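/- Consider the plant $x_{k+1}=Ax_k+Bu_k+w_k$ with $x_k\in\mathbb R^n$, $u_k\in\mathbb R^m$, spectral radius $\rho(A)>1$, and independent disturbances $w_k\sim N(0,R)$, where $R$ is positive definite. In every slot $k$ a half-duplex controller schedules either the sensor (uplink, $a_k=1$) or its own transmission (downlink, $a_k=2$). The uplink and downlink channels are independent finite-state Markov chains $h_{s,k}\in\{1,\dots,B_s\}$, $h_{c,k}\in\{1,\dots,B_c\}$, unaffected by the actions and independent of the disturbances; a packet scheduled in slot $k$ is lost with probability $\omega_{h_{s,k}}$ (uplink) or $\xi_{h_{c,k}}$ (downlink). The estimate is $\hat x_{k+1}=Ax_k+Bu_k$ if a sensor packet is received in slot $k$, and $\hat x_{k+1}=A\hat x_k+Bu_k$ otherwise. The actuator holds a buffer of $v\ge 1$ commands: if a control packet is received in slot $k$, the buffer becomes $[K\hat x_k,K(A+BK)\hat x_k,\dots,K(A+BK)^{v-1}\hat x_k]$; otherwise it is shifted forward by one and padded with $0$. The input $u_k$ is the first command in the buffer. The plant is $v$-step controllable: $(A+BK)^v=0$. The state of the scheduling problem is $(\tau^0_k,\dots,\tau^{v-1}_k,\phi^0_k,\dots,\phi^{v-1}_k,h_{s,k},h_{c,k})$.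 Here $\tau^0_k$ is the number of slots since the latest received sensor packet, and, with $t^1_k>t^2_k>\cdots$ the slots before $k$ in which a control packet was received and $t^0_k=k$, $\tau^i_k=\tau^0_{t^i_k}$ and $\phi^i_k=t^i_k-t^{i+1}_k+\tau^{i+1}_k$. At time $0$ at least $v$ control packets have already been received, the $v$-th latest of them after some received sensor packet. A stationary deterministic policy is a map from states to actions. It stabilizes the plant if, from every initial state, the average cost $J=\limsup_{N\to\infty}\frac1N\sum_{k=0}^{N-1}\mathbb E[x_k^\top Qx_k]$ is finite, where $Q$ is positive definite; it is optimal if, from every initial state, $J$ is minimal among all (possibly randomized) policies that choose $a_k$ from the channel states up to slot $k$ and the actions and packet receptions before slot $k$. Then: (a) if there is an optimal stationary deterministic policy that stabilizes the plant, then $\max\{\min_i\omega_i,\min_j\xi_j\}<1/\rho^2(A)$; (b) if $\max\{\max_i\omega_i,\max_j\xi_j\}<1/\rho^2(A)$, then there is an optimal stationary deterministic policy that stabilizes the plant. -/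

import Mathlib

open scoped ENNReal Matrix

namespace WNCS

noncomputable section

/-- The half-duplex choice made in a slot: `sense` schedules the sensor (uplink, `a = 1`),
`control` schedules the controller (downlink, `a = 2`). -/
inductive Action
  | sense
  | control
  deriving DecidableEq

/-- What happened in a slot: the action, and whether the scheduled packet was received. -/
abbrev Outcome := Action × Bool

/-- The sensor was scheduled and its packet arrived (`δ = 1`). -/
def sensed : Outcome := (Action.sense, true)

/-- The controller was scheduled and its packet arrived (`γ = 1`). -/
def controlled : Outcome := (Action.control, true)

/-- Data of a wireless networked control system over finite-state Markov fading channels: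
`n` plant states, `m` inputs, prediction length `v`, `Bs` uplink and `Bc` downlink channel states.
`ds i` and `dc j` are the laws of the next channel state given the current one;
`ω i` and `ξ j` are the packet-loss probabilities in each channel state. -/
structure System (n m v Bs Bc : ℕ) where
  A : Matrix (Fin n) (Fin n) ℝ
  B : Matrix (Fin n) (Fin m) ℝ
  K : Matrix (Fin m) (Fin n) ℝ
  Q : Matrix (Fin n) (Fin n) ℝ
  R : Matrix (Fin n) (Fin n) ℝ
  ds : Fin Bs → PMF (Fin Bs)
  dc : Fin Bc → PMF (Fin Bc)
  ω : Fin Bs → unitInterval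
  ξ : Fin Bc → unitInterval

/-- The spectral radius of a real square matrix (largest modulus of a complex eigenvalue). -/
def rho {n : ℕ} (A : Matrix (Fin n) (Fin n) ℝ) : ℝ :=
  (spectralRadius ℂ (A.map Complex.ofReal)).toReal

/-! ### The plant, the estimator and the command buffer -/

/-- Plant state, its estimate at the controller, and the actuator's command buffer as it was left
by the previous slot. -/
structure PlantState (n m v : ℕ) where
  x : Fin n → ℝ
  xhat : Fin n → ℝ
  buf : Fin v → Fin m → ℝ

variable {n m v Bs Bc : ℕ}

/-- The buffer used in the current slot: refilled with the predictive commands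
`K (A + B K) ^ i x̂` on a successful control packet, and shifted by one (padding with `0`)
otherwise. -/
def nextBuf (S : System n m v Bs Bc) (o : Outcome) (p : PlantState n m v) : Fin v → Fin m → ℝ :=
  fun i =>
    if o = controlled then S.K *ᵥ ((S.A + S.B * S.K) ^ (i : ℕ) *ᵥ p.xhat)
    else if h : (i : ℕ) + 1 < v then p.buf ⟨(i : ℕ) + 1, h⟩ else 0

/-- One slot of the closed loop with outcome `o` and disturbance `w`. -/
def plantStep [NeZero v] (S : System n m v Bs Bc) (o : Outcome) (w : Fin n → ℝ)
    (p : PlantState n m v) : PlantState n m v :=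
  let u : Fin m → ℝ := nextBuf S o p 0
  { x := S.A *ᵥ p.x + S.B *ᵥ u + w
    xhat := if o = sensed then S.A *ᵥ p.x + S.B *ᵥ u else S.A *ᵥ p.xhat + S.B *ᵥ u
    buf := nextBuf S o p }

/-- The closed loop after a list of slot outcomes (newest first), driven by the disturbances
`w 0, w 1, …`, and started at rest. -/
def plant [NeZero v] (S : System n m v Bs Bc) (w : ℕ → EuclideanSpace ℝ (Fin n)) :
    List Outcome → PlantState n m v
  | [] => { x := 0, xhat := 0, buf := 0 }
  | o :: l => plantStep S o (w l.length).ofLp (plant S w l)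

/-- The law of the disturbance: independent `N(0, R)` vectors. -/
def noise (S : System n m v Bs Bc) : MeasureTheory.Measure (ℕ → EuclideanSpace ℝ (Fin n)) :=
  MeasureTheory.Measure.infinitePi fun _ => ProbabilityTheory.multivariateGaussian 0 S.R

/-- `E[xᵀ Q x]` given the outcomes of all slots up to now; the expectation is over the
disturbances, which are independent of the channels and of the packet losses. -/
def quadCost [NeZero v] (S : System n m v Bs Bc) (l : List Outcome) : ℝ≥0∞ :=
  ∫⁻ w, ENNReal.ofReal ((plant S w l).x ⬝ᵥ (S.Q *ᵥ (plant S w l).x)) ∂(noise S)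

/-! ### The state of the scheduling problem -/

/-- The indicators `(τ⁰, …, τ^{v-1}, φ⁰, …, φ^{v-1})`. -/
@[ext]
structure Indicators (v : ℕ) where
  τ : Fin v → ℕ
  φ : Fin v → ℕ

/-- Update of the indicators in a slot with outcome `o`. -/
def indicatorsStep [NeZero v] (o : Outcome) (s : Indicators v) : Indicators v where
  τ := fun i =>
    if i = 0 then (if o = sensed then 1 else s.τ 0 + 1)
    else if o = controlled then s.τ ⟨(i : ℕ) - 1, by omega⟩ else s.τ i
  φ := fun i =>
    if i = 0 then (if o = controlled then s.τ 0 + 1 else s.φ 0 + 1)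
    else if o = controlled then s.φ ⟨(i : ℕ) - 1, by omega⟩ else s.φ i

/-- The indicators after a list of slot outcomes (newest first). The initial value is immaterial
for records satisfying `Warm`. -/
def indicators (v : ℕ) [NeZero v] : List Outcome → Indicators v
  | [] => { τ := 0, φ := 0 }
  | o :: l => indicatorsStep o (indicators v l)

/-- A record of past outcomes (newest first) in which there are at least `v` successful control
packets, the `v`-th latest of which was preceded by a successful sensor packet: all indicators,
and the covariances of the plant state and of the estimation error, are then determined
by the record, whatever happened before it. -/
def Warm (v : ℕ) (past : List Outcome) : Prop :=
  ∃ recent older : List Outcome,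
    past = recent ++ older ∧ v ≤ recent.count controlled ∧ sensed ∈ older

/-! ### Policies and the average cost -/

/-- The current states of the uplink and of the downlink channel. -/
abbrev Channel (Bs Bc : ℕ) := Fin Bs × Fin Bc

/-- What the scheduler knows at the beginning of a slot: the channel states and outcomes of the
slots completed since time `0` (newest first), and the current channel states. -/
abbrev Info (Bs Bc : ℕ) := List (Channel Bs Bc × Outcome) × Channel Bs Bc

/-- An admissible scheduling policy: history-dependent and possibly randomized. -/
abbrev Policy (Bs Bc : ℕ) := Info Bs Bc → PMF Action

/-- A stationary deterministic policy: the action is a function of the current state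
`(τ⁰, …, τ^{v-1}, φ⁰, …, φ^{v-1}, h_s, h_c)`. -/
abbrev StationaryPolicy (v Bs Bc : ℕ) := Indicators v × Channel Bs Bc → Action

/-- Packet-loss probability of the scheduled transmission. -/
def lossProb (S : System n m v Bs Bc) (h : Channel Bs Bc) : Action → unitInterval
  | Action.sense => S.ω h.1
  | Action.control => S.ξ h.2

/-- The law of the success flag of a transmission with loss probability `p`. -/
def successLaw (p : unitInterval) : PMF Bool :=
  PMF.ofFintype (fun b => if b then ENNReal.ofReal (1 - p) else ENNReal.ofReal p) (by
    have h0 : (0 : ℝ) ≤ p := p.2.1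
    have h1 : (0 : ℝ) ≤ 1 - p := sub_nonneg.2 p.2.2
    simp [← ENNReal.ofReal_add h1 h0])

/-- The law of the next channel states; the two channels evolve independently of each other and
of the actions. -/
def channelLaw (S : System n m v Bs Bc) (h : Channel Bs Bc) : PMF (Channel Bs Bc) :=
  (S.ds h.1).bind fun i => (S.dc h.2).bind fun j => PMF.pure (i, j)

/-- The law of the scheduler's information at time `k` under the policy `π`, when the channels
start in `h₀`. -/
def law (S : System n m v Bs Bc) (π : Policy Bs Bc) (h₀ : Channel Bs Bc) : ℕ → PMF (Info Bs Bc)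
  | 0 => PMF.pure ([], h₀)
  | k + 1 =>
    (law S π h₀ k).bind fun I =>
      (π I).bind fun a =>
        (successLaw (lossProb S I.2 a)).bind fun ok =>
          (channelLaw S I.2).bind fun h' => PMF.pure ((I.2, (a, ok)) :: I.1, h')

/-- All outcomes up to now, when `past` is the record of the outcomes before time `0`. -/
def record (past : List Outcome) (I : Info Bs Bc) : List Outcome :=
  I.1.map Prod.snd ++ past

/-- The expected cost `E[x_kᵀ Q x_k]` at time `k`. -/
def stageCost [NeZero v] (S : System n m v Bs Bc) (π : Policy Bs Bc) (past : List Outcome)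
    (h₀ : Channel Bs Bc) (k : ℕ) : ℝ≥0∞ :=
  ∑' I, law S π h₀ k I * quadCost S (record past I)

/-- The long-term average cost `J`. -/
def avgCost [NeZero v] (S : System n m v Bs Bc) (π : Policy Bs Bc) (past : List Outcome)
    (h₀ : Channel Bs Bc) : ℝ≥0∞ :=
  Filter.limsup (fun N : ℕ => (∑ k ∈ Finset.range N, stageCost S π past h₀ k) / (N : ℝ≥0∞))
    Filter.atTop

/-- The policy that applies the stationary deterministic policy `f` in every slot. -/
def StationaryPolicy.toPolicy [NeZero v] (f : StationaryPolicy v Bs Bc) (past : List Outcome) :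
    Policy Bs Bc :=
  fun I => PMF.pure (f (indicators v (record past I), I.2))

/-- `f` stabilizes the plant: its average cost is finite from every initial state. -/
def Stabilizes [NeZero v] (S : System n m v Bs Bc) (f : StationaryPolicy v Bs Bc) : Prop :=
  ∀ past : List Outcome, Warm v past → ∀ h₀ : Channel Bs Bc,
    avgCost S (f.toPolicy past) past h₀ < ∞

/-- `f` is optimal: from every initial state its average cost is minimal among all admissible
policies. -/
def IsOptimal [NeZero v] (S : System n m v Bs Bc) (f : StationaryPolicy v Bs Bc) : Prop :=
  ∀ past : List Outcome, Warm v past → ∀ h₀ : Channel Bs Bc, ∀ π : Policy Bs Bc,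
    avgCost S (f.toPolicy past) past h₀ ≤ avgCost S π past h₀

end

end WNCS

/-!
The closed loop is linear, so the plant state is the superposition of the responses to the past
disturbances (`plant_eq`). The response to a disturbance is `A ^ j` until a control packet arrives
after a sensor packet, and it is multiplied by the nilpotent matrix `A + B K` from then on (`gain`).
Hence the expected cost of a record of outcomes is a sum of response costs over the windows formed
by its latest outcomes (`quadCost_eq`), and this sum is a function of the indicators
(`windowSum_energy_congr`).

Necessity. If all packets of one kind are lost with probability at least `1 / ρ ^ 2`, then, whatever
the policy, a disturbance of age `j` is uncontrolled with probability at least a constant times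
`ρ ^ (-2 j)`, while its response has squared size at least `ρ ^ (2 j)`. So the expected cost in slot
`k` is at least a constant times `k` (`exists_linear_le_stageCost`).

Sufficiency is proved by vanishing discount, on states made of a record of outcomes and a channel
state. As the channel may be reducible and periodic, the discounted value `val` is compared, for
each channel state separately, with its value at the empty record, which is minimal there because
the responses to old disturbances only add costs. Three facts bound the difference.

* Along every sequence of outcomes, the response to an old disturbance is dominated by the response
  to one new disturbance (`exists_pathSum_energy_append_le`). So the relative value of every record
  is at most a multiple of the effect `gap` of a single disturbance (`val_le_add_gap`), where the
  multiple is controlled by a Lyapunov function.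
* Alternating between the sensor until it succeeds and the controller until it succeeds keeps this
  Lyapunov function bounded in mean, uniformly over the paths of the channel, because loss
  probabilities below `1 / ρ ^ 2` outweigh the growth of `A ^ j` (`exists_lyapunov`). Hence `gap` is
  at most a constant plus a multiple of its mean after `k` slots (`gap_le`).
* The discounted sum of `gap` along the channel is the value of the plant at rest, which the
  alternating policy bounds by a constant over `1 - α`. With the ergodic decomposition of the
  channel, the Cesàro means of `gap` stay bounded, and so does `gap` (`exists_gap_bound`).

In the limit this gives an optimality equation whose right-hand side depends on the channel state
only (`exists_optimality_equation`). A minimizing action in it is a function of the indicators and of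
the channel state, its average cost is the invariant part of the right-hand side, and no policy does
better, as Cesàro means dominate discounted means (`exists_sum_pow_mul_le`).
-/

namespace WNCS

/-! ### Superposition of the responses to the disturbances -/

noncomputable section

variable {n m v Bs Bc : ℕ}

/-- Has a disturbance that entered just before the outcomes `t` (newest first) been measured by
the sensor? -/
def seen : List Outcome → Prop
  | [] => False
  | o :: t => o = sensed ∨ seen t

/-- Has a disturbance that entered just before the outcomes `t` (newest first) been counteracted,
that is, has a control packet arrived after a sensor packet? -/
def acted : List Outcome → Prop
  | [] => False
  | o :: t => (o = controlled ∧ seen t) ∨ acted t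

lemma seen_of_acted {t : List Outcome} (h : acted t) : seen t := by
  induction t with
  | nil => exact h
  | cons o t ih =>
    rcases h with h | h
    · exact Or.inr h.2
    · exact Or.inr (ih h)

lemma seen_iff_mem {t : List Outcome} : seen t ↔ sensed ∈ t := by
  induction t with
  | nil => simp [seen]
  | cons o t ih => simp [seen, ih, eq_comm]

lemma controlled_ne_sensed : controlled ≠ sensed := by simp [controlled, sensed]

lemma mem_of_acted {t : List Outcome} (h : acted t) : controlled ∈ t := by
  induction t with
  | nil => exact h.elim
  | cons o t ih =>
    rcases h with h | h
    · simp [h.1]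
    · simp [ih h]

open Classical in
/-- The plant state `t.length` slots after a unit disturbance entered, as a matrix acting on the
disturbance, when the slots since then had the outcomes `t`. -/
def gain (S : System n m v Bs Bc) : List Outcome → Matrix (Fin n) (Fin n) ℝ
  | [] => 1
  | o :: t => if acted (o :: t) then (S.A + S.B * S.K) * gain S t else S.A * gain S t

open Classical in
/-- The contribution of a disturbance to the state for which the command of the latest slot was
computed; it vanishes as long as the controller has not reacted to the disturbance. -/
def target (S : System n m v Bs Bc) : List Outcome → Matrix (Fin n) (Fin n) ℝ
  | [] => 0
  | o :: t => if acted (o :: t) then gain S t else 0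

open Classical in
/-- The contribution of a disturbance to the estimate. -/
def estGain (S : System n m v Bs Bc) (t : List Outcome) : Matrix (Fin n) (Fin n) ℝ :=
  if seen t then gain S t else 0

lemma gain_cons (S : System n m v Bs Bc) (o : Outcome) (t : List Outcome) :
    gain S (o :: t) = S.A * gain S t + S.B * (S.K * target S (o :: t)) := by
  by_cases h : acted (o :: t)
  · simp [gain, target, h, add_mul, Matrix.mul_assoc]
  · simp [gain, target, h]

lemma gain_eq_mul_target (S : System n m v Bs Bc) {t : List Outcome} (h : acted t) :
    gain S t = (S.A + S.B * S.K) * target S t := by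
  cases t with
  | nil => exact h.elim
  | cons o t => simp [gain, target, h]

lemma target_controlled (S : System n m v Bs Bc) (t : List Outcome) :
    target S (controlled :: t) = estGain S t := by
  by_cases h : seen t
  · have : acted (controlled :: t) := Or.inl ⟨rfl, h⟩
    simp [target, estGain, h, this]
  · have : ¬ acted (controlled :: t) := by
      rintro (h' | h')
      · exact h h'.2
      · exact h (seen_of_acted h')
    simp [target, estGain, h, this]

lemma target_of_ne (S : System n m v Bs Bc) {o : Outcome} (ho : o ≠ controlled)
    (t : List Outcome) : target S (o :: t) = (S.A + S.B * S.K) * target S t := by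
  by_cases h : acted t
  · have : acted (o :: t) := Or.inr h
    rw [← gain_eq_mul_target S h]
    simp [target, this]
  · have h' : ¬ acted (o :: t) := by
      rintro (h' | h')
      · exact ho h'.1
      · exact h h'
    have h2 : target S t = 0 := by cases t <;> simp_all [target]
    rw [h2, mul_zero, target, if_neg h']

lemma estGain_sensed (S : System n m v Bs Bc) (t : List Outcome) :
    estGain S (sensed :: t) = gain S (sensed :: t) := by
  have : seen (sensed :: t) := Or.inl rfl
  simp [estGain, this]

lemma estGain_of_ne (S : System n m v Bs Bc) {o : Outcome} (ho : o ≠ sensed)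
    (t : List Outcome) :
    estGain S (o :: t) = S.A * estGain S t + S.B * (S.K * target S (o :: t)) := by
  by_cases h : seen t
  · have : seen (o :: t) := Or.inr h
    simp [estGain, h, this, gain_cons]
  · have h1 : ¬ seen (o :: t) := by rintro (h' | h'); exacts [ho h', h h']
    have h2 : ¬ acted (o :: t) := fun h' => h1 (seen_of_acted h')
    simp [estGain, h, h1, target, h2]

/-- The superposition of the responses `F` to all past disturbances. -/
def superpose (F : List Outcome → Matrix (Fin n) (Fin n) ℝ) (w : ℕ → EuclideanSpace ℝ (Fin n))
    (l : List Outcome) : Fin n → ℝ :=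
  ∑ j ∈ Finset.range l.length, F (l.take j) *ᵥ (w (l.length - 1 - j)).ofLp

lemma superpose_cons (F : List Outcome → Matrix (Fin n) (Fin n) ℝ)
    (w : ℕ → EuclideanSpace ℝ (Fin n)) (o : Outcome) (l : List Outcome) :
    superpose F w (o :: l)
      = superpose (fun t => F (o :: t)) w l + F [] *ᵥ (w l.length).ofLp := by
  simp only [superpose, List.length_cons, Finset.sum_range_succ']
  simp [Nat.sub_sub, add_comm]

lemma superpose_add (F F' : List Outcome → Matrix (Fin n) (Fin n) ℝ)
    (w : ℕ → EuclideanSpace ℝ (Fin n)) (l : List Outcome) :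
    superpose (fun t => F t + F' t) w l = superpose F w l + superpose F' w l := by
  simp [superpose, Matrix.add_mulVec, Finset.sum_add_distrib]

lemma superpose_mul {k : ℕ} (M : Matrix (Fin k) (Fin n) ℝ) (L : Matrix (Fin n) (Fin k) ℝ)
    (F : List Outcome → Matrix (Fin n) (Fin n) ℝ)
    (w : ℕ → EuclideanSpace ℝ (Fin n)) (l : List Outcome) :
    superpose (fun t => L * (M * F t)) w l = L *ᵥ (M *ᵥ superpose F w l) := by
  simp only [superpose]
  rw [Matrix.mulVec_mulVec, ← Matrix.mulVecLin_apply, map_sum]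
  simp

lemma superpose_mul' (M : Matrix (Fin n) (Fin n) ℝ)
    (F : List Outcome → Matrix (Fin n) (Fin n) ℝ)
    (w : ℕ → EuclideanSpace ℝ (Fin n)) (l : List Outcome) :
    superpose (fun t => M * F t) w l = M *ᵥ superpose F w l := by
  simpa using superpose_mul 1 M F w l

/-- The plant state, the estimate and the buffered commands are superpositions of the responses to
the individual disturbances. -/
theorem plant_eq [NeZero v] (S : System n m v Bs Bc) (hK : (S.A + S.B * S.K) ^ v = 0)
    (w : ℕ → EuclideanSpace ℝ (Fin n)) (l : List Outcome) :
    (plant S w l).x = superpose (gain S) w l ∧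
    (plant S w l).xhat = superpose (estGain S) w l ∧
    ∀ i, (plant S w l).buf i =
      S.K *ᵥ ((S.A + S.B * S.K) ^ (i : ℕ) *ᵥ superpose (target S) w l) := by
  induction l with
  | nil => simp [plant, superpose]
  | cons o l ih =>
    obtain ⟨ih1, ih2, ih3⟩ := ih
    have hbuf : ∀ i, nextBuf S o (plant S w l) i =
        S.K *ᵥ ((S.A + S.B * S.K) ^ (i : ℕ) *ᵥ superpose (target S) w (o :: l)) := by
      intro i
      rw [superpose_cons]
      by_cases ho : o = controlled
      · subst ho
        have : (fun t => target S (controlled :: t)) = estGain S :=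
          funext (target_controlled S)
        rw [this]
        simp [nextBuf, ih2, target]
      · have : (fun t => target S (o :: t)) = fun t => (S.A + S.B * S.K) * target S t :=
          funext (target_of_ne S ho)
        rw [this, superpose_mul']
        simp only [nextBuf, ho, if_false, target, Matrix.zero_mulVec, add_zero]
        rw [Matrix.mulVec_mulVec _ (_ ^ _), ← pow_succ]
        split_ifs with h
        · rw [ih3]
        · -- the buffer is exhausted: the padding agrees with the dead-beat prediction
          have : (i : ℕ) + 1 = v := by omega
          rw [this, hK]; simp
    have hx : S.A *ᵥ (plant S w l).x + S.B *ᵥ nextBuf S o (plant S w l) 0 =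
        superpose (fun t => gain S (o :: t)) w l := by
      have : (fun t => gain S (o :: t)) =
          fun t => S.A * gain S t + S.B * (S.K * target S (o :: t)) := funext (gain_cons S o)
      rw [this, superpose_add, superpose_mul', superpose_mul, ih1, hbuf, superpose_cons]
      simp [target]
    refine ⟨?_, ?_, hbuf⟩
    · rw [superpose_cons, ← hx]
      simp [plant, plantStep, gain]
    · rw [superpose_cons]
      by_cases ho : o = sensed
      · subst ho
        have h1 : (fun t => estGain S (sensed :: t)) = fun t => gain S (sensed :: t) :=
          funext (estGain_sensed S)
        rw [h1, ← hx]
        simp [plant, plantStep, estGain, seen]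
      · have : (fun t => estGain S (o :: t)) =
            fun t => S.A * estGain S t + S.B * (S.K * target S (o :: t)) :=
          funext (estGain_of_ne S ho)
        rw [this, superpose_add, superpose_mul', superpose_mul, ← ih2]
        simp [plant, plantStep, estGain, seen, ho, hbuf, superpose_cons, target]

/-- The expected cost of the response to a single disturbance after the outcomes `t`. -/
def energy (S : System n m v Bs Bc) (t : List Outcome) : ℝ :=
  ((gain S t)ᵀ * S.Q * gain S t * S.R).trace

/-- The sum of `f` over the proper initial segments of `l` (the latest `j` outcomes,
`j < l.length`). -/
def windowSum (f : List Outcome → ℝ) (l : List Outcome) : ℝ :=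
  ∑ j ∈ Finset.range l.length, f (l.take j)

open MeasureTheory ProbabilityTheory

lemma memLp_coord (S : System n m v Bs Bc) (j : ℕ) (a : Fin n) :
    MemLp (fun w : ℕ → EuclideanSpace ℝ (Fin n) => (w j).ofLp a) 2 (noise S) := by
  have h : MemLp (fun y : EuclideanSpace ℝ (Fin n) => y.ofLp a) 2 (multivariateGaussian 0 S.R) :=
    IsGaussian.memLp_dual (multivariateGaussian 0 S.R) (EuclideanSpace.proj a) 2 (by simp)
  exact h.comp_measurePreserving (measurePreserving_eval_infinitePi _ j)

lemma integral_coord (S : System n m v Bs Bc) (j : ℕ) (a : Fin n) :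
    ∫ w, (w j).ofLp a ∂(noise S) = 0 := by
  have h := (measurePreserving_eval_infinitePi
    (fun _ : ℕ => multivariateGaussian (0 : EuclideanSpace ℝ (Fin n)) S.R) j)
  have h2 : ∫ y : EuclideanSpace ℝ (Fin n), y.ofLp a ∂(multivariateGaussian 0 S.R) = 0 := by
    have := ContinuousLinearMap.integral_comp_comm (EuclideanSpace.proj (𝕜 := ℝ) a)
      (IsGaussian.integrable_id (μ := multivariateGaussian (0 : EuclideanSpace ℝ (Fin n)) S.R))
    simpa using this
  rw [← h2, ← h.map_eq, integral_map h.measurable.aemeasurable (by fun_prop)]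
  rfl

lemma integral_coord_mul (S : System n m v Bs Bc) (hR : S.R.PosDef) (i j : ℕ) (a b : Fin n) :
    ∫ w, (w i).ofLp a * (w j).ofLp b ∂(noise S) = if i = j then S.R a b else 0 := by
  split_ifs with hij
  · subst hij
    have h := (measurePreserving_eval_infinitePi
      (fun _ : ℕ => multivariateGaussian (0 : EuclideanSpace ℝ (Fin n)) S.R) i)
    have h2 : ∫ y : EuclideanSpace ℝ (Fin n), y.ofLp a * y.ofLp b
        ∂(multivariateGaussian 0 S.R) = S.R a b := by
      rw [← covariance_eval_multivariateGaussian (μ := 0) hR.posSemidef a b, covariance]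
      have h3 : ∀ c, ∫ y : EuclideanSpace ℝ (Fin n), y.ofLp c
          ∂(multivariateGaussian 0 S.R) = 0 := by
        intro c
        have := ContinuousLinearMap.integral_comp_comm (EuclideanSpace.proj (𝕜 := ℝ) c)
          (IsGaussian.integrable_id (μ := multivariateGaussian (0 : EuclideanSpace ℝ (Fin n)) S.R))
        simpa using this
      simp [h3]
    rw [← h2, ← h.map_eq, integral_map h.measurable.aemeasurable (by fun_prop)]
    rfl
  · have hind : iIndepFun (fun k (w : ℕ → EuclideanSpace ℝ (Fin n)) => w k) (noise S) :=
      iIndepFun_infinitePi (X := fun _ x => x) (by fun_prop)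
    have h2 := (hind.indepFun hij).comp (φ := fun y => y.ofLp a) (ψ := fun y => y.ofLp b)
      (by fun_prop) (by fun_prop)
    have h3 := h2.integral_mul_eq_mul_integral (memLp_coord S i a).1 (memLp_coord S j b).1
    have h4 := integral_coord S i a
    simp only [Function.comp_def, Pi.mul_def] at h3
    rw [h3, h4, zero_mul]

instance (S : System n m v Bs Bc) : IsProbabilityMeasure (noise S) := by
  unfold noise; infer_instance

/-- The expected cost is the sum of the costs of the responses to the individual disturbances. -/
theorem quadCost_eq [NeZero v] (S : System n m v Bs Bc) (hQ : S.Q.PosDef) (hR : S.R.PosDef)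
    (hK : (S.A + S.B * S.K) ^ v = 0) (l : List Outcome) :
    quadCost S l = ENNReal.ofReal (windowSum (energy S) l) := by
  have hx : ∀ w, (plant S w l).x ⬝ᵥ (S.Q *ᵥ (plant S w l).x) =
      ∑ j ∈ Finset.range l.length, ∑ j' ∈ Finset.range l.length, ∑ a, ∑ b,
        ((gain S (l.take j))ᵀ * S.Q * gain S (l.take j')) a b *
          ((w (l.length - 1 - j)).ofLp a * (w (l.length - 1 - j')).ofLp b) := by
    intro w
    rw [(plant_eq S hK w l).1, superpose, ← Matrix.mulVecLin_apply S.Q, map_sum, sum_dotProduct]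
    refine Finset.sum_congr rfl fun j _ => ?_
    rw [dotProduct_sum]
    refine Finset.sum_congr rfl fun j' _ => ?_
    have h : ∀ y z : Fin n → ℝ, (gain S (l.take j) *ᵥ y) ⬝ᵥ (S.Q *ᵥ (gain S (l.take j') *ᵥ z)) =
        y ⬝ᵥ (((gain S (l.take j))ᵀ * S.Q * gain S (l.take j')) *ᵥ z) := by
      intro y z
      rw [← Matrix.vecMul_transpose, ← Matrix.dotProduct_mulVec, Matrix.mulVec_mulVec,
        Matrix.mulVec_mulVec, Matrix.mul_assoc]
    rw [Matrix.mulVecLin_apply, h]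
    simp only [dotProduct, Matrix.mulVec, Finset.mul_sum]
    exact Finset.sum_congr rfl fun a _ => Finset.sum_congr rfl fun b _ => by ring
  have hint : ∀ j j' a b, Integrable (fun w : ℕ → EuclideanSpace ℝ (Fin n) =>
      ((gain S (l.take j))ᵀ * S.Q * gain S (l.take j')) a b *
          ((w (l.length - 1 - j)).ofLp a * (w (l.length - 1 - j')).ofLp b)) (noise S) :=
    fun j j' a b => ((memLp_coord S _ a).integrable_mul (memLp_coord S _ b)).const_mul _
  rw [quadCost, ← ofReal_integral_eq_lintegral_ofReal]
  · congr 1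
    simp_rw [hx]
    rw [integral_finsetSum _ fun j _ => integrable_finsetSum _ fun j' _ =>
      integrable_finsetSum _ fun a _ => integrable_finsetSum _ fun b _ => hint j j' a b]
    refine Finset.sum_congr rfl fun j hj => ?_
    rw [integral_finsetSum _ fun j' _ =>
      integrable_finsetSum _ fun a _ => integrable_finsetSum _ fun b _ => hint j j' a b]
    rw [Finset.sum_eq_single_of_mem j hj]
    · rw [integral_finsetSum _ fun a _ => integrable_finsetSum _ fun b _ => hint j j a b]
      rw [energy, Matrix.trace]
      refine Finset.sum_congr rfl fun a _ => ?_
      rw [integral_finsetSum _ fun b _ => hint j j a b, Matrix.diag_apply, Matrix.mul_apply]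
      refine Finset.sum_congr rfl fun b _ => ?_
      rw [integral_const_mul, integral_coord_mul S hR, if_pos rfl]
      congr 1
      simpa using (hR.isHermitian.apply a b).symm
    · intro j' hj' hne
      rw [integral_finsetSum _ fun a _ => integrable_finsetSum _ fun b _ => hint j j' a b]
      refine Finset.sum_eq_zero fun a _ => ?_
      rw [integral_finsetSum _ fun b _ => hint j j' a b]
      refine Finset.sum_eq_zero fun b _ => ?_
      rw [integral_const_mul, integral_coord_mul S hR, if_neg, mul_zero]
      simp only [Finset.mem_range] at hj hj'
      omega
  · simp_rw [hx]
    exact integrable_finsetSum _ fun j _ => integrable_finsetSum _ fun j' _ =>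
      integrable_finsetSum _ fun a _ => integrable_finsetSum _ fun b _ => hint j j' a b
  · exact Filter.Eventually.of_forall fun w => by
      simpa using hQ.posSemidef.dotProduct_mulVec_nonneg (plant S w l).x

end

/-! ### The cost as a function of the indicators -/

noncomputable section

variable {n m v Bs Bc : ℕ}

/-- The number of slots since the `r`-th latest received control packet, with `ctlAge l 0 = 0`.
The time before the record counts as one in which packets of both kinds were received in
abundance; this agrees with a plant that starts at rest. -/
def ctlAge : List Outcome → ℕ → ℕ
  | [], _ => 0
  | _ :: _, 0 => 0
  | o :: l, r + 1 => if o = controlled then ctlAge l r + 1 else ctlAge l (r + 1) + 1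

/-- The number of slots since the latest sensor packet that was received before the `r`-th latest
control packet (before now, for `r = 0`). -/
def infoAge : List Outcome → ℕ → ℕ
  | [], _ => 0
  | o :: l, 0 => if o = sensed then 1 else infoAge l 0 + 1
  | o :: l, r + 1 => if o = controlled then infoAge l r + 1 else infoAge l (r + 1) + 1

@[simp] lemma ctlAge_zero (l : List Outcome) : ctlAge l 0 = 0 := by cases l <;> rfl

/-- The indicators of the scheduling problem are differences of ages. -/
lemma indicators_add_ctlAge [NeZero v] (l : List Outcome) (i : Fin v) :
    (indicators v l).τ i + ctlAge l i = infoAge l i ∧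
    (indicators v l).φ i + ctlAge l i = infoAge l (i + 1) := by
  induction l generalizing i with
  | nil => simp [indicators, ctlAge, infoAge]
  | cons o l ih =>
    obtain ⟨i, hi⟩ := i
    cases i with
    | zero =>
      have h0 := ih 0
      have : (⟨0, hi⟩ : Fin v) = 0 := by ext; simp
      simp only [this, indicators, indicatorsStep]
      by_cases h1 : o = sensed
      · subst h1
        simp_all [infoAge, controlled_ne_sensed.symm]
      · by_cases h2 : o = controlled <;> simp_all [infoAge]
    | succ i =>
      have h0 := ih ⟨i, by omega⟩
      have h1 := ih ⟨i + 1, hi⟩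
      have : (⟨i + 1, hi⟩ : Fin v) ≠ 0 := by
        intro h; simpa using congrArg Fin.val h
      simp only [this, indicators, indicatorsStep, if_false]
      by_cases h2 : o = controlled
      · simp only [h2, if_true, infoAge, ctlAge] at h0 ⊢
        simp only [Nat.add_sub_cancel]
        omega
      · simp only [h2, if_false, infoAge, ctlAge] at h1 ⊢
        omega

lemma infoAge_mono (l : List Outcome) (r : ℕ) : infoAge l r ≤ infoAge l (r + 1) := by
  induction l generalizing r with
  | nil => simp [infoAge]
  | cons o l ih =>
    cases r with
    | zero =>
      by_cases h1 : o = sensed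
      · subst h1; simp [infoAge, controlled_ne_sensed.symm]
      · by_cases h2 : o = controlled
        · simp [infoAge, h2, controlled_ne_sensed]
        · simpa [infoAge, h1, h2] using ih 0
    | succ r =>
      have h0 := ih r
      have h1 := ih (r + 1)
      by_cases h2 : o = controlled <;> simp [infoAge, h2] <;> omega

lemma infoAge_monotone (l : List Outcome) : Monotone (infoAge l) :=
  monotone_nat_of_le_succ (infoAge_mono l)

lemma infoAge_le_length (l : List Outcome) (r : ℕ) : infoAge l r ≤ l.length := by
  induction l generalizing r with
  | nil => simp [infoAge]
  | cons o l ih =>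
    cases r with
    | zero =>
      have := ih 0
      by_cases h : o = sensed <;> simp [infoAge, h, this]
    | succ r =>
      have h0 := ih r
      have h1 := ih (r + 1)
      by_cases h2 : o = controlled <;> simp [infoAge, h2] <;> omega

lemma infoAge_cons_pos (o : Outcome) (l : List Outcome) (r : ℕ) : 0 < infoAge (o :: l) r := by
  cases r with
  | zero => by_cases h : o = sensed <;> simp [infoAge, h]
  | succ r => by_cases h : o = controlled <;> simp [infoAge, h]

lemma seen_take_iff {l : List Outcome} {j : ℕ} (hj : j < l.length) :
    seen (l.take j) ↔ infoAge l 0 ≤ j := by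
  induction l generalizing j with
  | nil => simp at hj
  | cons o l ih =>
    cases j with
    | zero =>
      have := infoAge_cons_pos o l 0
      simp [seen]; omega
    | succ j =>
      have := ih (j := j) (by simpa using hj)
      by_cases h : o = sensed <;> simp [seen, infoAge, h, this]

lemma acted_take_iff {l : List Outcome} {j : ℕ} (hj : j < l.length) :
    acted (l.take j) ↔ infoAge l 1 ≤ j := by
  induction l generalizing j with
  | nil => simp at hj
  | cons o l ih =>
    cases j with
    | zero =>
      have := infoAge_cons_pos o l 1
      simp [acted]; omega
    | succ j =>
      have hj' : j < l.length := by simpa using hj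
      have h1 := ih hj'
      have h2 := seen_take_iff hj'
      have h3 : infoAge l 0 ≤ infoAge l 1 := infoAge_mono l 0
      by_cases h : o = controlled
      · simp [acted, infoAge, h, h1, h2]; omega
      · simp [acted, infoAge, h, h1]

lemma gain_of_not_acted (S : System n m v Bs Bc) {t : List Outcome} (h : ¬ acted t) :
    gain S t = S.A ^ t.length := by
  induction t with
  | nil => simp [gain]
  | cons o t ih =>
    rw [gain, if_neg h, ih fun h' => h (Or.inr h'), List.length_cons, pow_succ']

lemma gain_cons_of_acted (S : System n m v Bs Bc) {o : Outcome} {t : List Outcome}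
    (h : acted (o :: t)) : gain S (o :: t) = (S.A + S.B * S.K) * gain S t := by
  rw [gain, if_pos h]

/-- A disturbance that entered between the sensor packets used by the `r+1`-st and by the `r`-th
latest control packets was propagated in open loop until the `r`-th latest control packet, and by
the closed-loop matrix from then on. -/
lemma gain_take_eq (S : System n m v Bs Bc) {l : List Outcome} {j r : ℕ} (hj : j < l.length)
    (hr : 1 ≤ r) (h1 : infoAge l r ≤ j) (h2 : j < infoAge l (r + 1)) :
    ctlAge l r ≤ j ∧
    gain S (l.take j) = (S.A + S.B * S.K) ^ ctlAge l r * S.A ^ (j - ctlAge l r) := by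
  induction l generalizing j r with
  | nil => simp at hj
  | cons o l ih =>
    have hact : acted ((o :: l).take j) :=
      (acted_take_iff hj).2 ((infoAge_monotone _ hr).trans h1)
    cases j with
    | zero => exact absurd (infoAge_cons_pos o l r) (by omega)
    | succ j =>
      have hj' : j < l.length := by simpa using hj
      rw [List.take_succ_cons] at hact ⊢
      rw [gain_cons_of_acted S hact]
      obtain ⟨r, rfl⟩ : ∃ r', r = r' + 1 := ⟨r - 1, by omega⟩
      by_cases h : o = controlled
      · simp only [infoAge, h, if_true] at h1 h2
        simp only [ctlAge, h, if_true]
        rcases Nat.eq_zero_or_pos r with rfl | hr'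
        · rw [zero_add] at h2
          have hna : ¬ acted (l.take j) := by rw [acted_take_iff hj']; omega
          rw [gain_of_not_acted S hna]
          simp [hj'.le]
        · obtain ⟨h3, h4⟩ := ih hj' hr' (by omega) (by omega)
          refine ⟨by omega, ?_⟩
          rw [h4, ← Matrix.mul_assoc, ← pow_succ', Nat.add_sub_add_right]
      · simp only [infoAge, h, if_false] at h1 h2
        simp only [ctlAge, h, if_false]
        obtain ⟨h3, h4⟩ := ih hj' hr (by omega) (by omega)
        refine ⟨by omega, ?_⟩
        rw [h4, ← Matrix.mul_assoc, ← pow_succ', Nat.add_sub_add_right]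

lemma gain_take_eq_pow_mul (S : System n m v Bs Bc) {l : List Outcome} {j r : ℕ}
    (hj : j < l.length) (hr : 1 ≤ r) (h1 : infoAge l r ≤ j) :
    ∃ X, gain S (l.take j) = (S.A + S.B * S.K) ^ r * X := by
  induction l generalizing j r with
  | nil => simp at hj
  | cons o l ih =>
    have hact : acted ((o :: l).take j) :=
      (acted_take_iff hj).2 ((infoAge_monotone _ hr).trans h1)
    cases j with
    | zero => exact absurd (infoAge_cons_pos o l r) (by omega)
    | succ j =>
      have hj' : j < l.length := by simpa using hj
      rw [List.take_succ_cons] at hact ⊢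
      rw [gain_cons_of_acted S hact]
      obtain ⟨r, rfl⟩ : ∃ r', r = r' + 1 := ⟨r - 1, by omega⟩
      by_cases h : o = controlled
      · simp only [infoAge, h, if_true] at h1
        rcases Nat.eq_zero_or_pos r with rfl | hr'
        · exact ⟨gain S (l.take j), by simp⟩
        · obtain ⟨X, hX⟩ := ih hj' hr' (by omega)
          exact ⟨X, by rw [hX, ← Matrix.mul_assoc, ← pow_succ']⟩
      · simp only [infoAge, h, if_false] at h1
        obtain ⟨X, hX⟩ := ih hj' hr (by omega)
        refine ⟨(S.A + S.B * S.K) * X, ?_⟩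
        rw [hX, ← Matrix.mul_assoc, ← Matrix.mul_assoc, ← pow_succ', ← pow_succ]

lemma ages_congr [NeZero v] {l l' : List Outcome} (h : indicators v l = indicators v l') :
    (∀ r < v, ctlAge l r = ctlAge l' r) ∧ ∀ r < v, infoAge l (r + 1) = infoAge l' (r + 1) := by
  have key : ∀ r < v, ctlAge l r = ctlAge l' r ∧ infoAge l (r + 1) = infoAge l' (r + 1) := by
    intro r
    induction r with
    | zero =>
      intro hr
      have h1 := (indicators_add_ctlAge l ⟨0, hr⟩).2
      have h2 := (indicators_add_ctlAge l' ⟨0, hr⟩).2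
      rw [h] at h1
      simp_all
    | succ r ih =>
      intro hr
      have h1 := indicators_add_ctlAge l ⟨r + 1, hr⟩
      have h2 := indicators_add_ctlAge l' ⟨r + 1, hr⟩
      have h3 := ih (by omega)
      rw [h] at h1
      simp only at h1 h2
      omega
  exact ⟨fun r hr => (key r hr).1, fun r hr => (key r hr).2⟩

/-- The expected cost is a function of the indicators. -/
theorem windowSum_energy_congr [NeZero v] (S : System n m v Bs Bc)
    (hK : (S.A + S.B * S.K) ^ v = 0) {l l' : List Outcome}
    (h : indicators v l = indicators v l') :
    windowSum (energy S) l = windowSum (energy S) l' := by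
  have hv : 1 ≤ v := Nat.one_le_iff_ne_zero.2 (NeZero.ne v)
  have trunc : ∀ l : List Outcome, windowSum (energy S) l =
      ∑ j ∈ Finset.range (infoAge l v), energy S (l.take j) := by
    intro l
    refine (Finset.sum_subset (Finset.range_mono (infoAge_le_length l v)) ?_).symm
    intro j hj hj'
    obtain ⟨X, hX⟩ := gain_take_eq_pow_mul S (Finset.mem_range.1 hj) hv (by simpa using hj')
    simp [energy, hX, hK]
  obtain ⟨hd, he⟩ := ages_congr h
  have hev : infoAge l v = infoAge l' v := by
    have := he (v - 1) (by omega)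
    rwa [Nat.sub_add_cancel hv] at this
  rw [trunc l, trunc l', ← hev]
  refine Finset.sum_congr rfl fun j hj => ?_
  have hj := Finset.mem_range.1 hj
  have hjl := hj.trans_le (infoAge_le_length l v)
  have hjl' := hj.trans_le (hev.le.trans (infoAge_le_length l' v))
  have : gain S (l.take j) = gain S (l'.take j) := by
    by_cases hj1 : j < infoAge l 1
    · have hj1' : j < infoAge l' 1 := by rwa [← he 0 (by omega)]
      rw [gain_of_not_acted S (by rw [acted_take_iff hjl]; omega),
        gain_of_not_acted S (by rw [acted_take_iff hjl']; omega)]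
      simp [hjl.le, hjl'.le]
    · classical
      have hex : ∃ r, j < infoAge l r := ⟨v, hj⟩
      have hr0 := Nat.find_spec hex
      have hrv : Nat.find hex ≤ v := Nat.find_min' hex hj
      have hr2 : 2 ≤ Nat.find hex := by
        rw [Nat.le_find_iff]
        intro r hr
        have := infoAge_monotone l (show r ≤ 1 by omega)
        omega
      obtain ⟨r, hr⟩ : ∃ r, Nat.find hex = r + 1 := ⟨Nat.find hex - 1, by omega⟩
      have hr1 : ¬ j < infoAge l r := Nat.find_min hex (by omega)
      rw [hr] at hr0
      have h1 : infoAge l r = infoAge l' r := by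
        have := he (r - 1) (by omega)
        rwa [Nat.sub_add_cancel (by omega)] at this
      have h2 := he r (by omega)
      rw [(gain_take_eq S hjl (r := r) (by omega) (by omega) hr0).2,
        (gain_take_eq S hjl' (r := r) (by omega) (by omega) (by omega)).2, hd r (by omega)]
  rw [energy, energy, this]

end

/-! ### Growth of matrix powers and of the response costs -/

noncomputable section

variable {n m v Bs Bc : ℕ}

open scoped Matrix.Norms.Operator

lemma eq_zero_of_conjugate_eq_zero {Q X : Matrix (Fin n) (Fin n) ℝ} (hQ : Q.PosDef)
    (h : Xᵀ * Q * X = 0) : X = 0 := by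
  refine Matrix.toLin'.injective (LinearMap.ext fun y => ?_)
  rw [Matrix.toLin'_apply, map_zero, LinearMap.zero_apply]
  by_contra hne
  have h1 := hQ.dotProduct_mulVec_pos hne
  have h2 : star (X *ᵥ y) ⬝ᵥ (Q *ᵥ (X *ᵥ y)) = y ⬝ᵥ ((Xᵀ * Q * X) *ᵥ y) := by
    simp [← Matrix.mulVec_mulVec, Matrix.dotProduct_mulVec, Matrix.vecMul_transpose]
  rw [h2, h] at h1
  simp at h1

lemma trace_conjugate_pos {Q R G : Matrix (Fin n) (Fin n) ℝ} (hQ : Q.PosDef) (hR : R.PosDef)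
    (hG : G ≠ 0) : 0 < (Gᵀ * Q * G * R).trace := by
  obtain ⟨C, hC⟩ : ∃ C : Matrix (Fin n) (Fin n) ℝ, R = Cᴴ * C := by
    open scoped MatrixOrder in
    exact CStarAlgebra.nonneg_iff_eq_star_mul_self.1 hR.posSemidef.nonneg
  have hC' : R = Cᵀ * C := by simpa using hC
  have hpsd : ((G * Cᵀ)ᵀ * Q * (G * Cᵀ)).PosSemidef := by
    simpa using hQ.posSemidef.conjTranspose_mul_mul_same (G * Cᵀ)
  have htr : (Gᵀ * Q * G * R).trace = ((G * Cᵀ)ᵀ * Q * (G * Cᵀ)).trace := by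
    rw [hC', ← Matrix.mul_assoc, Matrix.trace_mul_comm]
    simp [Matrix.mul_assoc]
  rw [htr]
  refine lt_of_le_of_ne hpsd.trace_nonneg fun h0 => hG ?_
  have h1 := eq_zero_of_conjugate_eq_zero hQ (hpsd.trace_eq_zero_iff.1 h0.symm)
  have h2 : G * R = 0 := by rw [hC', ← Matrix.mul_assoc, h1, zero_mul]
  have hu := hR.isUnit
  exact hu.mul_left_eq_zero.1 h2

/-- A continuous, positive, quadratically homogeneous function on a finite-dimensional space is
comparable to the square of the norm. -/
lemma exists_quadratic_bounds {E : Type*} [NormedAddCommGroup E] [NormedSpace ℝ E]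
    [FiniteDimensional ℝ E] [Nontrivial E] (φ : E → ℝ) (hφ : Continuous φ)
    (hpos : ∀ x, x ≠ 0 → 0 < φ x) (hhom : ∀ (t : ℝ) x, φ (t • x) = t ^ 2 * φ x) :
    ∃ c₁ c₂ : ℝ, 0 < c₁ ∧ 0 < c₂ ∧ ∀ x, c₁ * ‖x‖ ^ 2 ≤ φ x ∧ φ x ≤ c₂ * ‖x‖ ^ 2 := by
  have hK : IsCompact (Metric.sphere (0 : E) 1) := isCompact_sphere 0 1
  have hne : (Metric.sphere (0 : E) 1).Nonempty := NormedSpace.sphere_nonempty.2 zero_le_one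
  obtain ⟨y, hy, hmin⟩ := hK.exists_isMinOn hne hφ.continuousOn
  obtain ⟨z, hz, hmax⟩ := hK.exists_isMaxOn hne hφ.continuousOn
  have hne0 : ∀ x ∈ Metric.sphere (0 : E) 1, x ≠ 0 := by
    intro x hx h; simp [h] at hx
  refine ⟨φ y, φ z, hpos y (hne0 y hy), hpos z (hne0 z hz), fun x => ?_⟩
  by_cases hx : x = 0
  · have : φ 0 = 0 := by simpa using hhom 0 0
    simp [hx, this]
  have hx' : ‖x‖ ≠ 0 := norm_ne_zero_iff.2 hx
  have hu : ‖x‖⁻¹ • x ∈ Metric.sphere (0 : E) 1 := by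
    simp [norm_smul, inv_mul_cancel₀ hx']
  have hφx : φ x = ‖x‖ ^ 2 * φ (‖x‖⁻¹ • x) := by
    rw [← hhom, smul_smul, mul_inv_cancel₀ hx', one_smul]
  have h1 := hmin hu
  have h2 := hmax hu
  simp only [Set.mem_ofPred_eq] at h1 h2
  rw [hφx, mul_comm, mul_comm (φ z)]
  constructor <;> gcongr

lemma exists_energy_bounds [NeZero n] (S : System n m v Bs Bc) (hQ : S.Q.PosDef)
    (hR : S.R.PosDef) : ∃ c₁ c₂ : ℝ, 0 < c₁ ∧ 0 < c₂ ∧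
      ∀ t, c₁ * ‖gain S t‖ ^ 2 ≤ energy S t ∧ energy S t ≤ c₂ * ‖gain S t‖ ^ 2 := by
  obtain ⟨c₁, c₂, h1, h2, h⟩ := exists_quadratic_bounds
    (fun G : Matrix (Fin n) (Fin n) ℝ => (Gᵀ * S.Q * G * S.R).trace)
    (by fun_prop) (fun G hG => trace_conjugate_pos hQ hR hG)
    (fun t G => by simp [Matrix.trace_smul, pow_two, mul_assoc])
  exact ⟨c₁, c₂, h1, h2, fun t => h _⟩

lemma norm_map_ofReal (A : Matrix (Fin n) (Fin n) ℝ) : ‖A.map Complex.ofReal‖ = ‖A‖ := by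
  simp [Matrix.linfty_opNorm_def]

lemma map_ofReal_pow (A : Matrix (Fin n) (Fin n) ℝ) (j : ℕ) :
    (A ^ j).map Complex.ofReal = A.map Complex.ofReal ^ j :=
  map_pow (Complex.ofRealHom.mapMatrix) A j

lemma spectralRadius_ne_top [NeZero n] (A : Matrix (Fin n) (Fin n) ℝ) :
    spectralRadius ℂ (A.map Complex.ofReal) ≠ ∞ :=
  ((spectrum.spectralRadius_le_nnnorm _).trans_lt ENNReal.coe_lt_top).ne

lemma rho_pow_le_norm_pow [NeZero n] (A : Matrix (Fin n) (Fin n) ℝ) (j : ℕ) :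
    rho A ^ j ≤ ‖A ^ j‖ := by
  have h := (spectrum.spectralRadius_pow_le' (𝕜 := ℂ) (A.map Complex.ofReal) j).trans
    (spectrum.spectralRadius_le_nnnorm _)
  rw [← map_ofReal_pow] at h
  have h2 := ENNReal.toReal_mono ENNReal.coe_ne_top h
  rw [ENNReal.toReal_pow] at h2
  simpa [rho, norm_map_ofReal] using h2

/-- The powers of `A` grow at most at any rate exceeding the spectral radius. -/
lemma exists_norm_pow_sq_le [NeZero n] (A : Matrix (Fin n) (Fin n) ℝ) {r : ℝ}
    (hr : rho A ^ 2 < r) : ∃ C : ℝ, 0 < C ∧ ∀ j, ‖A ^ j‖ ^ 2 ≤ C * r ^ j := by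
  have hrho : 0 ≤ rho A := ENNReal.toReal_nonneg
  have hr0 : 0 < r := (sq_nonneg _).trans_lt hr
  have hlt : spectralRadius ℂ (A.map Complex.ofReal) < ENNReal.ofReal (√r) := by
    rw [← ENNReal.ofReal_toReal (spectralRadius_ne_top A)]
    exact (ENNReal.ofReal_lt_ofReal_iff (Real.sqrt_pos.2 hr0)).2 (Real.lt_sqrt_of_sq_lt hr)
  have hev := (spectrum.pow_norm_pow_one_div_tendsto_nhds_spectralRadius
    (A.map Complex.ofReal)).eventually (gt_mem_nhds hlt)
  obtain ⟨N, hN⟩ := Filter.eventually_atTop.1 hev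
  have hlarge : ∀ j, max N 1 ≤ j → ‖A ^ j‖ ^ 2 ≤ r ^ j := by
    intro j hj
    have hj0 : (j : ℝ) ≠ 0 := by
      have : 1 ≤ j := (le_max_right _ _).trans hj
      positivity
    have h := hN j ((le_max_left _ _).trans hj)
    rw [ENNReal.ofReal_lt_ofReal_iff (Real.sqrt_pos.2 hr0), ← map_ofReal_pow,
      norm_map_ofReal] at h
    have h2 : ‖A ^ j‖ ≤ √r ^ j := by
      have h3 := pow_le_pow_left₀ (by positivity) h.le j
      rwa [← Real.rpow_natCast (_ ^ _), ← Real.rpow_mul (norm_nonneg _), one_div,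
        inv_mul_cancel₀ hj0, Real.rpow_one] at h3
    calc ‖A ^ j‖ ^ 2 ≤ (√r ^ j) ^ 2 := by gcongr
      _ = r ^ j := by rw [← pow_mul, mul_comm, pow_mul, Real.sq_sqrt hr0.le]
  refine ⟨1 + ∑ j ∈ Finset.range (max N 1), ‖A ^ j‖ ^ 2 / r ^ j, by positivity, fun j => ?_⟩
  have hs : 0 ≤ ∑ j ∈ Finset.range (max N 1), ‖A ^ j‖ ^ 2 / r ^ j := by positivity
  by_cases hj : max N 1 ≤ j
  · have := hlarge j hj
    nlinarith [pow_pos hr0 j]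
  · have h1 : ‖A ^ j‖ ^ 2 / r ^ j ≤ ∑ j ∈ Finset.range (max N 1), ‖A ^ j‖ ^ 2 / r ^ j :=
      Finset.single_le_sum (f := fun j => ‖A ^ j‖ ^ 2 / r ^ j) (fun i _ => by positivity)
        (Finset.mem_range.2 (not_le.1 hj))
    rw [div_le_iff₀ (pow_pos hr0 j)] at h1
    nlinarith [pow_pos hr0 j]

/-- The powers of a nilpotent matrix decay at any geometric rate. -/
lemma exists_norm_pow_sq_le_of_nilpotent {N : Matrix (Fin n) (Fin n) ℝ} (hN : N ^ v = 0)
    {θ : ℝ} (hθ : 0 < θ) : ∃ C : ℝ, 0 < C ∧ ∀ j, ‖N ^ j‖ ^ 2 ≤ C * θ ^ j := by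
  refine ⟨1 + ∑ j ∈ Finset.range v, ‖N ^ j‖ ^ 2 / θ ^ j, by positivity, fun j => ?_⟩
  by_cases hj : v ≤ j
  · rw [pow_eq_zero_of_le hj hN]
    simp; positivity
  · have h1 : ‖N ^ j‖ ^ 2 / θ ^ j ≤ ∑ j ∈ Finset.range v, ‖N ^ j‖ ^ 2 / θ ^ j :=
      Finset.single_le_sum (f := fun j => ‖N ^ j‖ ^ 2 / θ ^ j) (fun i _ => by positivity)
        (Finset.mem_range.2 (not_le.1 hj))
    rw [div_le_iff₀ (pow_pos hθ j)] at h1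
    nlinarith [pow_pos hθ j]

end

/-! ### Necessity: linear growth of the stage costs -/

noncomputable section

variable {n m v Bs Bc : ℕ}

/-- The expectation of an extended nonnegative function under a discrete law. -/
def expect {α : Type*} (p : PMF α) (F : α → ℝ≥0∞) : ℝ≥0∞ := ∑' a, p a * F a

section expect

variable {α β : Type*}

@[simp] lemma expect_pure (a : α) (F : α → ℝ≥0∞) : expect (PMF.pure a) F = F a := by
  rw [expect, tsum_eq_single a]
  · simp
  · intro b hb; simp [PMF.pure_apply, hb]

lemma expect_bind (p : PMF α) (f : α → PMF β) (F : β → ℝ≥0∞) :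
    expect (p.bind f) F = expect p fun a => expect (f a) F := by
  simp only [expect, PMF.bind_apply, ← ENNReal.tsum_mul_right, ← ENNReal.tsum_mul_left]
  rw [ENNReal.tsum_comm]
  simp only [mul_assoc]

lemma expect_mono (p : PMF α) {F F' : α → ℝ≥0∞} (h : ∀ a, F a ≤ F' a) :
    expect p F ≤ expect p F' :=
  ENNReal.tsum_le_tsum fun a => mul_le_mul_right (h a) _

lemma expect_add (p : PMF α) (F F' : α → ℝ≥0∞) :
    expect p (fun a => F a + F' a) = expect p F + expect p F' := by
  simp only [expect, mul_add, ENNReal.tsum_add]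

lemma expect_const_mul (p : PMF α) (c : ℝ≥0∞) (F : α → ℝ≥0∞) :
    expect p (fun a => c * F a) = c * expect p F := by
  simp only [expect, ← ENNReal.tsum_mul_left]
  exact tsum_congr fun a => by ring

@[simp] lemma expect_const (p : PMF α) (c : ℝ≥0∞) : expect p (fun _ => c) = c := by
  rw [expect, ENNReal.tsum_mul_right, p.tsum_coe, one_mul]

lemma expect_sum (p : PMF α) {ι : Type*} (s : Finset ι) (F : ι → α → ℝ≥0∞) :
    expect p (fun a => ∑ i ∈ s, F i a) = ∑ i ∈ s, expect p (F i) := by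
  classical
  induction s using Finset.induction_on with
  | empty => simp
  | insert i s hi ih => simp only [Finset.sum_insert hi, expect_add, ih]

lemma le_expect (p : PMF α) {F : α → ℝ≥0∞} {c : ℝ≥0∞} (h : ∀ a, c ≤ F a) : c ≤ expect p F :=
  (expect_const p c).symm.le.trans (expect_mono p h)

lemma expect_successLaw (p : unitInterval) (F : Bool → ℝ≥0∞) :
    expect (successLaw p) F = ENNReal.ofReal (1 - p) * F true + ENNReal.ofReal p * F false := by
  rw [expect, tsum_bool, add_comm]
  simp [successLaw]

end expect

lemma expect_law_succ (S : System n m v Bs Bc) (π : Policy Bs Bc) (h₀ : Channel Bs Bc) (k : ℕ)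
    (F : Info Bs Bc → ℝ≥0∞) :
    expect (law S π h₀ (k + 1)) F = expect (law S π h₀ k) fun I =>
      expect (π I) fun a => expect (successLaw (lossProb S I.2 a)) fun ok =>
        expect (channelLaw S I.2) fun h' => F ((I.2, (a, ok)) :: I.1, h') := by
  simp only [law, expect_bind, expect_pure]

/-- The event that the packets of kind `a` have all been lost in the latest `j` slots. -/
def NoSuccess (a : Action) (j : ℕ) (l : List Outcome) : Prop :=
  j ≤ l.length ∧ (a, true) ∉ l.take j

lemma noSuccess_succ {a : Action} {j : ℕ} {o : Outcome} {l : List Outcome}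
    (h : NoSuccess a j l) (ho : o ≠ (a, true)) : NoSuccess a (j + 1) (o :: l) := by
  refine ⟨by simpa using h.1, ?_⟩
  rw [List.take_succ_cons, List.mem_cons, not_or]
  exact ⟨ho.symm, h.2⟩

open Classical in
/-- Whatever the policy, `j` slots pass without a success of kind `a` with probability at least
`p ^ j`, where `p` is the smallest loss probability. -/
lemma pow_le_expect_noSuccess (S : System n m v Bs Bc) (π : Policy Bs Bc) (h₀ : Channel Bs Bc)
    (a : Action) {p : ℝ} (hp : ∀ h, p ≤ lossProb S h a) (hp1 : p ≤ 1) {j k : ℕ} (hjk : j ≤ k) :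
    ENNReal.ofReal p ^ j ≤
      expect (law S π h₀ k) fun I => if NoSuccess a j (I.1.map Prod.snd) then 1 else 0 := by
  induction k generalizing j with
  | zero =>
    obtain rfl : j = 0 := by omega
    simp [law, NoSuccess]
  | succ k ih =>
    cases j with
    | zero => exact le_expect _ fun I => by simp [NoSuccess]
    | succ j =>
      rw [expect_law_succ, pow_succ']
      refine (mul_le_mul_right (ih (j := j) (by omega)) _).trans ?_
      rw [← expect_const_mul]
      refine expect_mono _ fun I => le_expect _ fun b => ?_
      by_cases hI : NoSuccess a j (I.1.map Prod.snd)
      · rw [if_pos hI, mul_one, expect_successLaw]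
        have hval : ∀ ok, (b, ok) ≠ (a, true) → (expect (channelLaw S I.2) fun h' =>
            if NoSuccess a (j + 1) (List.map Prod.snd ((I.2, (b, ok)) :: I.1, h').1)
              then (1 : ℝ≥0∞) else 0) = 1 := by
          intro ok hok
          have : NoSuccess a (j + 1) ((b, ok) :: List.map Prod.snd I.1) := noSuccess_succ hI hok
          simp [this]
        rw [hval false (by simp)]
        by_cases hb : b = a
        · subst hb
          rw [mul_one]
          exact le_add_left (ENNReal.ofReal_le_ofReal (hp _))
        · rw [hval true (by simp [hb]), mul_one, mul_one, ← ENNReal.ofReal_add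
            (sub_nonneg.2 (lossProb S I.2 b).2.2) (lossProb S I.2 b).2.1]
          exact ENNReal.ofReal_le_ofReal (by linarith)
      · simp [hI]

open scoped Matrix.Norms.Operator

lemma energy_nonneg [NeZero n] (S : System n m v Bs Bc) (hQ : S.Q.PosDef) (hR : S.R.PosDef)
    (t : List Outcome) : 0 ≤ energy S t := by
  obtain ⟨c₁, c₂, h1, -, h⟩ := exists_energy_bounds S hQ hR
  exact le_trans (by positivity) (h t).1

lemma not_acted_of_noSuccess {a : Action} {j : ℕ} {l : List Outcome}
    (h : NoSuccess a (j + 1) l) : ¬ acted (l.take j) := by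
  have hsub : (a, true) ∉ l.take j := fun h' => h.2 ((List.take_prefix_take_left (by omega)).subset h')
  intro hact
  cases a with
  | sense => exact hsub (seen_iff_mem.1 (seen_of_acted hact))
  | control => exact hsub (mem_of_acted hact)

/-- If all packets of one kind are lost with probability at least `1 / ρ²`, then the expected cost
grows linearly under every policy. -/
lemma exists_linear_le_stageCost [NeZero n] [NeZero v] (S : System n m v Bs Bc)
    (hQ : S.Q.PosDef) (hR : S.R.PosDef) (hA : 1 < rho S.A) (hK : (S.A + S.B * S.K) ^ v = 0)
    (a : Action) (ha : ∀ h, 1 / rho S.A ^ 2 ≤ lossProb S h a) :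
    ∃ c : ℝ, 0 < c ∧ ∀ (π : Policy Bs Bc) past h₀ (k : ℕ),
      ENNReal.ofReal (c * k) ≤ stageCost S π past h₀ k := by
  classical
  obtain ⟨c₁, c₂, hc₁, -, hc⟩ := exists_energy_bounds S hQ hR
  have hρ : 0 < rho S.A := by linarith
  set p := 1 / rho S.A ^ 2 with hp
  have hp0 : 0 < p := by positivity
  have hp1 : p ≤ 1 := by
    rw [hp, div_le_one (by positivity)]; nlinarith
  refine ⟨c₁ * p, by positivity, fun π past h₀ k => ?_⟩
  have hpoint : ∀ I : Info Bs Bc, ∑ j ∈ Finset.range k, ENNReal.ofReal (c₁ * rho S.A ^ (2 * j)) *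
      (if NoSuccess a (j + 1) (I.1.map Prod.snd) then 1 else 0) ≤
      quadCost S (record past I) := by
    intro I
    rw [quadCost_eq S hQ hR hK, windowSum,
      ENNReal.ofReal_sum_of_nonneg fun j _ => energy_nonneg S hQ hR _]
    simp only [mul_ite, mul_one, mul_zero]
    rw [← Finset.sum_filter]
    have hmem : ∀ j ∈ (Finset.range k).filter
        (fun j => NoSuccess a (j + 1) (I.1.map Prod.snd)), j < (I.1.map Prod.snd).length := by
      intro j hj
      exact (Finset.mem_filter.1 hj).2.1
    refine (Finset.sum_le_sum fun j hj => ?_).trans (Finset.sum_le_sum_of_subset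
      (t := Finset.range (record past I).length)
      (f := fun j => ENNReal.ofReal (energy S ((record past I).take j))) ?_)
    · refine ENNReal.ofReal_le_ofReal ?_
      have hj' := hmem j hj
      have htake : (record past I).take j = (I.1.map Prod.snd).take j := by
        rw [record, List.take_append_of_le_length hj'.le]
      have hna := not_acted_of_noSuccess (Finset.mem_filter.1 hj).2
      have h1 := (hc ((I.1.map Prod.snd).take j)).1
      rw [gain_of_not_acted S hna, List.length_take_of_le hj'.le] at h1
      rw [htake]
      refine le_trans ?_ h1
      rw [mul_comm 2 j, pow_mul]
      gcongr
      exact rho_pow_le_norm_pow _ _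
    · intro j hj
      have := hmem j hj
      simp only [record, List.length_append, Finset.mem_range] at *
      omega
  have hexp : ∑ j ∈ Finset.range k, ENNReal.ofReal (c₁ * rho S.A ^ (2 * j)) *
      ENNReal.ofReal p ^ (j + 1) ≤ stageCost S π past h₀ k := by
    refine le_trans ?_ (expect_mono (law S π h₀ k) hpoint)
    rw [expect_sum]
    refine Finset.sum_le_sum fun j hj => ?_
    rw [expect_const_mul]
    gcongr
    exact pow_le_expect_noSuccess S π h₀ a ha hp1 (Finset.mem_range.1 hj)
  refine le_trans (le_of_eq ?_) hexp
  have hterm : ∀ j, ENNReal.ofReal (c₁ * rho S.A ^ (2 * j)) * ENNReal.ofReal p ^ (j + 1) =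
      ENNReal.ofReal (c₁ * p) := by
    intro j
    rw [← ENNReal.ofReal_pow hp0.le, ← ENNReal.ofReal_mul (by positivity)]
    congr 1
    have : p ^ j * rho S.A ^ (2 * j) = 1 := by
      rw [pow_mul, ← mul_pow, hp, one_div, inv_mul_cancel₀ (by positivity), one_pow]
    calc c₁ * rho S.A ^ (2 * j) * p ^ (j + 1) = c₁ * p * (p ^ j * rho S.A ^ (2 * j)) := by ring
      _ = c₁ * p := by rw [this, mul_one]
  simp only [hterm, Finset.sum_const, Finset.card_range, nsmul_eq_mul]
  rw [mul_comm (c₁ * p), ENNReal.ofReal_mul (by positivity), ENNReal.ofReal_natCast]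

lemma avgCost_eq_top [NeZero v] (S : System n m v Bs Bc) (π : Policy Bs Bc)
    (past : List Outcome) (h₀ : Channel Bs Bc) {c : ℝ} (hc : 0 < c)
    (h : ∀ k : ℕ, ENNReal.ofReal (c * k) ≤ stageCost S π past h₀ k) :
    avgCost S π past h₀ = ∞ := by
  refine Filter.Tendsto.limsup_eq ?_
  have hlim : Filter.Tendsto (fun N : ℕ => ENNReal.ofReal (c / 2 * ((N : ℝ) - 1))) Filter.atTop
      (nhds ∞) :=
    ENNReal.tendsto_ofReal_atTop.comp
      ((Filter.tendsto_atTop_add_const_right _ _ tendsto_natCast_atTop_atTop).const_mul_atTop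
        (by positivity))
  refine tendsto_nhds_top_mono hlim ?_
  filter_upwards [Filter.eventually_ge_atTop 1] with N hN
  have hN0 : (0 : ℝ) < N := by exact_mod_cast hN
  have h1 : ENNReal.ofReal (∑ k ∈ Finset.range N, c * k) ≤
      ∑ k ∈ Finset.range N, stageCost S π past h₀ k := by
    rw [ENNReal.ofReal_sum_of_nonneg fun k _ => by positivity]
    exact Finset.sum_le_sum fun k _ => h k
  have h2 : ∑ k ∈ Finset.range N, c * (k : ℝ) = c / 2 * (N - 1) * N := by
    have : ∀ M : ℕ, ∑ k ∈ Finset.range M, c * (k : ℝ) = c / 2 * (M - 1) * M := by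
      intro M
      induction M with
      | zero => simp
      | succ M ih => rw [Finset.sum_range_succ, ih]; push_cast; ring
    exact this N
  rw [ENNReal.le_div_iff_mul_le (Or.inl (by positivity)) (Or.inl (by simp)),
    ← ENNReal.ofReal_natCast, ← ENNReal.ofReal_mul' hN0.le, ← h2]
  exact h1

lemma neZero_of_one_lt_rho {A : Matrix (Fin n) (Fin n) ℝ} (hA : 1 < rho A) : NeZero n := by
  refine ⟨?_⟩
  rintro rfl
  have : rho A = 0 := by simp [rho, Subsingleton.elim (A.map Complex.ofReal) 0]
  linarith

/-- A policy of finite average cost can only exist if the packets of either kind get through well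
enough in some channel state. -/
theorem necessity [NeZero v] [NeZero Bs] [NeZero Bc] (S : System n m v Bs Bc)
    (hQ : S.Q.PosDef) (hR : S.R.PosDef) (hA : 1 < rho S.A) (hK : (S.A + S.B * S.K) ^ v = 0)
    {π : Policy Bs Bc} {past : List Outcome} {h₀ : Channel Bs Bc}
    (hfin : avgCost S π past h₀ < ∞) :
    max (⨅ i, (S.ω i : ℝ)) (⨅ j, (S.ξ j : ℝ)) < 1 / rho S.A ^ 2 := by
  have hn := neZero_of_one_lt_rho hA
  by_contra hcon
  obtain ⟨a, ha⟩ : ∃ a, ∀ h, 1 / rho S.A ^ 2 ≤ lossProb S h a := by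
    rcases le_max_iff.1 (not_lt.1 hcon) with h | h
    · exact ⟨Action.sense, fun g => h.trans (ciInf_le (Set.finite_range _).bddBelow g.1)⟩
    · exact ⟨Action.control, fun g => h.trans (ciInf_le (Set.finite_range _).bddBelow g.2)⟩
  obtain ⟨c, hc, h⟩ := exists_linear_le_stageCost S hQ hR hA hK a ha
  exact hfin.ne (avgCost_eq_top S π past h₀ hc (h π past h₀))

end

/-! ### Sums over windows -/

noncomputable section

variable {n m v Bs Bc : ℕ}

open scoped Matrix.Norms.Operator

lemma windowSum_nil (f : List Outcome → ℝ) : windowSum f [] = 0 := by simp [windowSum]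

lemma windowSum_cons (f : List Outcome → ℝ) (o : Outcome) (l : List Outcome) :
    windowSum f (o :: l) = f [] + windowSum (fun t => f (o :: t)) l := by
  simp only [windowSum, List.length_cons, Finset.sum_range_succ']
  simp [add_comm]

lemma windowSum_append (f : List Outcome → ℝ) (l l' : List Outcome) :
    windowSum f (l ++ l') = windowSum f l + windowSum (fun t => f (l ++ t)) l' := by
  induction l generalizing f with
  | nil => simp [windowSum]
  | cons o l ih => rw [List.cons_append, windowSum_cons, windowSum_cons, ih, add_assoc]; rfl

lemma windowSum_nonneg {f : List Outcome → ℝ} (hf : ∀ t, 0 ≤ f t) (l : List Outcome) :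
    0 ≤ windowSum f l := Finset.sum_nonneg fun _ _ => hf _

lemma windowSum_mono {f g : List Outcome → ℝ} (h : ∀ t, f t ≤ g t) (l : List Outcome) :
    windowSum f l ≤ windowSum g l := Finset.sum_le_sum fun _ _ => h _

lemma windowSum_add (f g : List Outcome → ℝ) (l : List Outcome) :
    windowSum (fun t => f t + g t) l = windowSum f l + windowSum g l := Finset.sum_add_distrib

lemma windowSum_const_mul (c : ℝ) (f : List Outcome → ℝ) (l : List Outcome) :
    windowSum (fun t => c * f t) l = c * windowSum f l := (Finset.mul_sum _ _ _).symm

lemma windowSum_zero (l : List Outcome) : windowSum (fun _ => 0) l = 0 := by simp [windowSum]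

/-! ### A Lyapunov function -/

open Classical in
/-- Growth bound for the response to a disturbance that has not been measured. -/
def unseenWeight (r : ℝ) (t : List Outcome) : ℝ := if seen t then 0 else r ^ t.length

open Classical in
/-- Growth bound for the response to a disturbance that has been measured but not counteracted. -/
def seenWeight (r : ℝ) (t : List Outcome) : ℝ :=
  if seen t ∧ ¬ acted t then r ^ t.length else 0

open Classical in
/-- Bound for the response to a disturbance that has been counteracted. As the closed-loop matrix
is nilpotent, the decay rate `θ` is free. -/
def actedWeight (r θ : ℝ) : List Outcome → ℝ
  | [] => 0
  | o :: t => if acted (o :: t) then θ * (actedWeight r θ t + seenWeight r t) else 0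

section weights

variable (r θ : ℝ) (t : List Outcome)

lemma acted_controlled_iff : acted (controlled :: t) ↔ seen t :=
  ⟨fun h => h.elim (fun h => h.2) seen_of_acted, fun h => Or.inl ⟨rfl, h⟩⟩

lemma acted_cons_of_ne {o : Outcome} (ho : o ≠ controlled) : acted (o :: t) ↔ acted t := by
  simp [acted, ho]

lemma seen_cons_of_ne {o : Outcome} (ho : o ≠ sensed) : seen (o :: t) ↔ seen t := by
  simp [seen, ho]

lemma seen_sensed : seen (sensed :: t) := Or.inl rfl

lemma actedWeight_of_not_acted {t : List Outcome} (h : ¬ acted t) : actedWeight r θ t = 0 := by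
  cases t with
  | nil => rfl
  | cons o t => rw [actedWeight, if_neg h]

lemma unseenWeight_sensed : unseenWeight r (sensed :: t) = 0 := by
  simp [unseenWeight, seen_sensed]

lemma unseenWeight_cons_of_ne {o : Outcome} (ho : o ≠ sensed) :
    unseenWeight r (o :: t) = r * unseenWeight r t := by
  by_cases h : seen t <;> simp [unseenWeight, seen_cons_of_ne t ho, h, pow_succ']

lemma seenWeight_sensed :
    seenWeight r (sensed :: t) = r * (unseenWeight r t + seenWeight r t) := by
  have h2 : seen (sensed :: t) := seen_sensed t
  have h3 := acted_cons_of_ne t controlled_ne_sensed.symm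
  by_cases h : acted t
  · simp [seenWeight, unseenWeight, h3, h, seen_of_acted h]
  · by_cases h' : seen t <;> simp [seenWeight, unseenWeight, h2, h3, h, h', pow_succ']

lemma seenWeight_controlled : seenWeight r (controlled :: t) = 0 := by
  simp [seenWeight, acted_controlled_iff, seen_cons_of_ne t controlled_ne_sensed]

lemma seenWeight_cons_of_ne {o : Outcome} (ho : o ≠ sensed) (ho' : o ≠ controlled) :
    seenWeight r (o :: t) = r * seenWeight r t := by
  by_cases h : seen t ∧ ¬ acted t <;>
    simp [seenWeight, seen_cons_of_ne t ho, acted_cons_of_ne t ho', h, pow_succ']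

lemma actedWeight_controlled :
    actedWeight r θ (controlled :: t) = θ * actedWeight r θ t + θ * seenWeight r t := by
  by_cases h : seen t
  · simp [actedWeight, acted_controlled_iff, h, mul_add]
  · have h' : ¬ acted t := fun h' => h (seen_of_acted h')
    simp [actedWeight, acted_controlled_iff, h, actedWeight_of_not_acted r θ h', seenWeight]

lemma actedWeight_cons_of_ne {o : Outcome} (ho : o ≠ controlled) :
    actedWeight r θ (o :: t) = θ * actedWeight r θ t := by
  by_cases h : acted t
  · simp [actedWeight, acted_cons_of_ne t ho, h, seenWeight]
  · simp [actedWeight, acted_cons_of_ne t ho, h, actedWeight_of_not_acted r θ h]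

variable {r θ}

lemma unseenWeight_nonneg (hr : 0 ≤ r) : 0 ≤ unseenWeight r t := by
  rw [unseenWeight]; split_ifs <;> positivity

lemma seenWeight_nonneg (hr : 0 ≤ r) : 0 ≤ seenWeight r t := by
  rw [seenWeight]; split_ifs <;> positivity

lemma actedWeight_nonneg (hr : 0 ≤ r) (hθ : 0 ≤ θ) : 0 ≤ actedWeight r θ t := by
  induction t with
  | nil => exact le_rfl
  | cons o t ih =>
    have := seenWeight_nonneg t hr
    rw [actedWeight]; split_ifs <;> positivity

end weights

lemma gain_of_acted (S : System n m v Bs Bc) (r θ : ℝ) {t : List Outcome} (h : acted t) :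
    ∃ k i, gain S t = (S.A + S.B * S.K) ^ k * S.A ^ i ∧ actedWeight r θ t = θ ^ k * r ^ i := by
  induction t with
  | nil => exact h.elim
  | cons o t ih =>
    rw [gain_cons_of_acted S h, actedWeight, if_pos h]
    by_cases h' : acted t
    · obtain ⟨k, i, h1, h2⟩ := ih h'
      refine ⟨k + 1, i, by rw [h1, pow_succ', Matrix.mul_assoc], ?_⟩
      simp [seenWeight, h', h2, pow_succ']; ring
    · have hs : seen t := by
        rcases h with h | h
        · exact h.2
        · exact absurd h h'
      refine ⟨1, t.length, by rw [gain_of_not_acted S h', pow_one], ?_⟩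
      simp [seenWeight, hs, h', actedWeight_of_not_acted r θ h']

lemma exists_norm_gain_sq_le [NeZero n] (S : System n m v Bs Bc)
    (hK : (S.A + S.B * S.K) ^ v = 0) {r θ : ℝ} (hr : rho S.A ^ 2 < r) (hθ : 0 < θ) :
    ∃ C : ℝ, 0 < C ∧ ∀ t, ‖gain S t‖ ^ 2 ≤
      C * (unseenWeight r t + seenWeight r t + actedWeight r θ t) := by
  obtain ⟨C₁, hC₁, h1⟩ := exists_norm_pow_sq_le S.A hr
  obtain ⟨C₂, hC₂, h2⟩ := exists_norm_pow_sq_le_of_nilpotent hK hθ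
  have hr0 : 0 ≤ r := (sq_nonneg _).trans hr.le
  refine ⟨C₁ + C₂ * C₁, by positivity, fun t => ?_⟩
  have hu := unseenWeight_nonneg t hr0
  have hs := seenWeight_nonneg t hr0
  have ha := actedWeight_nonneg t hr0 hθ.le
  by_cases h : acted t
  · obtain ⟨k, i, h3, h4⟩ := gain_of_acted S r θ h
    have h5 : ‖gain S t‖ ^ 2 ≤ C₂ * C₁ * actedWeight r θ t := by
      calc ‖gain S t‖ ^ 2 ≤ (‖(S.A + S.B * S.K) ^ k‖ * ‖S.A ^ i‖) ^ 2 := by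
            rw [h3]; gcongr; exact norm_mul_le _ _
        _ = ‖(S.A + S.B * S.K) ^ k‖ ^ 2 * ‖S.A ^ i‖ ^ 2 := by ring
        _ ≤ (C₂ * θ ^ k) * (C₁ * r ^ i) := by
            gcongr
            · exact h2 k
            · exact h1 i
        _ = C₂ * C₁ * actedWeight r θ t := by rw [h4]; ring
    have : 0 ≤ C₂ * C₁ * (unseenWeight r t + seenWeight r t) := by positivity
    have : 0 ≤ C₁ * (unseenWeight r t + seenWeight r t + actedWeight r θ t) := by positivity
    linarith
  · have h5 : unseenWeight r t + seenWeight r t = r ^ t.length := by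
      by_cases h' : seen t <;> simp [unseenWeight, seenWeight, h, h']
    have h6 := h1 t.length
    rw [← gain_of_not_acted S h, ← h5] at h6
    have : 0 ≤ C₂ * C₁ * (unseenWeight r t + seenWeight r t + actedWeight r θ t) := by positivity
    have : 0 ≤ C₁ * actedWeight r θ t := by positivity
    linarith

/-- Under the alternating policy (sense until a sensor packet arrives, then control until a
control packet arrives), is the sensor to be scheduled next? -/
def sensing : List Outcome → Prop
  | [] => True
  | o :: t => o = controlled ∨ (o ≠ sensed ∧ sensing t)

open Classical in
/-- The alternating policy: sense until a sensor packet arrives, then control until a control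
packet arrives. -/
def alternating (l : List Outcome) : Action :=
  if sensing l then Action.sense else Action.control

/-- The alternating policy has a Lyapunov function that dominates the cost. -/
theorem exists_lyapunov [NeZero n] (S : System n m v Bs Bc)
    (hK : (S.A + S.B * S.K) ^ v = 0) {p : ℝ} (hp0 : 0 ≤ p) (hp1 : p ≤ 1)
    (hp : p * rho S.A ^ 2 < 1) :
    ∃ (W : List Outcome → ℝ) (lam K C : ℝ), (∀ l, 0 ≤ W l) ∧ 0 ≤ lam ∧ lam < 1 ∧ 0 ≤ K ∧ 0 < C ∧
      (∀ l, windowSum (fun t => ‖gain S t‖ ^ 2) l ≤ C * W l) ∧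
      ∀ l ℓ, 0 ≤ ℓ → ℓ ≤ p →
        (1 - ℓ) * W ((alternating l, true) :: l) + ℓ * W ((alternating l, false) :: l) ≤
          lam * W l + K := by
  classical
  have hρ2 : 0 ≤ rho S.A ^ 2 := sq_nonneg _
  set r := rho S.A ^ 2 + (1 - p * rho S.A ^ 2) / 2 with hr
  have hr1 : rho S.A ^ 2 < r := by linarith
  have hr0 : 0 < r := by linarith
  have hpr : p * r < 1 := by nlinarith
  have hpr0 : 0 ≤ p * r := by positivity
  obtain ⟨C, hC, hgain⟩ := exists_norm_gain_sq_le S hK hr1 (θ := 1 / 4) (by norm_num)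
  set μ := (1 - p * r) / 2 with hμ
  have hμ0 : 0 < μ := by linarith
  set lam := (1 + p * r) / 2 with hlam
  have hlamμ : lam = μ + p * r := by rw [hμ, hlam]; ring
  -- each weight absorbs, with a margin `μ`, what the next mode contributes
  set b' := (1 / 4) / μ with hb'
  set a := b' * r / μ with ha
  set a' := a * r / μ with ha'
  have hb'0 : 0 < b' := by positivity
  have ha0 : 0 < a := by positivity
  have ha'0 : 0 < a' := by positivity
  have eb' : b' * μ = 1 / 4 := by rw [hb']; field_simp
  have ea : a * μ = b' * r := by rw [ha]; field_simp
  have ea' : a' * μ = a * r := by rw [ha']; field_simp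
  let X : List Outcome → ℝ := windowSum (unseenWeight r)
  let Y : List Outcome → ℝ := windowSum (seenWeight r)
  let Z : List Outcome → ℝ := windowSum (actedWeight r (1 / 4))
  have hX : ∀ l, 0 ≤ X l := windowSum_nonneg fun t => unseenWeight_nonneg t hr0.le
  have hY : ∀ l, 0 ≤ Y l := windowSum_nonneg fun t => seenWeight_nonneg t hr0.le
  have hZ : ∀ l, 0 ≤ Z l := windowSum_nonneg fun t => actedWeight_nonneg t hr0.le (by norm_num)
  have hX0 : unseenWeight r [] = 1 := by simp [unseenWeight, seen]
  have hY0 : seenWeight r [] = 0 := by simp [seenWeight, seen]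
  have hZ0 : actedWeight r (1 / 4) [] = 0 := rfl
  have X1 : ∀ l, X (sensed :: l) = 1 := fun l => by
    simp only [X, windowSum_cons, hX0, unseenWeight_sensed, windowSum_zero, add_zero]
  have X2 : ∀ o l, o ≠ sensed → X (o :: l) = 1 + r * X l := fun o l ho => by
    simp only [X, windowSum_cons, hX0, unseenWeight_cons_of_ne r _ ho, windowSum_const_mul]
  have Y1 : ∀ l, Y (sensed :: l) = r * (X l + Y l) := fun l => by
    simp only [X, Y, windowSum_cons, hY0, seenWeight_sensed, windowSum_const_mul, windowSum_add,
      zero_add]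
  have Y2 : ∀ l, Y (controlled :: l) = 0 := fun l => by
    simp only [Y, windowSum_cons, hY0, seenWeight_controlled, windowSum_zero, add_zero]
  have Y3 : ∀ o l, o ≠ sensed → o ≠ controlled → Y (o :: l) = r * Y l := fun o l ho ho' => by
    simp only [Y, windowSum_cons, hY0, seenWeight_cons_of_ne r _ ho ho', windowSum_const_mul,
      zero_add]
  have Z1 : ∀ l, Z (controlled :: l) = 1 / 4 * Z l + 1 / 4 * Y l := fun l => by
    simp only [Y, Z, windowSum_cons, hZ0, actedWeight_controlled, windowSum_const_mul,
      windowSum_add, zero_add]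
  have Z2 : ∀ o l, o ≠ controlled → Z (o :: l) = 1 / 4 * Z l := fun o l ho => by
    simp only [Z, windowSum_cons, hZ0, actedWeight_cons_of_ne r _ _ ho, windowSum_const_mul,
      zero_add]
  let W : List Outcome → ℝ := fun l =>
    if sensing l then a * X l + a * Y l + Z l else a' * X l + b' * Y l + Z l
  have hW : ∀ l, 0 ≤ W l := by
    intro l
    have := hX l; have := hY l; have := hZ l
    simp only [W]; split_ifs <;> positivity
  refine ⟨W, lam, a + a', C * (1 / a + 1 / a' + 1 / b' + 1), hW, by positivity, by linarith,
    by positivity, by positivity, ?_, ?_⟩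
  · intro l
    have h1 : windowSum (fun t => ‖gain S t‖ ^ 2) l ≤ C * (X l + Y l + Z l) := by
      refine (windowSum_mono hgain l).trans (le_of_eq ?_)
      rw [windowSum_const_mul, windowSum_add, windowSum_add]
    refine h1.trans ?_
    rw [mul_assoc]
    refine mul_le_mul_of_nonneg_left ?_ hC.le
    have e1 : 1 / a * a = 1 := by field_simp
    have e2 : 1 / a' * a' = 1 := by field_simp
    have e3 : 1 / b' * b' = 1 := by field_simp
    have hXl := hX l; have hYl := hY l; have hZl := hZ l
    have i1 : 0 < 1 / a := by positivity
    have i2 : 0 < 1 / a' := by positivity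
    have i3 : 0 < 1 / b' := by positivity
    have hexp : (1 / a + 1 / a' + 1 / b' + 1) * W l =
        1 / a * W l + 1 / a' * W l + 1 / b' * W l + W l := by ring
    by_cases hs : sensing l
    · have hWl : W l = a * X l + a * Y l + Z l := by simp [W, hs]
      have h2 : 1 / a * W l = X l + Y l + 1 / a * Z l := by
        rw [hWl]; linear_combination (X l + Y l) * e1
      have h3 : Z l ≤ W l := by rw [hWl]; linarith [mul_nonneg ha0.le hXl, mul_nonneg ha0.le hYl]
      have := mul_nonneg i1.le hZl
      have := mul_nonneg i2.le (hW l)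
      have := mul_nonneg i3.le (hW l)
      rw [hexp]
      linarith
    · have hWl : W l = a' * X l + b' * Y l + Z l := by simp [W, hs]
      have h2 : 1 / a' * W l = X l + 1 / a' * (b' * Y l) + 1 / a' * Z l := by
        rw [hWl]; linear_combination (X l) * e2
      have h2' : 1 / b' * W l = 1 / b' * (a' * X l) + Y l + 1 / b' * Z l := by
        rw [hWl]; linear_combination (Y l) * e3
      have h3 : Z l ≤ W l := by rw [hWl]; linarith [mul_nonneg ha'0.le hXl, mul_nonneg hb'0.le hYl]
      have := mul_nonneg i2.le hZl
      have := mul_nonneg i3.le hZl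
      have := mul_nonneg i1.le (hW l)
      have := mul_nonneg i2.le (mul_nonneg hb'0.le hYl)
      have := mul_nonneg i3.le (mul_nonneg ha'0.le hXl)
      rw [hexp]
      linarith
  · intro l ℓ hℓ0 hℓp
    have hXl := hX l; have hYl := hY l; have hZl := hZ l
    have hbound : ∀ u w : ℝ, 0 ≤ u → 0 ≤ w → (1 - ℓ) * u + ℓ * w ≤ u + p * w := by
      intro u w hu hw; nlinarith [mul_nonneg hℓ0 hu, mul_nonneg (sub_nonneg.2 hℓp) hw]
    refine (hbound _ _ (hW _) (hW _)).trans ?_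
    have hZp : 1 / 4 * Z l + p * (1 / 4 * Z l) ≤ (μ + p * r) * Z l := by
      have h1 : p * Z l ≤ 1 * Z l := mul_le_mul_of_nonneg_right hp1 hZl
      have h2 : 1 / 2 * Z l ≤ (μ + p * r) * Z l :=
        mul_le_mul_of_nonneg_right (by rw [hμ]; linarith) hZl
      linarith
    by_cases hs : sensing l
    · have hWl : W l = a * X l + a * Y l + Z l := by simp [W, hs]
      have ho : (Action.sense, false) ≠ sensed := by simp [sensed]
      have ho' : (Action.sense, false) ≠ controlled := by simp [controlled]
      have hs1 : ¬ sensing (sensed :: l) := by simp [sensing, controlled_ne_sensed.symm]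
      have hs2 : sensing ((Action.sense, false) :: l) := Or.inr ⟨ho, hs⟩
      have hW1 : W (sensed :: l) = a' + b' * (r * (X l + Y l)) + 1 / 4 * Z l := by
        simp only [W, hs1, if_false, X1, Y1, Z2 _ l controlled_ne_sensed.symm, mul_one]
      have hW2 : W ((Action.sense, false) :: l) =
          a * (1 + r * X l) + a * (r * Y l) + 1 / 4 * Z l := by
        simp only [W, hs2, if_true, X2 _ l ho, Y3 _ l ho ho', Z2 _ l ho']
      simp only [alternating, hs, if_true]
      change W (sensed :: l) + _ ≤ _
      rw [hW1, hW2, hWl]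
      have e1 : b' * (r * (X l + Y l)) = a * μ * (X l + Y l) := by rw [ea]; ring
      rw [e1, hlamμ]
      linarith [mul_le_mul_of_nonneg_right hp1 ha0.le]
    · have hWl : W l = a' * X l + b' * Y l + Z l := by simp [W, hs]
      have ho : (Action.control, false) ≠ sensed := by simp [sensed]
      have ho' : (Action.control, false) ≠ controlled := by simp [controlled]
      have hs1 : sensing (controlled :: l) := Or.inl rfl
      have hs2 : ¬ sensing ((Action.control, false) :: l) := by
        rintro (h | h)
        · exact ho' h
        · exact hs h.2
      have hW1 : W (controlled :: l) = a * (1 + r * X l) + (1 / 4 * Z l + 1 / 4 * Y l) := by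
        simp only [W, hs1, if_true, X2 _ l controlled_ne_sensed, Y2, Z1, mul_zero, add_zero]
      have hW2 : W ((Action.control, false) :: l) =
          a' * (1 + r * X l) + b' * (r * Y l) + 1 / 4 * Z l := by
        simp only [W, hs2, if_false, X2 _ l ho, Y3 _ l ho ho', Z2 _ l ho']
      simp only [alternating, hs, if_false]
      change W (controlled :: l) + _ ≤ _
      rw [hW1, hW2, hWl]
      have e1 : a * (1 + r * X l) = a + a' * μ * X l := by rw [ea']; ring
      have e2 : 1 / 4 * Y l = b' * μ * Y l := by rw [eb']
      rw [e1, e2, hlamμ]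
      linarith [mul_le_mul_of_nonneg_right hp1 ha'0.le]

/-! ### Comparing the responses to different disturbances -/

/-- The discounted sum of `f` over the final segments of `l`, that is, over the records at the
times up to now. -/
def pathSum (α : ℝ) (f : List Outcome → ℝ) : List Outcome → ℝ
  | [] => f []
  | o :: l => pathSum α f l + α ^ (l.length + 1) * f (o :: l)

section pathSum

variable {α : ℝ} {f g : List Outcome → ℝ}

lemma pathSum_add (l : List Outcome) :
    pathSum α (fun t => f t + g t) l = pathSum α f l + pathSum α g l := by
  induction l with
  | nil => rfl
  | cons o l ih => simp only [pathSum, ih]; ring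

lemma pathSum_nonneg (hα : 0 ≤ α) (hf : ∀ t, 0 ≤ f t) (l : List Outcome) :
    0 ≤ pathSum α f l := by
  induction l with
  | nil => exact hf _
  | cons o l ih => have := hf (o :: l); simp only [pathSum]; positivity

lemma pathSum_le_append (hα : 0 ≤ α) (hf : ∀ t, 0 ≤ f t) (l l' : List Outcome) :
    pathSum α f l' ≤ pathSum α f (l ++ l') := by
  induction l with
  | nil => rfl
  | cons o l ih =>
    have h := hf (o :: (l ++ l'))
    have : 0 ≤ α ^ ((l ++ l').length + 1) * f (o :: (l ++ l')) := by positivity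
    simp only [List.cons_append, pathSum]; linarith

lemma le_pathSum_self (hα : 0 ≤ α) (hf : ∀ t, 0 ≤ f t) (l : List Outcome) :
    α ^ l.length * f l ≤ pathSum α f l := by
  cases l with
  | nil => simp [pathSum]
  | cons o l => have := pathSum_nonneg hα hf l; simp only [pathSum, List.length_cons]; linarith

end pathSum

lemma seen_append {t p : List Outcome} : seen (t ++ p) ↔ seen t ∨ seen p := by
  simp [seen_iff_mem]

lemma acted_append_of_not_seen {t p : List Outcome} (hp : ¬ seen p) :
    acted (t ++ p) ↔ acted t := by
  induction t with
  | nil => simpa [acted] using fun h => hp (seen_of_acted h)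
  | cons o t ih => simp [acted, ih, seen_append, hp]

lemma gain_append_of_not_seen (S : System n m v Bs Bc) {t p : List Outcome} (hp : ¬ seen p) :
    gain S (t ++ p) = gain S t * gain S p := by
  induction t with
  | nil => simp [gain]
  | cons o t ih =>
    have h := acted_append_of_not_seen (t := o :: t) hp
    rw [List.cons_append] at h ⊢
    by_cases h' : acted (o :: t)
    · rw [gain_cons_of_acted S h', gain_cons_of_acted S (h.2 h'), ih, Matrix.mul_assoc]
    · rw [gain, gain, if_neg h', if_neg (mt h.1 h'), ih, Matrix.mul_assoc]

lemma acted_append_of_acted {t p : List Outcome} (hp : acted p) : acted (t ++ p) := by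
  induction t with
  | nil => exact hp
  | cons o t ih => exact Or.inr ih

lemma gain_append_of_acted (S : System n m v Bs Bc) {t p : List Outcome} (hp : acted p) :
    gain S (t ++ p) = (S.A + S.B * S.K) ^ t.length * gain S p := by
  induction t with
  | nil => simp
  | cons o t ih =>
    rw [List.cons_append, gain_cons_of_acted S (Or.inr (acted_append_of_acted hp)), ih,
      List.length_cons, pow_succ', Matrix.mul_assoc]

lemma gain_append_of_not_mem (S : System n m v Bs Bc) {t p : List Outcome} (hp : ¬ acted p)
    (ht : controlled ∉ t) : gain S (t ++ p) = S.A ^ t.length * gain S p := by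
  have hna : ¬ acted (t ++ p) := by
    induction t with
    | nil => exact hp
    | cons o t ih =>
      simp only [List.mem_cons, not_or] at ht
      rintro (h | h)
      · exact ht.1 h.1.symm
      · exact ih ht.2 h
  rw [gain_of_not_acted S hna, gain_of_not_acted S hp, List.length_append, pow_add]

/-- Along every sequence of outcomes, the discounted cost of the response to an old disturbance is
bounded by that of the response to a new disturbance, times the square of the present gain of the
old one. Once a measured disturbance is counteracted, its response dies out within `v` slots, which
is paid for by the open-loop response of the new disturbance up to then. -/
theorem exists_pathSum_energy_append_le [NeZero n] (S : System n m v Bs Bc) (hQ : S.Q.PosDef)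
    (hR : S.R.PosDef) (hK : (S.A + S.B * S.K) ^ v = 0) :
    ∃ C : ℝ, 0 < C ∧ ∀ (α : ℝ), 0 ≤ α → α ≤ 1 → ∀ l p : List Outcome,
      pathSum α (fun t => energy S (t ++ p)) l ≤
        C * ‖gain S p‖ ^ 2 * pathSum α (energy S) l := by
  obtain ⟨c₁, c₂, hc₁, hc₂, hc⟩ := exists_energy_bounds S hQ hR
  obtain ⟨c₃, hc₃, hN⟩ := exists_norm_pow_sq_le_of_nilpotent hK (θ := 1 / 2) (by norm_num)
  have hen := energy_nonneg S hQ hR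
  set N := S.A + S.B * S.K with hNdef
  -- the cost of a response of the form `N ^ k * X * Y`
  have hup : ∀ (t : List Outcome) (k : ℕ) (X Y : Matrix (Fin n) (Fin n) ℝ),
      gain S t = N ^ k * X * Y → energy S t ≤ c₂ * c₃ * (1 / 2) ^ k * ‖X‖ ^ 2 * ‖Y‖ ^ 2 := by
    intro t k X Y h
    calc energy S t ≤ c₂ * ‖gain S t‖ ^ 2 := (hc t).2
      _ ≤ c₂ * (‖N ^ k‖ * ‖X‖ * ‖Y‖) ^ 2 := by
          rw [h]
          gcongr
          exact (norm_mul_le _ _).trans (by gcongr; exact norm_mul_le _ _)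
      _ = c₂ * ‖N ^ k‖ ^ 2 * ‖X‖ ^ 2 * ‖Y‖ ^ 2 := by ring
      _ ≤ c₂ * (c₃ * (1 / 2) ^ k) * ‖X‖ ^ 2 * ‖Y‖ ^ 2 := by gcongr; exact hN k
      _ = _ := by ring
  have hpt : ∀ t p : List Outcome, gain S (t ++ p) = gain S t * gain S p →
      energy S (t ++ p) ≤ c₂ / c₁ * ‖gain S p‖ ^ 2 * energy S t := by
    intro t p h
    calc energy S (t ++ p) ≤ c₂ * ‖gain S (t ++ p)‖ ^ 2 := (hc _).2
      _ ≤ c₂ * (‖gain S t‖ * ‖gain S p‖) ^ 2 := by rw [h]; gcongr; exact norm_mul_le _ _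
      _ = c₂ / c₁ * ‖gain S p‖ ^ 2 * (c₁ * ‖gain S t‖ ^ 2) := by field_simp
      _ ≤ _ := by gcongr; exact (hc t).1
  have hone : 1 ≤ ‖(1 : Matrix (Fin n) (Fin n) ℝ)‖ ^ 2 := one_le_pow₀ (one_le_norm_one _)
  refine ⟨c₂ / c₁ + 2 * (c₂ * c₃ / c₁), by positivity, fun α hα0 hα1 l p => ?_⟩
  have hps := pathSum_nonneg hα0 hen l
  have hgp := sq_nonneg ‖gain S p‖
  -- the tail that follows the first counteraction
  have tail : ∀ (b : ℝ) (u x : List Outcome), 0 ≤ b → (∀ t, α ^ (t ++ x).length *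
      energy S (t ++ x ++ p) ≤ b * (1 / 2) ^ t.length) →
      pathSum α (fun t => energy S (t ++ p)) (u ++ x) ≤
        pathSum α (fun t => energy S (t ++ p)) x + b * (1 - (1 / 2) ^ u.length) := by
    intro b u x hb h
    induction u with
    | nil => simp
    | cons o u ih =>
      have h1 := h (o :: u)
      simp only [List.cons_append, pathSum, List.length_cons] at h1 ⊢
      rw [pow_succ] at h1 ⊢
      rw [pow_succ (1 / 2 : ℝ)] at h1 ⊢
      nlinarith
  by_cases hs : seen p
  swap
  · have h : pathSum α (fun t => energy S (t ++ p)) l ≤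
        c₂ / c₁ * ‖gain S p‖ ^ 2 * pathSum α (energy S) l := by
      induction l with
      | nil => exact hpt [] p (by simp [gain])
      | cons o l ih =>
        have h1 := hpt (o :: l) p (gain_append_of_not_seen S hs)
        have h2 := mul_le_mul_of_nonneg_left h1 (pow_nonneg hα0 (l.length + 1))
        have h3 := ih (pathSum_nonneg hα0 hen l)
        simp only [pathSum]
        linarith
    have : 0 ≤ 2 * (c₂ * c₃ / c₁) * ‖gain S p‖ ^ 2 * pathSum α (energy S) l := by positivity
    linarith
  by_cases ha : acted p
  · have h := tail (c₂ * c₃ * ‖(1 : Matrix (Fin n) (Fin n) ℝ)‖ ^ 2 * ‖gain S p‖ ^ 2) l []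
      (by positivity) ?_
    · have h0 := hup ([] ++ p) 0 1 (gain S p) (by simp)
      have h1 : c₁ * ‖(1 : Matrix (Fin n) (Fin n) ℝ)‖ ^ 2 ≤ pathSum α (energy S) l := by
        have h2 := pathSum_le_append hα0 hen l []
        rw [List.append_nil] at h2
        exact ((hc []).1).trans h2
      rw [List.append_nil] at h
      have h2 : (0 : ℝ) ≤ (1 / 2) ^ l.length := by positivity
      have h3 : 0 ≤ c₂ * c₃ * ‖(1 : Matrix (Fin n) (Fin n) ℝ)‖ ^ 2 * ‖gain S p‖ ^ 2 := by
        positivity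
      have h4 : c₂ * c₃ * ‖(1 : Matrix (Fin n) (Fin n) ℝ)‖ ^ 2 * ‖gain S p‖ ^ 2 ≤
          c₂ * c₃ / c₁ * ‖gain S p‖ ^ 2 * pathSum α (energy S) l := by
        calc _ = c₂ * c₃ / c₁ * ‖gain S p‖ ^ 2 *
              (c₁ * ‖(1 : Matrix (Fin n) (Fin n) ℝ)‖ ^ 2) := by field_simp
          _ ≤ _ := by gcongr
      have h5 : 0 ≤ c₂ / c₁ * ‖gain S p‖ ^ 2 * pathSum α (energy S) l := by positivity
      simp only [pathSum] at h
      rw [pow_zero, mul_one] at h0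
      nlinarith
    · intro t
      have h1 := hup (t ++ p) t.length 1 (gain S p) (by
        rw [gain_append_of_acted S ha, mul_one])
      have h2 : α ^ (t ++ []).length ≤ 1 := pow_le_one₀ hα0 hα1
      rw [List.append_nil] at h2 ⊢
      calc α ^ t.length * energy S (t ++ p) ≤ 1 * energy S (t ++ p) := by
            gcongr; exact hen _
        _ ≤ _ := by rw [one_mul]; linarith
  · have hnomem : ∀ x : List Outcome, controlled ∉ x →
        pathSum α (fun t => energy S (t ++ p)) x ≤
          c₂ / c₁ * ‖gain S p‖ ^ 2 * pathSum α (energy S) x := by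
      intro x hx
      have hstep : ∀ t : List Outcome, controlled ∉ t →
          gain S (t ++ p) = gain S t * gain S p := by
        intro t ht
        rw [gain_append_of_not_mem S ha ht,
          gain_of_not_acted S (fun h => ht (mem_of_acted h))]
      induction x with
      | nil => exact hpt [] p (by simp [gain])
      | cons o x ih =>
        have h1 := hpt (o :: x) p (hstep _ hx)
        have h2 := mul_le_mul_of_nonneg_left h1 (pow_nonneg hα0 (x.length + 1))
        have h3 := ih (fun h => hx (List.mem_cons_of_mem _ h))
        simp only [pathSum]
        linarith
    by_cases hl : controlled ∈ l
    swap
    · have : 0 ≤ 2 * (c₂ * c₃ / c₁) * ‖gain S p‖ ^ 2 * pathSum α (energy S) l := by positivity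
      linarith [hnomem l hl]
    -- split the outcomes at the first control packet
    obtain ⟨u, x, rfl, hx⟩ : ∃ u x, l = u ++ controlled :: x ∧ controlled ∉ x := by
      have : controlled ∈ l.reverse := List.mem_reverse.2 hl
      obtain ⟨s, t, hst, hs'⟩ := List.eq_append_cons_of_mem this
      refine ⟨t.reverse, s.reverse, ?_, by simpa using hs'⟩
      rw [← List.reverse_reverse l, hst]
      simp
    set g := c₂ * c₃ * (α ^ x.length * ‖S.A ^ x.length‖ ^ 2) * ‖gain S p‖ ^ 2 with hg
    have hg0 : 0 ≤ g := by positivity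
    have hcx : acted (controlled :: (x ++ p)) :=
      Or.inl ⟨rfl, seen_append.2 (Or.inr hs)⟩
    have h := tail g u (controlled :: x) hg0 ?_
    · have h1 := hup (controlled :: (x ++ p)) 1 (S.A ^ x.length) (gain S p) (by
        rw [gain_cons_of_acted S hcx, gain_append_of_not_mem S ha hx, pow_one, Matrix.mul_assoc])
      have h2 : α ^ (x.length + 1) * energy S (controlled :: (x ++ p)) ≤ g := by
        calc α ^ (x.length + 1) * energy S (controlled :: (x ++ p))
            ≤ α ^ x.length * (c₂ * c₃ * (1 / 2) ^ 1 * ‖S.A ^ x.length‖ ^ 2 *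
              ‖gain S p‖ ^ 2) := by
              have : α ^ (x.length + 1) ≤ α ^ x.length :=
                pow_le_pow_of_le_one hα0 hα1 (Nat.le_succ _)
              have := hen (controlled :: (x ++ p))
              gcongr
          _ = g / 2 := by rw [hg]; ring
          _ ≤ g := by linarith
      have h3 := hnomem x hx
      have h4 : pathSum α (energy S) x ≤ pathSum α (energy S) (u ++ controlled :: x) := by
        have := pathSum_le_append hα0 hen (u ++ [controlled]) x
        simpa using this
      have h5 : g ≤ c₂ * c₃ / c₁ * ‖gain S p‖ ^ 2 * pathSum α (energy S) x := by
        have h6 := (hc x).1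
        rw [gain_of_not_acted S (fun h => hx (mem_of_acted h))] at h6
        calc g = c₂ * c₃ / c₁ * ‖gain S p‖ ^ 2 *
              (α ^ x.length * (c₁ * ‖S.A ^ x.length‖ ^ 2)) := by rw [hg]; field_simp
          _ ≤ c₂ * c₃ / c₁ * ‖gain S p‖ ^ 2 * (α ^ x.length * energy S x) := by gcongr
          _ ≤ _ := by gcongr; exact le_pathSum_self hα0 hen x
      have h6 : (0 : ℝ) ≤ (1 / 2) ^ u.length := by positivity
      have h7 : (c₂ / c₁ + 2 * (c₂ * c₃ / c₁)) * ‖gain S p‖ ^ 2 * pathSum α (energy S) x ≤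
          (c₂ / c₁ + 2 * (c₂ * c₃ / c₁)) * ‖gain S p‖ ^ 2 *
            pathSum α (energy S) (u ++ controlled :: x) := by gcongr
      simp only [pathSum, List.cons_append] at h
      nlinarith
    · intro t
      have hgain : gain S (t ++ controlled :: x ++ p) =
          N ^ (t.length + 1) * S.A ^ x.length * gain S p := by
        rw [List.append_assoc, List.cons_append, gain_append_of_acted S hcx,
          gain_cons_of_acted S hcx, gain_append_of_not_mem S ha hx, pow_succ]
        simp only [Matrix.mul_assoc]
        rfl
      have h1 := hup _ _ _ _ hgain
      have h2 : α ^ (t ++ controlled :: x).length ≤ α ^ x.length :=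
        pow_le_pow_of_le_one hα0 hα1 (by simp; omega)
      calc α ^ (t ++ controlled :: x).length * energy S (t ++ controlled :: x ++ p)
          ≤ α ^ x.length * (c₂ * c₃ * (1 / 2) ^ (t.length + 1) * ‖S.A ^ x.length‖ ^ 2 *
              ‖gain S p‖ ^ 2) := by
            have := hen (t ++ controlled :: x ++ p)
            gcongr
        _ = g * (1 / 2) ^ t.length / 2 := by rw [hg, pow_succ]; ring
        _ ≤ g * (1 / 2) ^ t.length := by
            have : 0 ≤ g * (1 / 2) ^ t.length := by positivity
            linarith

end

/-! ### Discounted scheduling problems -/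

noncomputable section

/-- A scheduling problem over an uncontrolled finite Markov chain, with the structure that the
existence of an average-cost optimal policy rests on. States are pairs of a record of outcomes and
a channel state. The cost `windowSum q` superposes the costs `q` of single disturbances; the
decision rule `good` has the Lyapunov function `W`; and the responses to all disturbances in a
record `p` are dominated, along every sequence of outcomes, by the response to one new disturbance. -/
structure Scheduling (H : Type*) [Fintype H] where
  P : H → H → ℝ
  P_nonneg : ∀ h h', 0 ≤ P h h'
  P_sum : ∀ h, ∑ h', P h h' = 1
  loss : H → Action → ℝ
  loss_nonneg : ∀ h a, 0 ≤ loss h a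
  loss_le_one : ∀ h a, loss h a ≤ 1
  q : List Outcome → ℝ
  q_nonneg : ∀ t, 0 ≤ q t
  W : List Outcome → ℝ
  W_nonneg : ∀ l, 0 ≤ W l
  good : List Outcome → Action
  lam : ℝ
  lam_nonneg : 0 ≤ lam
  lam_lt_one : lam < 1
  K : ℝ
  K_nonneg : 0 ≤ K
  drift : ∀ l h, (1 - loss h (good l)) * W ((good l, true) :: l) +
    loss h (good l) * W ((good l, false) :: l) ≤ lam * W l + K
  Cc : ℝ
  Cc_nonneg : 0 ≤ Cc
  cost_le : ∀ l, windowSum q l ≤ Cc * W l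
  Cd : ℝ
  Cd_nonneg : 0 ≤ Cd
  dominated : ∀ α : ℝ, 0 ≤ α → α ≤ 1 → ∀ l p,
    pathSum α (fun t => windowSum (fun s => q (t ++ s)) p) l ≤ Cd * W p * pathSum α q l

namespace Scheduling

variable {H : Type*} [Fintype H] (M : Scheduling H)

/-- The cost of a record. -/
def cost (l : List Outcome) : ℝ := windowSum M.q l

/-- The expectation of `F` after one slot in which the action `a` is taken. -/
def next (a : Action) (F : List Outcome → H → ℝ) (l : List Outcome) (h : H) : ℝ :=
  ∑ h', M.P h h' * ((1 - M.loss h a) * F ((a, true) :: l) h' +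
    M.loss h a * F ((a, false) :: l) h')

/-- The transition operator of the channel. -/
def chan : (H → ℝ) →ₗ[ℝ] (H → ℝ) where
  toFun x h := ∑ h', M.P h h' * x h'
  map_add' x y := by ext h; simp [mul_add, Finset.sum_add_distrib]
  map_smul' c x := by
    ext h
    simp only [Pi.smul_apply, smul_eq_mul, RingHom.id_apply, Finset.mul_sum]
    exact Finset.sum_congr rfl fun _ _ => by ring

lemma chan_apply (x : H → ℝ) (h : H) : M.chan x h = ∑ h', M.P h h' * x h' := rfl

lemma chan_mono {x y : H → ℝ} (hxy : x ≤ y) : M.chan x ≤ M.chan y := fun h =>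
  Finset.sum_le_sum fun h' _ => mul_le_mul_of_nonneg_left (hxy h') (M.P_nonneg h h')

lemma chan_nonneg {x : H → ℝ} (hx : 0 ≤ x) : 0 ≤ M.chan x := by
  simpa using M.chan_mono hx

lemma chan_const (c : ℝ) : M.chan (fun _ => c) = fun _ => c := by
  ext h; rw [chan_apply, ← Finset.sum_mul, M.P_sum, one_mul]

section next

variable {M} {a : Action} {F G : List Outcome → H → ℝ} {l : List Outcome} {h : H}

lemma next_mono_at {l' : List Outcome} (hFG : ∀ o h', F (o :: l) h' ≤ G (o :: l') h') :
    M.next a F l h ≤ M.next a G l' h := by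
  refine Finset.sum_le_sum fun h' _ => mul_le_mul_of_nonneg_left ?_ (M.P_nonneg h h')
  have h0 := M.loss_nonneg h a
  have h1 := sub_nonneg.2 (M.loss_le_one h a)
  gcongr <;> exact hFG _ _

lemma next_add : M.next a (fun l h => F l h + G l h) l h = M.next a F l h + M.next a G l h := by
  simp only [next, ← Finset.sum_add_distrib]
  exact Finset.sum_congr rfl fun _ _ => by ring

lemma next_const_mul (c : ℝ) : M.next a (fun l h => c * F l h) l h = c * M.next a F l h := by
  simp only [next, Finset.mul_sum]
  exact Finset.sum_congr rfl fun _ _ => by ring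

lemma next_sum {ι : Type*} (s : Finset ι) (F : ι → List Outcome → H → ℝ) :
    M.next a (fun l h => ∑ i ∈ s, F i l h) l h = ∑ i ∈ s, M.next a (F i) l h := by
  simp only [next, Finset.mul_sum, ← Finset.sum_add_distrib]
  exact Finset.sum_comm

/-- The channel is not affected by the actions. -/
lemma next_channel (x : H → ℝ) : M.next a (fun _ h => x h) l h = M.chan x h := by
  simp only [next, chan_apply]
  exact Finset.sum_congr rfl fun _ _ => by ring

lemma next_const (c : ℝ) : M.next a (fun _ _ => c) l h = c := by
  rw [next_channel, chan_const]

lemma next_nonneg (hF : ∀ l h, 0 ≤ F l h) : 0 ≤ M.next a F l h := by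
  rw [← next_const (M := M) (a := a) (l := l) (h := h) 0]
  exact next_mono_at fun o h' => hF _ _

/-- The Lyapunov function decreases in mean whatever the channel does next. -/
lemma next_good_le (x : H → ℝ) (hx : 0 ≤ x) :
    M.next (M.good l) (fun l h => M.W l * x h) l h ≤ (M.lam * M.W l + M.K) * M.chan x h := by
  rw [chan_apply, Finset.mul_sum, next]
  refine Finset.sum_le_sum fun h' _ => ?_
  have h1 := mul_le_mul_of_nonneg_right (M.drift l h) (mul_nonneg (M.P_nonneg h h') (hx h'))
  linarith

end next

/-- The smaller of the expectations of `F` after one slot with either action. -/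
def best (F : List Outcome → H → ℝ) (l : List Outcome) (h : H) : ℝ :=
  min (M.next Action.sense F l h) (M.next Action.control F l h)

lemma best_le (F : List Outcome → H → ℝ) (a : Action) (l : List Outcome) (h : H) :
    M.best F l h ≤ M.next a F l h := by
  cases a
  · exact min_le_left _ _
  · exact min_le_right _ _

lemma exists_best (F : List Outcome → H → ℝ) (l : List Outcome) (h : H) :
    ∃ a, M.best F l h = M.next a F l h := by
  rcases min_choice (M.next Action.sense F l h) (M.next Action.control F l h) with h' | h'
  · exact ⟨_, h'⟩
  · exact ⟨_, h'⟩

lemma best_le_best {F G : List Outcome → H → ℝ} {l l' : List Outcome} {h : H}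
    (hFG : ∀ o h', F (o :: l) h' ≤ G (o :: l') h') : M.best F l h ≤ M.best G l' h :=
  min_le_min (next_mono_at hFG) (next_mono_at hFG)

lemma best_nonneg {F : List Outcome → H → ℝ} (hF : ∀ l h, 0 ≤ F l h) (l : List Outcome) (h : H) :
    0 ≤ M.best F l h := le_min (next_nonneg hF) (next_nonneg hF)

/-- Value iteration: the minimal expected discounted cost over `k` slots. -/
def valIter (α : ℝ) : ℕ → List Outcome → H → ℝ
  | 0 => fun _ _ => 0
  | k + 1 => fun l h => M.cost l + α * M.best (valIter α k) l h

lemma valIter_succ (α : ℝ) (k : ℕ) (l : List Outcome) (h : H) :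
    M.valIter α (k + 1) l h = M.cost l + α * M.best (M.valIter α k) l h := rfl

lemma cost_nonneg (l : List Outcome) : 0 ≤ M.cost l := windowSum_nonneg M.q_nonneg l

lemma cost_append (l l' : List Outcome) :
    M.cost (l ++ l') = M.cost l + windowSum (fun s => M.q (l ++ s)) l' :=
  windowSum_append _ _ _

lemma cost_append_singleton (l : List Outcome) (o : Outcome) :
    M.cost (l ++ [o]) = M.cost l + M.q l := by
  rw [cost_append]; simp [windowSum]

lemma cost_nil : M.cost [] = 0 := windowSum_nil _

lemma cost_le_append (l l' : List Outcome) : M.cost l ≤ M.cost (l ++ l') := by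
  rw [cost_append]
  exact le_add_of_nonneg_right (windowSum_nonneg (fun _ => M.q_nonneg _) _)

section value

variable {α : ℝ}

lemma valIter_nonneg (hα : 0 ≤ α) (k : ℕ) (l : List Outcome) (h : H) :
    0 ≤ M.valIter α k l h := by
  induction k generalizing l h with
  | zero => exact le_rfl
  | succ k ih => exact add_nonneg (M.cost_nonneg l) (mul_nonneg hα (M.best_nonneg ih l h))

lemma valIter_le_succ (hα : 0 ≤ α) (k : ℕ) (l : List Outcome) (h : H) :
    M.valIter α k l h ≤ M.valIter α (k + 1) l h := by
  induction k generalizing l h with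
  | zero => exact M.valIter_nonneg hα 1 l h
  | succ k ih =>
    exact add_le_add le_rfl (mul_le_mul_of_nonneg_left
      (M.best_le_best fun o h' => ih (o :: l) h') hα)

lemma valIter_mono (hα : 0 ≤ α) (l : List Outcome) (h : H) :
    Monotone fun k => M.valIter α k l h :=
  monotone_nat_of_le_succ fun k => M.valIter_le_succ hα k l h

/-- The long-run average cost of the good decision rule. -/
def goodCost : ℝ := M.Cc / (1 - M.lam) * M.K

lemma goodCost_nonneg : 0 ≤ M.goodCost :=
  mul_nonneg (div_nonneg M.Cc_nonneg (sub_nonneg.2 M.lam_lt_one.le)) M.K_nonneg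

lemma valIter_le (hα0 : 0 ≤ α) (hα1 : α < 1) (k : ℕ) (l : List Outcome) (h : H) :
    M.valIter α k l h ≤ M.Cc / (1 - M.lam) * M.W l + M.goodCost / (1 - α) := by
  have hlam : 0 < 1 - M.lam := sub_pos.2 M.lam_lt_one
  have hα : 0 < 1 - α := sub_pos.2 hα1
  set a := M.Cc / (1 - M.lam) with ha
  have ha0 : 0 ≤ a := div_nonneg M.Cc_nonneg hlam.le
  have hb0 : 0 ≤ M.goodCost / (1 - α) := div_nonneg M.goodCost_nonneg hα.le
  induction k generalizing l h with
  | zero => have := M.W_nonneg l; simp only [valIter]; positivity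
  | succ k ih =>
    have h1 : M.next (M.good l) (M.valIter α k) l h ≤
        a * (M.lam * M.W l + M.K) + M.goodCost / (1 - α) := by
      refine (next_mono_at (G := fun l h => a * (M.W l * 1) + M.goodCost / (1 - α))
        fun o h' => by rw [mul_one]; exact ih _ _).trans ?_
      rw [next_add (F := fun l h => a * (M.W l * 1)) (G := fun _ _ => M.goodCost / (1 - α)),
        next_const, next_const_mul (F := fun l _ => M.W l * 1)]
      have := next_good_le (M := M) (l := l) (h := h) (fun _ => 1) (fun _ => zero_le_one)
      rw [chan_const, mul_one] at this
      gcongr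
    have h2 := (M.best_le (M.valIter α k) (M.good l) l h).trans h1
    have h3 : M.goodCost = a * M.K := rfl
    have h4 : M.Cc = a * (1 - M.lam) := by rw [ha]; field_simp
    have h5 := M.cost_le l
    have h6 : M.goodCost / (1 - α) = a * M.K + α * (M.goodCost / (1 - α)) := by
      rw [← h3]; field_simp; ring
    have h7 : 0 ≤ a * (M.lam * M.W l + M.K) := by
      have := M.W_nonneg l; have := M.K_nonneg; have := M.lam_nonneg; positivity
    rw [valIter]
    calc M.cost l + α * M.best (M.valIter α k) l h
        ≤ a * (1 - M.lam) * M.W l + α * (a * (M.lam * M.W l + M.K) + M.goodCost / (1 - α)) := by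
          rw [← h4]
          exact add_le_add h5 (mul_le_mul_of_nonneg_left h2 hα0)
      _ ≤ a * (1 - M.lam) * M.W l +
          (a * (M.lam * M.W l + M.K) + α * (M.goodCost / (1 - α))) := by
          have := mul_le_of_le_one_left h7 hα1.le
          linarith
      _ = a * M.W l + (a * M.K + α * (M.goodCost / (1 - α))) := by ring
      _ = _ := by rw [← h6]

/-- The minimal expected discounted cost. -/
def val (α : ℝ) (l : List Outcome) (h : H) : ℝ := ⨆ k, M.valIter α k l h

lemma bddAbove_valIter (hα0 : 0 ≤ α) (hα1 : α < 1) (l : List Outcome) (h : H) :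
    BddAbove (Set.range fun k => M.valIter α k l h) :=
  ⟨_, by rintro _ ⟨k, rfl⟩; exact M.valIter_le hα0 hα1 k l h⟩

open Filter Topology

lemma tendsto_valIter (hα0 : 0 ≤ α) (hα1 : α < 1) (l : List Outcome) (h : H) :
    Tendsto (fun k => M.valIter α k l h) atTop (𝓝 (M.val α l h)) :=
  tendsto_atTop_ciSup (M.valIter_mono hα0 l h) (M.bddAbove_valIter hα0 hα1 l h)

lemma valIter_le_val (hα0 : 0 ≤ α) (hα1 : α < 1) (k : ℕ) (l : List Outcome) (h : H) :
    M.valIter α k l h ≤ M.val α l h :=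
  le_ciSup (M.bddAbove_valIter hα0 hα1 l h) k

lemma val_le_of_forall {l : List Outcome} {h : H} {b : ℝ}
    (hb : ∀ k, M.valIter α k l h ≤ b) : M.val α l h ≤ b := ciSup_le hb

lemma val_nonneg (hα0 : 0 ≤ α) (hα1 : α < 1) (l : List Outcome) (h : H) : 0 ≤ M.val α l h :=
  M.valIter_le_val hα0 hα1 0 l h

lemma val_le (hα0 : 0 ≤ α) (hα1 : α < 1) (l : List Outcome) (h : H) :
    M.val α l h ≤ M.Cc / (1 - M.lam) * M.W l + M.goodCost / (1 - α) :=
  M.val_le_of_forall fun k => M.valIter_le hα0 hα1 k l h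

lemma tendsto_best {ι : Type*} {f : Filter ι} {F : ι → List Outcome → H → ℝ}
    {G : List Outcome → H → ℝ} (hF : ∀ l h, Tendsto (fun i => F i l h) f (𝓝 (G l h)))
    (l : List Outcome) (h : H) : Tendsto (fun i => M.best (F i) l h) f (𝓝 (M.best G l h)) := by
  have : ∀ a, Tendsto (fun i => M.next a (F i) l h) f (𝓝 (M.next a G l h)) := fun a =>
    tendsto_finsetSum _ fun h' _ => (((hF _ _).const_mul _).add ((hF _ _).const_mul _)).const_mul _
  exact (this _).min (this _)

/-- The optimality equation of the discounted problem. -/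
lemma val_eq (hα0 : 0 ≤ α) (hα1 : α < 1) (l : List Outcome) (h : H) :
    M.val α l h = M.cost l + α * M.best (M.val α) l h := by
  refine tendsto_nhds_unique
    ((M.tendsto_valIter hα0 hα1 l h).comp (tendsto_add_atTop_nat 1)) ?_
  exact ((M.tendsto_best (M.tendsto_valIter hα0 hα1) l h).const_mul α).const_add _

/-- A plant at rest is the best initial state. -/
lemma val_le_append (hα0 : 0 ≤ α) (hα1 : α < 1) (l p : List Outcome) (h : H) :
    M.val α l h ≤ M.val α (l ++ p) h := by
  refine M.val_le_of_forall fun k => le_trans ?_ (M.valIter_le_val hα0 hα1 k (l ++ p) h)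
  induction k generalizing l h with
  | zero => exact le_rfl
  | succ k ih =>
    exact add_le_add (M.cost_le_append l p) (mul_le_mul_of_nonneg_left
      (M.best_le_best fun o h' => ih (o :: l) h') hα0)

lemma val_nil_le (hα0 : 0 ≤ α) (hα1 : α < 1) (p : List Outcome) (h : H) :
    M.val α [] h ≤ M.val α p h := M.val_le_append hα0 hα1 [] p h

/-- Records that cannot be told apart by future costs have the same value. -/
lemma val_congr {l l' : List Outcome} (hl : ∀ t, M.cost (t ++ l) = M.cost (t ++ l')) (h : H) :
    M.val α l h = M.val α l' h := by
  have key : ∀ k t h, M.valIter α k (t ++ l) h = M.valIter α k (t ++ l') h := by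
    intro k
    induction k with
    | zero => intro t h; rfl
    | succ k ih =>
      intro t h
      rw [valIter_succ, valIter_succ, hl t]
      congr 2
      exact le_antisymm (M.best_le_best fun o h' => (ih (o :: t) h').le)
        (M.best_le_best fun o h' => (ih (o :: t) h').ge)
  exact congrArg iSup (funext fun k => key k [] h)

/-- The effect of a single new disturbance on the value of a plant at rest. -/
def gap (α : ℝ) (h : H) : ℝ := M.val α [sensed] h - M.val α [] h

lemma gap_nonneg (hα0 : 0 ≤ α) (hα1 : α < 1) : 0 ≤ M.gap α := fun h =>
  sub_nonneg.2 (M.val_nil_le hα0 hα1 _ h)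

lemma val_singleton (o : Outcome) (h : H) : M.val α [o] h = M.val α [sensed] h :=
  M.val_congr (fun t => by rw [cost_append_singleton, cost_append_singleton]) h

/-- A plant at rest costs nothing, and then one disturbance has entered. -/
lemma val_nil_eq (hα0 : 0 ≤ α) (hα1 : α < 1) (h : H) :
    M.val α [] h = α * M.chan (fun h => M.val α [sensed] h) h := by
  rw [M.val_eq hα0 hα1, cost_nil, zero_add]
  congr 1
  obtain ⟨a, ha⟩ := M.exists_best (M.val α) [] h
  rw [ha, ← next_channel (a := a) (l := [])]
  simp only [next, val_singleton]

lemma val_nil_sub (hα0 : 0 ≤ α) (hα1 : α < 1) (h : H) :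
    M.val α [] h - α * M.chan (M.val α []) h = α * M.chan (M.gap α) h := by
  have h1 : M.gap α = (fun h => M.val α [sensed] h) - M.val α [] := rfl
  rw [h1, map_sub, Pi.sub_apply, mul_sub, ← M.val_nil_eq hα0 hα1]

/-- The expectation of `F` after `k` slots under the decision rule `a`. -/
def runExpect (a : List Outcome → H → Action) (F : List Outcome → ℝ) :
    ℕ → List Outcome → H → ℝ
  | 0 => fun l _ => F l
  | k + 1 => fun l h => M.next (a l h) (runExpect a F k) l h

lemma runExpect_mono (a : List Outcome → H → Action) {F G : List Outcome → ℝ}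
    (hFG : ∀ l, F l ≤ G l) (k : ℕ) (l : List Outcome) (h : H) :
    M.runExpect a F k l h ≤ M.runExpect a G k l h := by
  induction k generalizing l h with
  | zero => exact hFG l
  | succ k ih => exact next_mono_at fun o h' => ih _ _

lemma runExpect_add (a : List Outcome → H → Action) (F G : List Outcome → ℝ)
    (k : ℕ) (l : List Outcome) (h : H) :
    M.runExpect a (fun l => F l + G l) k l h = M.runExpect a F k l h + M.runExpect a G k l h := by
  induction k generalizing l h with
  | zero => rfl
  | succ k ih => simp only [runExpect, next, ih, ← Finset.sum_add_distrib]
                 exact Finset.sum_congr rfl fun _ _ => by ring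

lemma runExpect_const_mul (a : List Outcome → H → Action) (c : ℝ) (F : List Outcome → ℝ)
    (k : ℕ) (l : List Outcome) (h : H) :
    M.runExpect a (fun l => c * F l) k l h = c * M.runExpect a F k l h := by
  induction k generalizing l h with
  | zero => rfl
  | succ k ih => simp only [runExpect, next, ih, Finset.mul_sum]
                 exact Finset.sum_congr rfl fun _ _ => by ring

/-- The value iteration is a lower bound for the cost of every decision rule. -/
lemma valIter_le_runExpect (hα0 : 0 ≤ α) (a : List Outcome → H → Action) (p : List Outcome)
    (k : ℕ) (l : List Outcome) (h : H) :
    pathSum α (fun t => M.cost (t ++ p)) l - α ^ l.length * M.cost (l ++ p) +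
      α ^ l.length * M.valIter α (k + 1) (l ++ p) h ≤
    M.runExpect a (pathSum α fun t => M.cost (t ++ p)) k l h := by
  set f : List Outcome → ℝ := fun t => M.cost (t ++ p) with hf
  induction k generalizing l h with
  | zero =>
    have hb : M.best (M.valIter α 0) (l ++ p) h = 0 := by simp [best, next, valIter]
    rw [valIter_succ, hb]
    simp [runExpect]
  | succ k ih =>
    have h1 : M.next (a l h) (fun t h' => pathSum α f l +
        α ^ (l.length + 1) * M.valIter α (k + 1) (t ++ p) h') l h ≤
        M.runExpect a (pathSum α f) (k + 1) l h := by
      refine next_mono_at fun o h' => ?_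
      have := ih (o :: l) h'
      simp only [pathSum, List.length_cons] at this
      simp only [hf] at this ⊢
      linarith
    rw [next_add (F := fun _ _ => pathSum α f l), next_const, next_const_mul] at h1
    refine le_trans ?_ h1
    have h2 := M.best_le (M.valIter α (k + 1)) (a l h) (l ++ p) h
    have h3 : M.next (a l h) (fun t h' => M.valIter α (k + 1) (t ++ p) h') l h =
        M.next (a l h) (M.valIter α (k + 1)) (l ++ p) h := rfl
    rw [h3, valIter_succ, pow_succ]
    have h4 := mul_le_mul_of_nonneg_left h2 (mul_nonneg (pow_nonneg hα0 l.length) hα0)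
    linarith

/-- An optimal decision rule attains the value up to the cost that remains. -/
lemma runExpect_le_val (hα0 : 0 ≤ α) (hα1 : α < 1) (a : List Outcome → H → Action)
    (p : List Outcome) (ha : ∀ l h, M.best (M.val α) (l ++ p) h =
      M.next (a l h) (M.val α) (l ++ p) h) (k : ℕ) (l : List Outcome) (h : H) :
    M.runExpect a (pathSum α fun t => M.cost (t ++ p)) k l h ≤
      pathSum α (fun t => M.cost (t ++ p)) l - α ^ l.length * M.cost (l ++ p) +
        α ^ l.length * M.val α (l ++ p) h := by
  set f : List Outcome → ℝ := fun t => M.cost (t ++ p) with hf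
  induction k generalizing l h with
  | zero =>
    have h1 : M.cost (l ++ p) ≤ M.val α (l ++ p) h := by
      rw [M.val_eq hα0 hα1]
      exact le_add_of_nonneg_right (mul_nonneg hα0 (M.best_nonneg (M.val_nonneg hα0 hα1) _ _))
    have := mul_le_mul_of_nonneg_left h1 (pow_nonneg hα0 l.length)
    simp only [runExpect]
    linarith
  | succ k ih =>
    have h1 : M.runExpect a (pathSum α f) (k + 1) l h ≤ M.next (a l h) (fun t h' =>
        pathSum α f l + α ^ (l.length + 1) * M.val α (t ++ p) h') l h := by
      refine next_mono_at fun o h' => ?_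
      have := ih (o :: l) h'
      simp only [pathSum, List.length_cons] at this
      simp only [hf] at this ⊢
      linarith
    rw [next_add (F := fun _ _ => pathSum α f l), next_const, next_const_mul] at h1
    refine h1.trans (le_of_eq ?_)
    have h3 : M.next (a l h) (fun t h' => M.val α (t ++ p) h') l h =
        M.best (M.val α) (l ++ p) h := (ha l h).symm
    rw [h3, M.val_eq hα0 hα1 (l ++ p), pow_succ]
    ring

/-- The value from an arbitrary record: apply the actions that are optimal after a single
disturbance to a plant with the record `p`. The extra cost is dominated by what the single
disturbance costs. -/
theorem val_le_add_gap (hα0 : 0 ≤ α) (hα1 : α < 1) (p : List Outcome) (h : H) :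
    M.val α p h ≤ M.val α [] h + (1 + M.Cd * M.W p) * M.gap α h := by
  choose a ha using fun l h => M.exists_best (M.val α) (l ++ [sensed]) h
  have hCW : 0 ≤ M.Cd * M.W p := mul_nonneg M.Cd_nonneg (M.W_nonneg p)
  have key : ∀ k, M.valIter α (k + 1) p h + M.Cd * M.W p * M.valIter α (k + 1) [] h ≤
      (1 + M.Cd * M.W p) * M.val α [sensed] h := by
    intro k
    set E0 := M.runExpect a (pathSum α M.cost) k [] h with hE0
    set Eq := M.runExpect a (pathSum α M.q) k [] h with hEq
    have h1 : M.valIter α (k + 1) [] h ≤ E0 := by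
      have := M.valIter_le_runExpect hα0 a [] k [] h
      simpa [pathSum] using this
    have h2 : E0 + Eq ≤ M.val α [sensed] h := by
      have h3 := M.runExpect_le_val hα0 hα1 a [sensed] ha k [] h
      have h4 : (pathSum α fun t => M.cost (t ++ [sensed])) =
          fun l => pathSum α M.cost l + pathSum α M.q l := by
        ext l
        simp only [cost_append_singleton, pathSum_add]
      rw [h4, runExpect_add] at h3
      have h5 : M.cost [sensed] = M.cost [] + M.q [] := M.cost_append_singleton [] sensed
      simpa [pathSum, h5] using h3
    have hEq0 : 0 ≤ Eq := by
      have := M.runExpect_mono a (fun l => pathSum_nonneg hα0 M.q_nonneg l) k [] h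
      refine le_trans (le_of_eq ?_) this
      simpa using (M.runExpect_const_mul a 0 (fun _ => 0) k [] h).symm
    have h3 : M.valIter α (k + 1) p h ≤ E0 + M.Cd * M.W p * Eq := by
      have h4 := M.valIter_le_runExpect hα0 a p k [] h
      have h5 : ∀ l, pathSum α (fun t => M.cost (t ++ p)) l ≤
          pathSum α M.cost l + M.Cd * M.W p * pathSum α M.q l := by
        intro l
        simp only [cost_append, pathSum_add]
        have := M.dominated α hα0 hα1.le l p
        gcongr
      have h6 := M.runExpect_mono a h5 k [] h
      rw [runExpect_add, runExpect_const_mul] at h6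
      simp only [pathSum, List.length_nil, pow_zero, one_mul, sub_self, zero_add,
        List.nil_append] at h4
      exact h4.trans h6
    nlinarith [mul_le_mul_of_nonneg_left h1 hCW, mul_le_mul_of_nonneg_left h2 hCW]
  have hlim := le_of_tendsto'
    (((M.tendsto_valIter hα0 hα1 p h).comp (tendsto_add_atTop_nat 1)).add
      (((M.tendsto_valIter hα0 hα1 [] h).comp (tendsto_add_atTop_nat 1)).const_mul
        (M.Cd * M.W p))) key
  rw [gap]
  linarith

/-- Bound for the mean of the Lyapunov function after `k` slots under the good decision rule. -/
def meanBound (k : ℕ) (x : ℝ) : ℝ :=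
  M.lam ^ k * x + M.K * ∑ i ∈ Finset.range k, M.lam ^ i

lemma meanBound_nonneg {x : ℝ} (hx : 0 ≤ x) (k : ℕ) : 0 ≤ M.meanBound k x := by
  have := M.lam_nonneg; have := M.K_nonneg; unfold meanBound; positivity

lemma meanBound_step (k : ℕ) (x : ℝ) :
    M.meanBound k (M.lam * x + M.K) = M.meanBound (k + 1) x := by
  rw [meanBound, meanBound, Finset.sum_range_succ]; ring

lemma meanBound_le {x : ℝ} (hx : 0 ≤ x) (k : ℕ) :
    M.meanBound k x ≤ x + M.K / (1 - M.lam) := by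
  have h1 : M.lam ^ k ≤ 1 := pow_le_one₀ M.lam_nonneg M.lam_lt_one.le
  have h2 : ∑ i ∈ Finset.range k, M.lam ^ i ≤ (1 - M.lam)⁻¹ := by
    rw [← tsum_geometric_of_lt_one M.lam_nonneg M.lam_lt_one]
    exact (summable_geometric_of_lt_one M.lam_nonneg M.lam_lt_one).sum_le_tsum _
      fun i _ => pow_nonneg M.lam_nonneg i
  rw [meanBound, div_eq_mul_inv]
  exact add_le_add (mul_le_of_le_one_left hx h1) (mul_le_mul_of_nonneg_left h2 M.K_nonneg)

lemma next_meanBound_le (k : ℕ) (x : H → ℝ) (hx : 0 ≤ x) (l : List Outcome) (h : H) :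
    M.next (M.good l) (fun l h => M.meanBound k (M.W l) * x h) l h ≤
      M.meanBound (k + 1) (M.W l) * M.chan x h := by
  set b := M.K * ∑ i ∈ Finset.range k, M.lam ^ i with hb
  have h1 : (fun (l : List Outcome) h => M.meanBound k (M.W l) * x h) =
      fun l h => M.lam ^ k * (M.W l * x h) + b * x h := by
    ext l h; simp only [meanBound, hb]; ring
  rw [h1, next_add (F := fun l h => M.lam ^ k * (M.W l * x h)) (G := fun _ h => b * x h),
    next_const_mul, next_const_mul (F := fun _ h => x h), next_channel, ← meanBound_step]
  have h2 := mul_le_mul_of_nonneg_left (next_good_le (M := M) (l := l) (h := h) x hx)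
    (pow_nonneg M.lam_nonneg k)
  rw [meanBound]
  linarith

/-- The value of `k` slots of the good decision rule, followed by optimal scheduling. -/
lemma val_le_good (hα0 : 0 ≤ α) (hα1 : α < 1) (k : ℕ) (l : List Outcome) (h : H) :
    M.val α l h ≤ M.Cc * ∑ i ∈ Finset.range k, M.meanBound i (M.W l) +
      α ^ k * (M.chan ^ k) (M.val α []) h +
      (1 + M.Cd * M.meanBound k (M.W l)) * (M.chan ^ k) (M.gap α) h := by
  have hgapk : ∀ k, 0 ≤ (M.chan ^ k) (M.gap α) := by
    intro k
    induction k with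
    | zero => exact M.gap_nonneg hα0 hα1
    | succ k ih => rw [pow_succ']; exact M.chan_nonneg ih
  have hCc := M.Cc_nonneg
  have hCd := M.Cd_nonneg
  induction k generalizing l h with
  | zero => simpa [meanBound] using M.val_le_add_gap hα0 hα1 l h
  | succ k ih =>
    set y := (M.chan ^ k) (M.gap α) with hy
    set z := (M.chan ^ k) (M.val α []) with hz
    have hy1 : (M.chan ^ (k + 1)) (M.gap α) = M.chan y := by rw [pow_succ']; rfl
    have hz1 : (M.chan ^ (k + 1)) (M.val α []) = M.chan z := by rw [pow_succ']; rfl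
    have hmb := fun i => M.meanBound_nonneg (M.W_nonneg l) i
    have hyn : 0 ≤ M.chan y h := M.chan_nonneg (hgapk k) h
    have h1 : M.next (M.good l) (M.val α) l h ≤
        M.Cc * ∑ i ∈ Finset.range k, M.meanBound (i + 1) (M.W l) + α ^ k * M.chan z h +
        (M.chan y h + M.Cd * (M.meanBound (k + 1) (M.W l) * M.chan y h)) := by
      refine (next_mono_at (l' := l) (G := fun l h =>
        M.Cc * ∑ i ∈ Finset.range k, M.meanBound i (M.W l) * 1 + α ^ k * z h +
          (y h + M.Cd * (M.meanBound k (M.W l) * y h))) fun o h' => ?_).trans ?_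
      · refine (ih _ _).trans (le_of_eq ?_)
        simp only [mul_one]; ring
      · rw [next_add (F := fun l h => M.Cc * ∑ i ∈ Finset.range k, M.meanBound i (M.W l) * 1 +
          α ^ k * z h), next_add (F := fun l h => M.Cc * ∑ i ∈ Finset.range k,
          M.meanBound i (M.W l) * 1) (G := fun l h => α ^ k * z h),
          next_add (F := fun l h => y h), next_const_mul, next_sum,
          next_const_mul (F := fun l h => z h), next_const_mul, next_channel, next_channel]
        have h2 : ∀ i, M.next (M.good l) (fun l _ => M.meanBound i (M.W l) * 1) l h ≤
            M.meanBound (i + 1) (M.W l) := fun i => by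
          have := M.next_meanBound_le i (fun _ => 1) (fun _ => zero_le_one) l h
          rwa [chan_const, mul_one] at this
        have h3 := M.next_meanBound_le k y (hgapk k) l h
        gcongr with i hi
        exact h2 i
    have h2 := mul_le_mul_of_nonneg_left ((M.best_le (M.val α) (M.good l) l h).trans h1) hα0
    have h3 : M.cost l ≤ M.Cc * M.meanBound 0 (M.W l) := by
      have : M.cost l ≤ M.Cc * M.W l := M.cost_le l
      simpa [meanBound] using this
    have h4 : 0 ≤ M.Cc * ∑ i ∈ Finset.range k, M.meanBound (i + 1) (M.W l) :=
      mul_nonneg hCc (Finset.sum_nonneg fun i _ => hmb _)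
    have h5 : 0 ≤ M.chan y h + M.Cd * (M.meanBound (k + 1) (M.W l) * M.chan y h) := by
      have := hmb (k + 1); positivity
    have h6 := mul_le_of_le_one_left h4 hα1.le
    have h7 := mul_le_of_le_one_left h5 hα1.le
    rw [M.val_eq hα0 hα1, hy1, hz1, Finset.sum_range_succ', pow_succ]
    linarith

/-- A recursive bound for the gap along the channel. -/
theorem gap_le (hα0 : 0 ≤ α) (hα1 : α < 1) (k : ℕ) (h : H) :
    M.gap α h ≤ k * (M.Cc * (M.W [sensed] + M.K / (1 - M.lam))) +
      (1 + M.Cd * (M.W [sensed] + M.K / (1 - M.lam))) * (M.chan ^ k) (M.gap α) h := by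
  have hgapk : 0 ≤ (M.chan ^ k) (M.gap α) := by
    induction k with
    | zero => exact M.gap_nonneg hα0 hα1
    | succ k ih => rw [pow_succ']; exact M.chan_nonneg ih
  have hz : ∀ k h, α ^ k * (M.chan ^ k) (M.val α []) h ≤ M.val α [] h := by
    intro k
    induction k with
    | zero => intro h; simp
    | succ k ih =>
      intro h
      have h1 := M.val_nil_sub hα0 hα1 h
      have h2 : 0 ≤ α * M.chan (M.gap α) h :=
        mul_nonneg hα0 (M.chan_nonneg (M.gap_nonneg hα0 hα1) h)
      have h3 : M.chan ((α ^ k) • (M.chan ^ k) (M.val α [])) ≤ M.chan (M.val α []) :=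
        M.chan_mono fun h => ih h
      have h4 := mul_le_mul_of_nonneg_left (h3 h) hα0
      rw [map_smul, Pi.smul_apply, smul_eq_mul] at h4
      rw [pow_succ' M.chan, pow_succ', Module.End.mul_apply]
      linarith
  have h1 := M.val_le_good hα0 hα1 k [sensed] h
  have h2 := hz k h
  have hmb := fun i => M.meanBound_le (M.W_nonneg [sensed]) i
  have h3 : M.Cc * ∑ i ∈ Finset.range k, M.meanBound i (M.W [sensed]) ≤
      k * (M.Cc * (M.W [sensed] + M.K / (1 - M.lam))) := by
    rw [mul_left_comm]
    refine mul_le_mul_of_nonneg_left ?_ M.Cc_nonneg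
    refine (Finset.sum_le_sum fun i _ => hmb i).trans (le_of_eq ?_)
    simp [mul_add]
  have h4 : (1 + M.Cd * M.meanBound k (M.W [sensed])) * (M.chan ^ k) (M.gap α) h ≤
      (1 + M.Cd * (M.W [sensed] + M.K / (1 - M.lam))) * (M.chan ^ k) (M.gap α) h := by
    refine mul_le_mul_of_nonneg_right ?_ (hgapk h)
    have := mul_le_mul_of_nonneg_left (hmb k) M.Cd_nonneg
    linarith
  rw [gap]
  linarith

end value

end Scheduling

end

/-! ### The vanishing-discount limit -/

noncomputable section

namespace Scheduling

open Filter Topology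

variable {H : Type*} [Fintype H] (M : Scheduling H)

lemma norm_chan_le (x : H → ℝ) : ‖M.chan x‖ ≤ ‖x‖ := by
  refine (pi_norm_le_iff_of_nonneg (norm_nonneg x)).2 fun h => ?_
  rw [Real.norm_eq_abs, chan_apply]
  refine (Finset.abs_sum_le_sum_abs _ _).trans ?_
  calc ∑ h', |M.P h h' * x h'| ≤ ∑ h', M.P h h' * ‖x‖ := by
        refine Finset.sum_le_sum fun h' _ => ?_
        rw [abs_mul, abs_of_nonneg (M.P_nonneg h h')]
        exact mul_le_mul_of_nonneg_left (norm_le_pi_norm x h') (M.P_nonneg h h')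
    _ = ‖x‖ := by rw [← Finset.sum_mul, M.P_sum, one_mul]

lemma norm_chan_pow_le (k : ℕ) (x : H → ℝ) : ‖(M.chan ^ k) x‖ ≤ ‖x‖ := by
  induction k with
  | zero => exact le_rfl
  | succ k ih => rw [pow_succ', Module.End.mul_apply]; exact (M.norm_chan_le _).trans ih

/-- Fixed vectors and coboundaries of the transition operator span everything: a vector that is
both is zero, because its multiples are bounded. -/
lemma exists_ergodic_decomposition (x : H → ℝ) :
    ∃ d y : H → ℝ, x = d + (y - M.chan y) ∧ M.chan d = d := by
  set T : (H → ℝ) →ₗ[ℝ] (H → ℝ) := LinearMap.id - M.chan with hT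
  have hdisj : Disjoint (LinearMap.ker T) (LinearMap.range T) := by
    rw [Submodule.disjoint_def]
    rintro x hx ⟨y, rfl⟩
    set x := T y with hxy
    have hx' : M.chan x = x := by
      have : x - M.chan x = 0 := hx
      exact (sub_eq_zero.1 this).symm
    have hpow : ∀ N : ℕ, (M.chan ^ N) y = y - (N : ℝ) • x := by
      intro N
      induction N with
      | zero => simp
      | succ N ih =>
        have h1 : M.chan y = y - x := by rw [hxy, hT]; simp
        rw [pow_succ', Module.End.mul_apply, ih, map_sub, map_smul, hx', h1]
        push_cast
        rw [add_smul, one_smul]; abel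
    have hbd : ∀ N : ℕ, (N : ℝ) * ‖x‖ ≤ 2 * ‖y‖ := by
      intro N
      have h1 : (N : ℝ) • x = y - (M.chan ^ N) y := by rw [hpow]; abel
      have h2 := norm_sub_le y ((M.chan ^ N) y)
      rw [← h1, norm_smul, Real.norm_natCast] at h2
      linarith [M.norm_chan_pow_le N y]
    by_contra hne
    have hpos : 0 < ‖x‖ := norm_pos_iff.2 hne
    obtain ⟨N, hN⟩ := exists_nat_gt (2 * ‖y‖ / ‖x‖)
    rw [div_lt_iff₀ hpos] at hN
    linarith [hbd N]
  have htop : LinearMap.ker T ⊔ LinearMap.range T = ⊤ := by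
    refine Submodule.eq_top_of_disjoint _ _ ?_ hdisj
    rw [add_comm, LinearMap.finrank_range_add_finrank_ker]
  have hx : x ∈ LinearMap.ker T ⊔ LinearMap.range T := by rw [htop]; trivial
  obtain ⟨d, hd, _, ⟨y, rfl⟩, rfl⟩ := Submodule.mem_sup.1 hx
  refine ⟨d, y, by simp [hT], ?_⟩
  have : d - M.chan d = 0 := hd
  exact (sub_eq_zero.1 this).symm

lemma exists_bounded_ergodic_decomposition :
    ∃ C : ℝ, 0 ≤ C ∧ ∀ x : H → ℝ, ∃ d y : H → ℝ,
      x = d + (y - M.chan y) ∧ M.chan d = d ∧ ‖y‖ ≤ C * ‖x‖ := by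
  classical
  choose d y hxy hd using fun i : H => M.exists_ergodic_decomposition (Pi.single i 1)
  refine ⟨∑ i, ‖y i‖, Finset.sum_nonneg fun _ _ => norm_nonneg _, fun x =>
    ⟨∑ i, x i • d i, ∑ i, x i • y i, ?_, ?_, ?_⟩⟩
  · have h1 : x = ∑ i, x i • (Pi.single i 1 : H → ℝ) := by
      ext h; simp [Finset.sum_apply, Pi.single_apply]
    conv_lhs => rw [h1]
    rw [map_sum, ← Finset.sum_sub_distrib, ← Finset.sum_add_distrib]
    refine Finset.sum_congr rfl fun i _ => ?_
    rw [hxy i, map_smul, smul_add, smul_sub]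
  · rw [map_sum]
    exact Finset.sum_congr rfl fun i _ => by rw [map_smul, hd]
  · rw [Finset.sum_mul]
    refine (norm_sum_le _ _).trans (Finset.sum_le_sum fun i _ => ?_)
    rw [norm_smul, mul_comm]
    exact mul_le_mul_of_nonneg_left (norm_le_pi_norm x i) (norm_nonneg _)

/-- The normalized discounted total of `d + (y - chan y)` is close to `d`, for `d` fixed. -/
lemma norm_sub_le_of_resolvent {α : ℝ} (hα0 : 0 ≤ α) (hα1 : α < 1) {d y z η : H → ℝ}
    (hd : M.chan d = d)
    (hz : z - α • M.chan z = (1 - α) • (d + (y - M.chan y) + η)) :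
    ‖z - d‖ ≤ ‖η‖ + 2 * (1 - α) * ‖y‖ := by
  have hα : 0 < 1 - α := sub_pos.2 hα1
  set u := z - d - (1 - α) • y with hu
  have h1 : u - α • M.chan u = (1 - α) • (η - (1 - α) • M.chan y) := by
    have : u - α • M.chan u = (z - α • M.chan z) - (1 - α) • d -
        (1 - α) • (y - α • M.chan y) := by
      rw [hu, map_sub, map_sub, map_smul, hd]
      module
    rw [this, hz]
    module
  have h2 : ‖u‖ ≤ ‖u - α • M.chan u‖ + α * ‖u‖ := by
    calc ‖u‖ = ‖(u - α • M.chan u) + α • M.chan u‖ := by rw [sub_add_cancel]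
      _ ≤ ‖u - α • M.chan u‖ + ‖α • M.chan u‖ := norm_add_le _ _
      _ ≤ _ := by
        rw [norm_smul, Real.norm_of_nonneg hα0]
        gcongr
        exact M.norm_chan_le u
  have h3 : ‖u - α • M.chan u‖ ≤ (1 - α) * (‖η‖ + (1 - α) * ‖y‖) := by
    rw [h1, norm_smul, Real.norm_of_nonneg hα.le]
    refine mul_le_mul_of_nonneg_left ((norm_sub_le _ _).trans ?_) hα.le
    rw [norm_smul, Real.norm_of_nonneg hα.le]
    gcongr
    exact M.norm_chan_le y
  have h4 : ‖u‖ ≤ ‖η‖ + (1 - α) * ‖y‖ := by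
    have : (1 - α) * ‖u‖ ≤ (1 - α) * (‖η‖ + (1 - α) * ‖y‖) := by linarith
    exact le_of_mul_le_mul_left this hα
  have h5 : z - d = u + (1 - α) • y := by rw [hu]; abel
  have h6 := norm_add_le u ((1 - α) • y)
  rw [norm_smul, Real.norm_of_nonneg hα.le] at h6
  rw [h5]
  linarith

/-- The gap stays bounded as the discounting vanishes. Its Cesàro means along the channel are
controlled by the value of a plant at rest, also from transient channel states. -/
theorem exists_gap_bound : ∃ α₀ B : ℝ, 0 ≤ α₀ ∧ α₀ < 1 ∧ 0 ≤ B ∧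
    ∀ α, α₀ < α → α < 1 → ∀ h, M.gap α h ≤ B := by
  obtain ⟨C, hC, hdec⟩ := M.exists_bounded_ergodic_decomposition
  have hlam : 0 < 1 - M.lam := sub_pos.2 M.lam_lt_one
  have hK' : 0 ≤ M.K / (1 - M.lam) := div_nonneg M.K_nonneg hlam.le
  set κ := 1 + M.Cd * (M.W [sensed] + M.K / (1 - M.lam)) with hκ
  have hκ1 : 0 < κ := by
    have := mul_nonneg M.Cd_nonneg (add_nonneg (M.W_nonneg [sensed]) hK')
    linarith
  set c := M.Cc * (M.W [sensed] + M.K / (1 - M.lam)) with hc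
  have hc0 : 0 ≤ c := mul_nonneg M.Cc_nonneg (add_nonneg (M.W_nonneg [sensed]) hK')
  set G := M.Cc / (1 - M.lam) * M.W [] + M.goodCost with hG
  have hG0 : 0 ≤ G := add_nonneg (mul_nonneg (div_nonneg M.Cc_nonneg hlam.le) (M.W_nonneg []))
    M.goodCost_nonneg
  obtain ⟨N, hN⟩ := exists_nat_gt (8 * κ * C)
  have hN0 : (0 : ℝ) < N := lt_of_le_of_lt (by positivity) hN
  set ε := 1 / (16 * κ * (C + 1)) with hε
  have hε0 : 0 < ε := by positivity
  refine ⟨max (1 / 2) (1 - ε), 2 * (N * c + κ * (2 * G)), le_max_of_le_left (by norm_num),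
    max_lt (by norm_num) (by linarith), by positivity, fun α hα hα1 => ?_⟩
  have hα2 : 1 / 2 < α := (le_max_left _ _).trans_lt hα
  have hαε : 1 - α < ε := by linarith [(le_max_right (1 / 2) (1 - ε)).trans_lt hα]
  have hα0 : 0 ≤ α := by linarith
  have hα1' : 0 < 1 - α := sub_pos.2 hα1
  set b := M.gap α with hb
  have hb0 : 0 ≤ b := M.gap_nonneg hα0 hα1
  obtain ⟨d, y, hdy, hd, hy⟩ := hdec b
  -- the invariant part of the gap is controlled by the value of a plant at rest
  have hz : ‖(1 - α) • M.val α [] - α • d‖ ≤ 2 * (1 - α) * (C * ‖b‖) := by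
    have h1 := M.norm_sub_le_of_resolvent hα0 hα1 (d := α • d) (y := α • M.chan y)
      (z := (1 - α) • M.val α []) (η := 0) (by rw [map_smul, hd]) (by
        have h2 : M.val α [] - α • M.chan (M.val α []) = α • M.chan b := by
          ext h; exact M.val_nil_sub hα0 hα1 h
        rw [map_smul, smul_comm α, ← smul_sub, h2, hdy]
        simp only [map_add, map_sub, map_smul, hd]
        module)
    rw [norm_zero, zero_add, norm_smul, Real.norm_of_nonneg hα0] at h1
    refine h1.trans ?_
    have h3 := (M.norm_chan_le y).trans hy
    have h4 : α * ‖M.chan y‖ ≤ 1 * (C * ‖b‖) := mul_le_mul hα1.le h3 (norm_nonneg _) zero_le_one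
    rw [one_mul] at h4
    gcongr
  have hdh : ∀ h, d h ≤ 2 * G + 4 * (1 - α) * (C * ‖b‖) := by
    intro h
    have h1 := (norm_le_pi_norm ((1 - α) • M.val α [] - α • d) h).trans hz
    simp only [Pi.sub_apply, Pi.smul_apply, smul_eq_mul, Real.norm_eq_abs] at h1
    have h2 := (abs_le.1 h1).1
    have h3 : (1 - α) * M.val α [] h ≤ G := by
      have h4 := mul_le_mul_of_nonneg_left (M.val_le hα0 hα1 [] h) hα1'.le
      have h5 : (1 - α) * (M.Cc / (1 - M.lam) * M.W []) ≤ M.Cc / (1 - M.lam) * M.W [] :=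
        mul_le_of_le_one_left (mul_nonneg (div_nonneg M.Cc_nonneg hlam.le) (M.W_nonneg []))
          (by linarith)
      have h6 : (1 - α) * (M.goodCost / (1 - α)) = M.goodCost := by field_simp
      rw [mul_add, h6] at h4
      linarith
    by_cases hd0 : d h ≤ 0
    · have : 0 ≤ 4 * (1 - α) * (C * ‖b‖) := by positivity
      linarith
    · have : 1 / 2 * d h ≤ α * d h := mul_le_mul_of_nonneg_right hα2.le (not_le.1 hd0).le
      linarith
  -- the mean of the recursive bounds over `k < N`
  have hsum : ∀ K : ℕ, ∑ k ∈ Finset.range K, (M.chan ^ k) b = (K : ℝ) • d + y - (M.chan ^ K) y := by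
    intro K
    induction K with
    | zero => simp
    | succ K ih =>
      have h1 : (M.chan ^ K) d = d := by
        clear ih
        induction K with
        | zero => rfl
        | succ K ih => rw [pow_succ', Module.End.mul_apply, ih, hd]
      have h2 : (M.chan ^ K) b = d + ((M.chan ^ K) y - (M.chan ^ (K + 1)) y) := by
        rw [hdy, map_add, map_sub, h1, pow_succ, Module.End.mul_apply]
      rw [Finset.sum_range_succ, ih, h2]
      push_cast
      module
  have hbh : ∀ h, b h ≤ N * c + κ * (2 * G) + 1 / 2 * ‖b‖ := by
    intro h
    have h1 : ∑ k ∈ Finset.range N, b h ≤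
        ∑ k ∈ Finset.range N, (N * c + κ * (M.chan ^ k) b h) := by
      refine Finset.sum_le_sum fun k hk => (M.gap_le hα0 hα1 k h).trans ?_
      have : (k : ℝ) ≤ N := by exact_mod_cast (Finset.mem_range.1 hk).le
      gcongr
    have h2 := congrFun (hsum N) h
    simp only [Finset.sum_apply, Pi.add_apply, Pi.sub_apply, Pi.smul_apply, smul_eq_mul] at h2
    have h1' : ∑ k ∈ Finset.range N, (N * c + κ * (M.chan ^ k) b h) =
        N * (N * c) + κ * ∑ k ∈ Finset.range N, (M.chan ^ k) b h := by
      simp [Finset.sum_add_distrib, Finset.mul_sum]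
    rw [h1', h2] at h1
    simp only [Finset.sum_const, Finset.card_range, nsmul_eq_mul] at h1
    have h3 : y h - (M.chan ^ N) y h ≤ 2 * (C * ‖b‖) := by
      have h4 := (norm_le_pi_norm y h).trans hy
      have h5 := (norm_le_pi_norm ((M.chan ^ N) y) h).trans ((M.norm_chan_pow_le N y).trans hy)
      rw [Real.norm_eq_abs] at h4 h5
      linarith [(abs_le.1 h4).2, (abs_le.1 h5).1]
    have h4 : N * d h + y h - (M.chan ^ N) y h ≤
        N * (2 * G + 4 * (1 - α) * (C * ‖b‖)) + 2 * (C * ‖b‖) := by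
      have := mul_le_mul_of_nonneg_left (hdh h) hN0.le
      linarith
    have h5 := mul_le_mul_of_nonneg_left h4 hκ1.le
    have h6 : κ * (4 * (1 - α) * (C * ‖b‖)) ≤ 1 / 4 * ‖b‖ := by
      have h7 : κ * 4 * (1 - α) * C ≤ 1 / 4 := by
        have h8 : κ * 4 * (1 - α) * C ≤ κ * 4 * ε * (C + 1) := by gcongr; linarith
        have h9 : κ * 4 * ε * (C + 1) = 1 / 4 := by rw [hε]; field_simp; norm_num
        linarith
      calc _ = κ * 4 * (1 - α) * C * ‖b‖ := by ring
        _ ≤ _ := by gcongr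
    have h7 : κ * (2 * (C * ‖b‖)) ≤ N * (1 / 4 * ‖b‖) := by
      have := mul_le_mul_of_nonneg_right hN.le (norm_nonneg b)
      linarith
    have h8 := mul_le_mul_of_nonneg_left h6 hN0.le
    refine le_of_mul_le_mul_left ?_ hN0
    linarith
  have hnorm : ‖b‖ ≤ N * c + κ * (2 * G) + 1 / 2 * ‖b‖ := by
    refine (pi_norm_le_iff_of_nonneg (by positivity)).2 fun h => ?_
    rw [Real.norm_of_nonneg (hb0 h)]
    exact hbh h
  intro h
  have h1 := norm_le_pi_norm b h
  rw [Real.norm_of_nonneg (hb0 h)] at h1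
  linarith

lemma best_add_channel (F : List Outcome → H → ℝ) (x : H → ℝ) (l : List Outcome) (h : H) :
    M.best (fun l h => F l h + x h) l h = M.best F l h + M.chan x h := by
  simp only [best]
  rw [next_add (G := fun _ h => x h), next_add (G := fun _ h => x h), next_channel, next_channel,
    min_add_add_right]

/-- The optimality equation of the average-cost problem. Its right-hand side `d + (y - chan y)`
depends on the channel state only; the invariant part `d` is the optimal average cost. It is a limit
of discounted optimality equations along an ultrafilter, and the minimal discounted costs approach
`d`. -/
theorem exists_optimality_equation : ∃ (d y : H → ℝ) (w : List Outcome → H → ℝ),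
    M.chan d = d ∧ (∀ l h, 0 ≤ w l h) ∧ (∀ h, 0 ≤ d h + (y h - M.chan y h)) ∧
    (∀ l h, d h + (y h - M.chan y h) + w l h = M.cost l + M.best w l h) ∧
    (∀ l l', (∀ t, M.cost (t ++ l) = M.cost (t ++ l')) → ∀ h, w l h = w l' h) ∧
    ∀ h x, x < d h → ∀ C, ∃ α, 0 ≤ α ∧ α < 1 ∧ x + (1 - α) * C < (1 - α) * M.val α [] h := by
  obtain ⟨α₀, B, hα₀, hα₀1, hB, hgap⟩ := M.exists_gap_bound
  let 𝒰 : Ultrafilter ℝ := Ultrafilter.of (𝓝[<] (1 : ℝ))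
  have h𝒰 : (𝒰 : Filter ℝ) ≤ 𝓝[<] (1 : ℝ) := Ultrafilter.of_le _
  have hev : ∀ᶠ α in (𝒰 : Filter ℝ), α₀ < α ∧ α < 1 :=
    h𝒰 (Ioo_mem_nhdsLT hα₀1)
  have hlimit : ∀ (u : ℝ → ℝ) (b : ℝ), (∀ α, α₀ < α → α < 1 → 0 ≤ u α ∧ u α ≤ b) →
      ∃ x, 0 ≤ x ∧ Tendsto u 𝒰 (𝓝 x) := by
    intro u b hu
    obtain ⟨x, hx, hlim⟩ := (isCompact_Icc (a := (0 : ℝ)) (b := b)).ultrafilter_le_nhds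
      (𝒰.map u) (by
        rw [le_principal_iff]
        change ∀ᶠ α in (𝒰 : Filter ℝ), u α ∈ Set.Icc 0 b
        filter_upwards [hev] with α hα using hu α hα.1 hα.2)
    exact ⟨x, hx.1, hlim⟩
  have hw : ∀ l h, ∃ x, 0 ≤ x ∧ Tendsto (fun α => M.val α l h - M.val α [] h) 𝒰 (𝓝 x) := by
    intro l h
    refine hlimit _ ((1 + M.Cd * M.W l) * B) fun α h0 h1 => ?_
    have hα0 := hα₀.trans h0.le
    refine ⟨sub_nonneg.2 (M.val_nil_le hα0 h1 l h), ?_⟩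
    have h2 := M.val_le_add_gap hα0 h1 l h
    have h3 := mul_le_mul_of_nonneg_left (hgap α h0 h1 h)
      (add_nonneg zero_le_one (mul_nonneg M.Cd_nonneg (M.W_nonneg l)))
    linarith
  choose w hw0 hwlim using hw
  have hD : ∀ h, ∃ x, 0 ≤ x ∧ Tendsto (fun α => α * M.chan (M.gap α) h) 𝒰 (𝓝 x) := by
    intro h
    refine hlimit _ B fun α h0 h1 => ?_
    have hα0 := hα₀.trans h0.le
    have h2 := M.chan_nonneg (M.gap_nonneg hα0 h1) h
    refine ⟨mul_nonneg hα0 h2, (mul_le_of_le_one_left h2 h1.le).trans ?_⟩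
    have h3 := M.chan_mono (x := M.gap α) (y := fun _ => B) (fun h => hgap α h0 h1 h) h
    rwa [chan_const] at h3
  choose D hD0 hDlim using hD
  obtain ⟨d, y, hdy, hd⟩ := M.exists_ergodic_decomposition D
  have hDh : ∀ h, D h = d h + (y h - M.chan y h) := fun h => congrFun hdy h
  have hid : Tendsto (fun α : ℝ => α) 𝒰 (𝓝 1) := (h𝒰.trans nhdsWithin_le_nhds)
  have hval : ∀ h, Tendsto (fun α => (1 - α) * M.val α [] h) 𝒰 (𝓝 (d h)) := by
    have h1 : Tendsto (fun α => ‖(fun h => α * M.chan (M.gap α) h) - D‖ + 2 * (1 - α) * ‖y‖) 𝒰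
        (𝓝 (‖D - D‖ + 2 * (1 - 1) * ‖y‖)) := by
      refine Tendsto.add ?_ (((tendsto_const_nhds.sub hid).const_mul 2).mul_const _)
      exact ((tendsto_pi_nhds.2 hDlim).sub_const D).norm
    simp only [sub_self, norm_zero, mul_zero, zero_mul, add_zero] at h1
    have h2 : Tendsto (fun α => ‖(1 - α) • M.val α [] - d‖) 𝒰 (𝓝 0) := by
      refine squeeze_zero' (Eventually.of_forall fun _ => norm_nonneg _) ?_ h1
      filter_upwards [hev] with α hα
      have hα0 := hα₀.trans hα.1.le
      refine M.norm_sub_le_of_resolvent hα0 hα.2 hd ?_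
      rw [← hdy, map_smul, smul_comm α, ← smul_sub]
      congr 1
      ext h
      have := M.val_nil_sub hα0 hα.2 h
      simpa using this
    have h3 := tendsto_pi_nhds.1 (tendsto_iff_norm_sub_tendsto_zero.2 h2)
    exact fun h => h3 h
  refine ⟨d, y, w, hd, hw0, fun h => (hDh h) ▸ hD0 h, fun l h => ?_, fun l l' hl h => ?_,
    fun h x hx C => ?_⟩
  · rw [← hDh]
    refine tendsto_nhds_unique ((hDlim h).add (hwlim l h)) ?_
    have h1 := (hid.mul (M.tendsto_best hwlim l h)).const_add (M.cost l)
    rw [one_mul] at h1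
    refine h1.congr' ?_
    filter_upwards [hev] with α hα
    have hα0 := hα₀.trans hα.1.le
    have h2 := M.best_add_channel (fun l h => M.val α l h - M.val α [] h) (M.val α []) l h
    simp only [sub_add_cancel] at h2
    have h3 := M.val_nil_sub hα0 hα.2 h
    have h4 := M.val_eq hα0 hα.2 l h
    have h5 : M.best (fun l h => M.val α l h) l h = M.best (M.val α) l h := rfl
    rw [h5] at h2
    rw [h2] at h4
    linarith
  · refine tendsto_nhds_unique (hwlim l h) ((hwlim l' h).congr fun α => ?_)
    rw [M.val_congr hl h]
  · have h1 : Tendsto (fun α : ℝ => x + (1 - α) * C) 𝒰 (𝓝 (x + (1 - 1) * C)) :=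
      ((tendsto_const_nhds.sub hid).mul_const C).const_add x
    rw [sub_self, zero_mul, add_zero] at h1
    obtain ⟨α, hα, hα'⟩ := ((h1.eventually_lt (hval h) hx).and hev).exists
    exact ⟨α, hα₀.trans hα'.1.le, hα'.2, hα⟩

end Scheduling

end

/-! ### Sufficiency: an optimal stationary policy -/

noncomputable section

variable {n m v Bs Bc : ℕ}

open Filter Topology

lemma pathSum_windowSum_le {α C : ℝ} {f : List Outcome → ℝ} {g : List Outcome → ℝ}
    (h : ∀ l p, pathSum α (fun t => f (t ++ p)) l ≤ C * g p * pathSum α f l)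
    (l p : List Outcome) :
    pathSum α (fun t => windowSum (fun s => f (t ++ s)) p) l ≤
      C * windowSum g p * pathSum α f l := by
  have hex : pathSum α (fun t => windowSum (fun s => f (t ++ s)) p) l =
      windowSum (fun s => pathSum α (fun t => f (t ++ s)) l) p := by
    induction l with
    | nil => rfl
    | cons o l ih =>
      simp only [pathSum, windowSum_add, windowSum_const_mul, ih]
  rw [hex]
  refine (windowSum_mono (h l) p).trans (le_of_eq ?_)
  have : (fun s => C * g s * pathSum α f l) = fun s => C * pathSum α f l * g s := by
    ext s; ring
  rw [this, windowSum_const_mul]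
  ring

/-- If all loss probabilities are below `1 / ρ²`, then the scheduling problem of the networked
control system has the structure required of a `Scheduling`. -/
theorem exists_scheduling [NeZero n] (S : System n m v Bs Bc)
    (hQ : S.Q.PosDef) (hR : S.R.PosDef) (hK : (S.A + S.B * S.K) ^ v = 0)
    {p : ℝ} (hp1 : p ≤ 1) (hp : p * rho S.A ^ 2 < 1)
    (hloss : ∀ h a, (lossProb S h a : ℝ) ≤ p) (hp0 : 0 ≤ p) :
    ∃ M : Scheduling (Channel Bs Bc), M.q = energy S ∧
      (∀ h h', M.P h h' = (channelLaw S h h').toReal) ∧ ∀ h a, M.loss h a = lossProb S h a := by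
  obtain ⟨W, lam, K, C, hW, hlam0, hlam1, hK0, hC, hgain, hdrift⟩ :=
    exists_lyapunov S hK hp0 hp1 hp
  obtain ⟨c₁, c₂, -, hc₂, hc⟩ := exists_energy_bounds S hQ hR
  obtain ⟨Cd, hCd, hdom⟩ := exists_pathSum_energy_append_le S hQ hR hK
  refine ⟨{ P := fun h h' => (channelLaw S h h').toReal
            P_nonneg := fun _ _ => ENNReal.toReal_nonneg
            P_sum := fun h => ?_
            loss := fun h a => lossProb S h a
            loss_nonneg := fun h a => (lossProb S h a).2.1
            loss_le_one := fun h a => (lossProb S h a).2.2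
            q := energy S
            q_nonneg := energy_nonneg S hQ hR
            W := W
            W_nonneg := hW
            good := alternating
            lam := lam
            lam_nonneg := hlam0
            lam_lt_one := hlam1
            K := K
            K_nonneg := hK0
            drift := fun l h => hdrift l _ (lossProb S h _).2.1 (hloss h _)
            Cc := c₂ * C
            Cc_nonneg := by positivity
            cost_le := fun l => ?_
            Cd := Cd * C
            Cd_nonneg := by positivity
            dominated := fun α h0 h1 l p => ?_ }, rfl, fun _ _ => rfl, fun _ _ => rfl⟩
  · have h1 := (channelLaw S h).tsum_coe
    rw [tsum_fintype] at h1
    rw [← ENNReal.toReal_sum fun _ _ => (channelLaw S h).apply_ne_top _, h1, ENNReal.toReal_one]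
  · refine (windowSum_mono (fun t => (hc t).2) l).trans ?_
    rw [windowSum_const_mul, mul_assoc]
    exact mul_le_mul_of_nonneg_left (hgain l) hc₂.le
  · refine (pathSum_windowSum_le (hdom α h0 h1) l p).trans ?_
    have h2 := pathSum_nonneg h0 (energy_nonneg S hQ hR) l
    refine mul_le_mul_of_nonneg_right ?_ h2
    rw [mul_assoc]
    exact mul_le_mul_of_nonneg_left (hgain p) hCd.le

section model

variable {S : System n m v Bs Bc} {M : Scheduling (Channel Bs Bc)}

lemma expect_channelLaw (hMP : ∀ h h', M.P h h' = (channelLaw S h h').toReal)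
    {x : Channel Bs Bc → ℝ} (hx : ∀ h, 0 ≤ x h) (h : Channel Bs Bc) :
    expect (channelLaw S h) (fun h' => ENNReal.ofReal (x h')) =
      ENNReal.ofReal (M.chan x h) := by
  rw [expect, tsum_fintype, Scheduling.chan_apply,
    ENNReal.ofReal_sum_of_nonneg fun h' _ => mul_nonneg (M.P_nonneg h h') (hx h')]
  refine Finset.sum_congr rfl fun h' _ => ?_
  rw [ENNReal.ofReal_mul (M.P_nonneg h h'), hMP,
    ENNReal.ofReal_toReal ((channelLaw S h).apply_ne_top _)]

lemma expect_slot (hMP : ∀ h h', M.P h h' = (channelLaw S h h').toReal)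
    (hML : ∀ h a, M.loss h a = lossProb S h a)
    {F : List Outcome → Channel Bs Bc → ℝ} (hF : ∀ l h, 0 ≤ F l h) (a : Action)
    (l : List Outcome) (h : Channel Bs Bc) :
    (expect (successLaw (lossProb S h a)) fun ok => expect (channelLaw S h) fun h' =>
      ENNReal.ofReal (F ((a, ok) :: l) h')) = ENNReal.ofReal (M.next a F l h) := by
  have h0 : 0 ≤ M.loss h a := M.loss_nonneg h a
  have h1 : 0 ≤ 1 - M.loss h a := sub_nonneg.2 (M.loss_le_one h a)
  have hch := fun ok => M.chan_nonneg (x := F ((a, ok) :: l)) (fun h' => hF _ h') h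
  simp only [fun ok => expect_channelLaw hMP (hF ((a, ok) :: l)) h]
  rw [expect_successLaw, ← hML, ← ENNReal.ofReal_mul h1, ← ENNReal.ofReal_mul h0,
    ← ENNReal.ofReal_add (mul_nonneg h1 (hch _)) (mul_nonneg h0 (hch _))]
  congr 1
  simp only [Scheduling.chan_apply, Scheduling.next, Finset.mul_sum, ← Finset.sum_add_distrib]
  exact Finset.sum_congr rfl fun _ _ => by ring

lemma expect_law_channel (hMP : ∀ h h', M.P h h' = (channelLaw S h h').toReal)
    (π : Policy Bs Bc) (h₀ : Channel Bs Bc) (k : ℕ) {x : Channel Bs Bc → ℝ}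
    (hx : ∀ h, 0 ≤ x h) :
    expect (law S π h₀ k) (fun I => ENNReal.ofReal (x I.2)) =
      ENNReal.ofReal ((M.chan ^ k) x h₀) := by
  induction k generalizing x with
  | zero => simp [law]
  | succ k ih =>
    rw [expect_law_succ]
    simp only [expect_channelLaw hMP hx, expect_const]
    rw [ih (x := M.chan x) fun h => M.chan_nonneg hx h, pow_succ]
    rfl

variable [NeZero v]

lemma stageCost_eq (hQ : S.Q.PosDef) (hR : S.R.PosDef) (hK : (S.A + S.B * S.K) ^ v = 0)
    (hMq : M.q = energy S) (π : Policy Bs Bc) (past : List Outcome) (h₀ : Channel Bs Bc)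
    (k : ℕ) : stageCost S π past h₀ k =
      expect (law S π h₀ k) fun I => ENNReal.ofReal (M.cost (record past I)) := by
  simp only [stageCost, expect, quadCost_eq S hQ hR hK, Scheduling.cost, hMq]

/-- Under a policy that attains the minima in the optimality equation, the total cost exceeds that
of the right-hand side by a bounded amount. -/
lemma sum_stageCost_le (hQ : S.Q.PosDef) (hR : S.R.PosDef) (hK : (S.A + S.B * S.K) ^ v = 0)
    (hMq : M.q = energy S) (hMP : ∀ h h', M.P h h' = (channelLaw S h h').toReal)
    (hML : ∀ h a, M.loss h a = lossProb S h a)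
    {D : Channel Bs Bc → ℝ} {w : List Outcome → Channel Bs Bc → ℝ} (hw : ∀ l h, 0 ≤ w l h)
    (hD : ∀ h, 0 ≤ D h) (heq : ∀ l h, D h + w l h = M.cost l + M.best w l h)
    (f : StationaryPolicy v Bs Bc)
    (hf : ∀ l h, M.best w l h = M.next (f (indicators v l, h)) w l h)
    (past : List Outcome) (h₀ : Channel Bs Bc) (N : ℕ) :
    ∑ k ∈ Finset.range N, stageCost S (f.toPolicy past) past h₀ k ≤
      ENNReal.ofReal (∑ k ∈ Finset.range N, (M.chan ^ k) D h₀ + w past h₀) := by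
  set E : ℕ → ℝ≥0∞ := fun k => expect (law S (f.toPolicy past) h₀ k) fun I =>
    ENNReal.ofReal (w (record past I) I.2) with hE
  have hchan : ∀ k h, 0 ≤ (M.chan ^ k) D h := by
    intro k
    induction k with
    | zero => exact hD
    | succ k ih => rw [pow_succ']; exact M.chan_nonneg ih
  have hstep : ∀ k, stageCost S (f.toPolicy past) past h₀ k + E (k + 1) =
      ENNReal.ofReal ((M.chan ^ k) D h₀) + E k := by
    intro k
    rw [stageCost_eq hQ hR hK hMq, ← expect_law_channel hMP (f.toPolicy past) h₀ k hD]
    simp only [hE]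
    rw [expect_law_succ, ← expect_add, ← expect_add]
    congr 1
    ext I
    rw [StationaryPolicy.toPolicy, expect_pure, ← ENNReal.ofReal_add (hD _) (hw _ _), heq,
      ENNReal.ofReal_add (M.cost_nonneg _) (M.best_nonneg hw _ _), hf,
      ← expect_slot hMP hML hw]
    rfl
  have hsum : ∑ k ∈ Finset.range N, stageCost S (f.toPolicy past) past h₀ k + E N =
      ENNReal.ofReal (∑ k ∈ Finset.range N, (M.chan ^ k) D h₀) + E 0 := by
    induction N with
    | zero => simp
    | succ N ih =>
      rw [Finset.sum_range_succ, add_assoc, hstep, add_left_comm, ih, Finset.sum_range_succ,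
        ENNReal.ofReal_add (Finset.sum_nonneg fun k _ => hchan k h₀) (hchan N h₀)]
      ring
  have hE0 : E 0 = ENNReal.ofReal (w past h₀) := by simp [hE, law, record]
  rw [ENNReal.ofReal_add (Finset.sum_nonneg fun k _ => hchan k h₀) (hw _ _), ← hE0, ← hsum]
  exact le_self_add

/-- No policy has smaller discounted costs than the value iteration. -/
lemma ofReal_valIter_le (hQ : S.Q.PosDef) (hR : S.R.PosDef) (hK : (S.A + S.B * S.K) ^ v = 0)
    (hMq : M.q = energy S) (hMP : ∀ h h', M.P h h' = (channelLaw S h h').toReal)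
    (hML : ∀ h a, M.loss h a = lossProb S h a) {α : ℝ} (hα : 0 ≤ α)
    (π : Policy Bs Bc) (past : List Outcome) (h₀ : Channel Bs Bc) (N k : ℕ) :
    expect (law S π h₀ k) (fun I => ENNReal.ofReal (M.valIter α N (record past I) I.2)) ≤
      ∑ i ∈ Finset.range N, ENNReal.ofReal α ^ i * stageCost S π past h₀ (k + i) := by
  induction N generalizing k with
  | zero => simp [Scheduling.valIter]
  | succ N ih =>
    have h1 := mul_le_mul_right (ih (k + 1)) (ENNReal.ofReal α)
    rw [expect_law_succ, ← expect_const_mul, Finset.mul_sum] at h1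
    rw [Finset.sum_range_succ', pow_zero, one_mul, add_zero,
      stageCost_eq hQ hR hK hMq (k := k)]
    have h2 : ∑ i ∈ Finset.range N, ENNReal.ofReal α *
        (ENNReal.ofReal α ^ i * stageCost S π past h₀ (k + 1 + i)) =
        ∑ i ∈ Finset.range N, ENNReal.ofReal α ^ (i + 1) *
          stageCost S π past h₀ (k + (i + 1)) := by
      refine Finset.sum_congr rfl fun i _ => ?_
      rw [pow_succ', mul_assoc, add_assoc, add_comm 1 i]
    rw [h2] at h1
    refine le_trans ?_ ((add_le_add le_rfl h1).trans (add_comm _ _).le)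
    rw [← expect_add]
    refine expect_mono _ fun I => ?_
    have hb := M.best_nonneg (M.valIter_nonneg hα N) (record past I) I.2
    rw [Scheduling.valIter_succ, ENNReal.ofReal_add (M.cost_nonneg _) (mul_nonneg hα hb),
      ENNReal.ofReal_mul hα]
    refine add_le_add le_rfl (mul_le_mul_right (le_expect _ fun a => ?_) _)
    refine (ENNReal.ofReal_le_ofReal (M.best_le _ a _ _)).trans (le_of_eq ?_)
    rw [← expect_slot hMP hML (M.valIter_nonneg hα N)]
    rfl

end model

lemma sum_pow_mul_le {α : ℝ} (hα0 : 0 ≤ α) (hα1 : α ≤ 1) (N : ℕ) {t : ℕ → ℝ} {C : ℝ}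
    (hC : 0 ≤ C) (h : ∀ n, ∑ k ∈ Finset.range n, t k ≤ C) :
    ∑ k ∈ Finset.range N, α ^ k * t k ≤ C := by
  induction N generalizing t C with
  | zero => simpa using hC
  | succ N ih =>
    have h0 : t 0 ≤ C := by simpa using h 1
    have h1 := ih (t := fun k => t (k + 1)) (C := C - t 0) (by linarith) fun n => by
      have := h (n + 1)
      rw [Finset.sum_range_succ'] at this
      linarith
    rw [Finset.sum_range_succ']
    have h2 : ∑ k ∈ Finset.range N, α ^ (k + 1) * t (k + 1) =
        α * ∑ k ∈ Finset.range N, α ^ k * t (k + 1) := by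
      rw [Finset.mul_sum]
      exact Finset.sum_congr rfl fun k _ => by ring
    rw [h2]
    have h3 := mul_le_mul_of_nonneg_left h1 hα0
    have h4 := mul_le_of_le_one_left (sub_nonneg.2 h0) hα1
    simp only [pow_zero, one_mul]
    linarith

/-- An Abelian inequality: discounted totals are bounded by the upper Cesàro mean. -/
lemma exists_sum_pow_mul_le {s : ℕ → ℝ≥0∞} {x : ℝ}
    (h : limsup (fun N : ℕ => (∑ k ∈ Finset.range N, s k) / (N : ℝ≥0∞)) atTop <
      ENNReal.ofReal x) :
    ∃ C : ℝ, ∀ α : ℝ, 0 ≤ α → α < 1 → ∀ N,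
      ∑ k ∈ Finset.range N, ENNReal.ofReal α ^ k * s k ≤ ENNReal.ofReal (x / (1 - α) + C) := by
  have hx : 0 < x := ENNReal.ofReal_pos.1 (bot_le.trans_lt h)
  obtain ⟨N₀, hN₀⟩ := eventually_atTop.1 (eventually_lt_of_limsup_lt h)
  have hlarge : ∀ N, max N₀ 1 ≤ N → ∑ k ∈ Finset.range N, s k ≤ ENNReal.ofReal (x * N) := by
    intro N hN
    have h1 := hN₀ N ((le_max_left _ _).trans hN)
    have hN1 : 1 ≤ N := (le_max_right _ _).trans hN
    have h2 := (ENNReal.div_le_iff (by positivity) (by simp)).1 h1.le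
    rwa [ENNReal.ofReal_mul hx.le, ENNReal.ofReal_natCast]
  have hfin : ∀ k, s k ≠ ∞ := by
    intro k
    have h1 := hlarge (max N₀ 1 + k + 1) (by omega)
    refine ((Finset.single_le_sum (f := s) (fun _ _ => zero_le) (Finset.mem_range.2
      (show k < max N₀ 1 + k + 1 by omega))).trans_lt (h1.trans_lt ENNReal.ofReal_lt_top)).ne
  have hs : ∀ k, s k = ENNReal.ofReal (s k).toReal := fun k => (ENNReal.ofReal_toReal (hfin k)).symm
  set C := ∑ k ∈ Finset.range (max N₀ 1), (s k).toReal with hC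
  have hC0 : 0 ≤ C := Finset.sum_nonneg fun _ _ => ENNReal.toReal_nonneg
  have hreal : ∀ N, ∑ k ∈ Finset.range N, ((s k).toReal - x) ≤ C := by
    intro N
    rw [Finset.sum_sub_distrib, Finset.sum_const, Finset.card_range, nsmul_eq_mul]
    have hxN : 0 ≤ N * x := by positivity
    rcases le_total (max N₀ 1) N with hN | hN
    · have h1 := ENNReal.toReal_mono ENNReal.ofReal_ne_top (hlarge N hN)
      rw [ENNReal.toReal_sum fun k _ => hfin k, ENNReal.toReal_ofReal (by positivity)] at h1
      linarith
    · have : ∑ k ∈ Finset.range N, (s k).toReal ≤ C :=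
        Finset.sum_le_sum_of_subset_of_nonneg (Finset.range_mono hN)
          fun _ _ _ => ENNReal.toReal_nonneg
      linarith
  refine ⟨C, fun α hα0 hα1 N => ?_⟩
  have h1 := sum_pow_mul_le hα0 hα1.le N hC0 hreal
  have h2 : ∑ k ∈ Finset.range N, ENNReal.ofReal α ^ k * s k =
      ENNReal.ofReal (∑ k ∈ Finset.range N, α ^ k * (s k).toReal) := by
    rw [ENNReal.ofReal_sum_of_nonneg fun k _ => by positivity]
    refine Finset.sum_congr rfl fun k _ => ?_
    rw [ENNReal.ofReal_mul (by positivity), ENNReal.ofReal_pow hα0, ← hs]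
  have h3 : ∑ k ∈ Finset.range N, α ^ k ≤ (1 - α)⁻¹ := by
    rw [← tsum_geometric_of_lt_one hα0 hα1]
    exact (summable_geometric_of_lt_one hα0 hα1).sum_le_tsum _ fun i _ => pow_nonneg hα0 i
  have h4 : ∑ k ∈ Finset.range N, α ^ k * ((s k).toReal - x) =
      ∑ k ∈ Finset.range N, α ^ k * (s k).toReal - x * ∑ k ∈ Finset.range N, α ^ k := by
    rw [Finset.mul_sum, ← Finset.sum_sub_distrib]
    exact Finset.sum_congr rfl fun k _ => by ring
  rw [h2]
  refine ENNReal.ofReal_le_ofReal ?_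
  have h5 := mul_le_mul_of_nonneg_left h3 hx.le
  rw [div_eq_mul_inv]
  linarith

/-- If packets of both kinds get through well enough in all channel states, then a stationary
deterministic policy is optimal and stabilizes the plant. -/
theorem sufficiency [NeZero v] [NeZero Bs] [NeZero Bc] (S : System n m v Bs Bc)
    (hQ : S.Q.PosDef) (hR : S.R.PosDef) (hA : 1 < rho S.A) (hK : (S.A + S.B * S.K) ^ v = 0)
    (hp : max (⨆ i, (S.ω i : ℝ)) (⨆ j, (S.ξ j : ℝ)) < 1 / rho S.A ^ 2) :
    ∃ f : StationaryPolicy v Bs Bc, IsOptimal S f ∧ Stabilizes S f := by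
  classical
  have hn := neZero_of_one_lt_rho hA
  set p := max (⨆ i, (S.ω i : ℝ)) (⨆ j, (S.ξ j : ℝ)) with hpdef
  have hρ : 0 < rho S.A ^ 2 := by positivity
  have hloss : ∀ h a, (lossProb S h a : ℝ) ≤ p := by
    intro h a
    cases a
    · exact (le_ciSup (f := fun i => (S.ω i : ℝ)) (Set.finite_range _).bddAbove h.1).trans
        (le_max_left _ _)
    · exact (le_ciSup (f := fun j => (S.ξ j : ℝ)) (Set.finite_range _).bddAbove h.2).trans
        (le_max_right _ _)
  have hp0 : 0 ≤ p := (lossProb S (0, 0) Action.sense).2.1.trans (hloss _ _)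
  have hp1 : p ≤ 1 := max_le (ciSup_le fun i => (S.ω i).2.2) (ciSup_le fun j => (S.ξ j).2.2)
  obtain ⟨M, hMq, hMP, hML⟩ := exists_scheduling S hQ hR hK hp1
    ((lt_div_iff₀ hρ).1 hp) hloss hp0
  obtain ⟨d, y, w, hd, hw, hD, heq, hcongr, hlower⟩ := M.exists_optimality_equation
  -- the relative value is a function of the indicators, hence so is a minimizing action
  have hind : ∀ l l', indicators v l = indicators v l' → ∀ h, w l h = w l' h := by
    intro l l' hl
    refine hcongr l l' fun t => ?_
    rw [Scheduling.cost, Scheduling.cost, hMq]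
    refine windowSum_energy_congr S hK ?_
    induction t with
    | nil => exact hl
    | cons o t ih => simp only [List.cons_append, indicators, ih]
  have hnext : ∀ l l', indicators v l = indicators v l' → ∀ a h,
      M.next a w l h = M.next a w l' h := by
    intro l l' hl a h
    have h1 : ∀ o h', w (o :: l) h' = w (o :: l') h' := fun o h' =>
      hind _ _ (by simp only [indicators, hl]) h'
    exact le_antisymm (Scheduling.next_mono_at fun o h' => (h1 o h').le)
      (Scheduling.next_mono_at fun o h' => (h1 o h').ge)
  choose a ha using M.exists_best w
  let f : StationaryPolicy v Bs Bc := fun s =>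
    if hs : ∃ l, indicators v l = s.1 then a hs.choose s.2 else Action.sense
  have hf : ∀ l h, M.best w l h = M.next (f (indicators v l, h)) w l h := by
    intro l h
    have hex : ∃ l', indicators v l' = indicators v l := ⟨l, rfl⟩
    have h1 : f (indicators v l, h) = a hex.choose h := dif_pos hex
    have h2 := hnext _ _ hex.choose_spec
    rw [h1, ← h2, ← ha, Scheduling.best, Scheduling.best, h2, h2]
  have hupper : ∀ past h₀, avgCost S (f.toPolicy past) past h₀ ≤ ENNReal.ofReal (d h₀) := by
    intro past h₀
    set C := 2 * ‖y‖ + w past h₀ with hC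
    have hsum : ∀ N : ℕ, ∑ k ∈ Finset.range N,
        (M.chan ^ k) (fun h => d h + (y h - M.chan y h)) h₀ ≤ N * d h₀ + 2 * ‖y‖ := by
      intro N
      have hdk : ∀ k, (M.chan ^ k) d = d := by
        intro k
        induction k with
        | zero => rfl
        | succ k ih => rw [pow_succ', Module.End.mul_apply, ih, hd]
      have h1 : ∀ k, (M.chan ^ k) (fun h => d h + (y h - M.chan y h)) h₀ =
          d h₀ + ((M.chan ^ k) y h₀ - (M.chan ^ (k + 1)) y h₀) := by
        intro k
        have : (fun h => d h + (y h - M.chan y h)) = d + (y - M.chan y) := rfl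
        rw [this, map_add, map_sub, hdk, pow_succ]
        rfl
      simp only [h1, Finset.sum_add_distrib, Finset.sum_const, Finset.card_range, nsmul_eq_mul]
      rw [Finset.sum_range_sub' (fun k => (M.chan ^ k) y h₀)]
      have h2 := norm_le_pi_norm y h₀
      have h3 := (norm_le_pi_norm ((M.chan ^ N) y) h₀).trans (M.norm_chan_pow_le N y)
      rw [Real.norm_eq_abs] at h2 h3
      have h4 : (M.chan ^ 0) y h₀ = y h₀ := rfl
      linarith [(abs_le.1 h2).2, (abs_le.1 h3).1]
    have hbound : ∀ᶠ N : ℕ in atTop,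
        (∑ k ∈ Finset.range N, stageCost S (f.toPolicy past) past h₀ k) / (N : ℝ≥0∞) ≤
          ENNReal.ofReal (d h₀ + C / N) := by
      filter_upwards [eventually_ge_atTop 1] with N hN
      have hN0 : (0 : ℝ) < N := by exact_mod_cast hN
      rw [ENNReal.div_le_iff (by positivity) (by simp), ← ENNReal.ofReal_natCast,
        ← ENNReal.ofReal_mul' hN0.le]
      refine (sum_stageCost_le hQ hR hK hMq hMP hML hw hD heq f hf past h₀ N).trans
        (ENNReal.ofReal_le_ofReal ?_)
      have h1 : (d h₀ + C / N) * N = N * d h₀ + C := by field_simp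
      rw [h1, hC]
      linarith [hsum N]
    have hlim : Tendsto (fun N : ℕ => ENNReal.ofReal (d h₀ + C / N)) atTop
        (𝓝 (ENNReal.ofReal (d h₀))) := by
      refine ENNReal.tendsto_ofReal ?_
      simpa using (tendsto_const_div_atTop_nhds_zero_nat C).const_add (d h₀)
    exact (limsup_le_limsup hbound).trans hlim.limsup_eq.le
  refine ⟨f, fun past _ h₀ π => (hupper past h₀).trans ?_,
    fun past _ h₀ => (hupper past h₀).trans_lt ENNReal.ofReal_lt_top⟩
  by_contra hcon
  obtain ⟨x, hx1, hx2⟩ := ENNReal.lt_iff_exists_real_btwn.1 (not_le.1 hcon) |>.imp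
    fun x hx => hx.2
  have hxd : x < d h₀ := by
    by_contra hle
    exact hx2.not_ge (ENNReal.ofReal_le_ofReal (not_lt.1 hle))
  obtain ⟨C, hC⟩ := exists_sum_pow_mul_le hx1
  obtain ⟨α, hα0, hα1, hα⟩ := hlower h₀ x hxd |C|
  have hα' : 0 < 1 - α := sub_pos.2 hα1
  have hx0 : 0 < x := ENNReal.ofReal_pos.1 (bot_le.trans_lt hx1)
  have hval : M.val α past h₀ ≤ x / (1 - α) + |C| := by
    refine M.val_le_of_forall fun N => ?_
    have h1 := ofReal_valIter_le hQ hR hK hMq hMP hML hα0 π past h₀ N 0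
    simp only [zero_add] at h1
    have h2 := h1.trans ((hC α hα0 hα1 N).trans
      (ENNReal.ofReal_le_ofReal (add_le_add le_rfl (le_abs_self C))))
    rw [law, expect_pure] at h2
    have hpos : 0 ≤ x / (1 - α) + |C| := by positivity
    simpa [record] using (ENNReal.ofReal_le_ofReal_iff hpos).1 h2
  have h1 := mul_le_mul_of_nonneg_left ((M.val_nil_le hα0 hα1 past h₀).trans hval) hα'.le
  have h2 : (1 - α) * (x / (1 - α) + |C|) = x + (1 - α) * |C| := by field_simp
  linarith

end

end WNCS

theorem theorem4 {n m v Bs Bc : ℕ} [NeZero v] [NeZero Bs] [NeZero Bc]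
    (S : WNCS.System n m v Bs Bc)
    (hQ : S.Q.PosDef) (hR : S.R.PosDef)
    (hA : 1 < WNCS.rho S.A)
    (hK : (S.A + S.B * S.K) ^ v = 0) :
    ((∃ f : WNCS.StationaryPolicy v Bs Bc, WNCS.IsOptimal S f ∧ WNCS.Stabilizes S f) →
      max (⨅ i, (S.ω i : ℝ)) (⨅ j, (S.ξ j : ℝ)) < 1 / WNCS.rho S.A ^ 2) ∧
    (max (⨆ i, (S.ω i : ℝ)) (⨆ j, (S.ξ j : ℝ)) < 1 / WNCS.rho S.A ^ 2 →
      ∃ f : WNCS.StationaryPolicy v Bs Bc, WNCS.IsOptimal S f ∧ WNCS.Stabilizes S f) := by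
  refine ⟨?_, WNCS.sufficiency S hQ hR hA hK⟩
  rintro ⟨f, -, hf⟩
  have hwarm : WNCS.Warm v (List.replicate v WNCS.controlled ++ [WNCS.sensed]) :=
    ⟨_, _, rfl, by simp, by simp⟩
  exact WNCS.necessity S hQ hR hA hK (hf _ hwarm (0, 0))
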